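/- **Setting.** Let $I=[0,1]$, $n\ge 1$, and let $m$ be Lebesgue measure. For $g:I^n\to\mathbb R$ let $\mathbf V_i g$ be the function of the $n-1$ variables $(x_j)_{j\ne i}$ whose value is the total variation of $x_i\mapsto g(x_1,\dots,x_n)$ on $[0,1]$. For $f\in L^1(I^n)$ put $$\mathbb V_i f=\inf\Big\{\int_{I^{n-1}}\mathbf V_i g\,dm:\ g=f\text{ a.e.},\ \mathbf V_i g\text{ measurable}\Big\},\qquad \mathbb V f=\max_{1\le i\le n}\mathbb V_i f,$$ and let $BV(I^n)=\{f\in L^1(I^n):\mathbb Vf<\infty\}$ with norm $\|f\|_{BV}=\|f\|_1+\mathbb Vf$. Let $\Omega$ be a Polish space with a Borel probability measure $\mathbb P$ and $\sigma:\Omega\to\Omega$ an invertible, ergodic, $\mathbb P$-preserving transformation. Fix points $0=a_{i,0}<a_{i,1}<\dots<a_{i,r_i}=1$ for $i=1,\dots,n$, and for $s=(s_1,\dots,s_n)$ with $1\le s_i\le r_i$ let $B_s$ be the product of the intervals $[a_{i,s_i-1},a_{i,s_i})$ (closed on the right if $a_{i,s_i}=1$). An *admissible random Jabłoński map* is a family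 $\{f_\omega\}_{\omega\in\Omega}$ of maps $f_\omega:I^n\to I^n$ with $$f_\omega(x)=(\varphi_{\omega,1,s}(x_1),\dots,\varphi_{\omega,n,s}(x_n)),\qquad x\in B_s,$$ such that every $\varphi_{\omega,i,s}$ is $C^2$ and monotonic on $[a_{i,s_i-1},a_{i,s_i}]$; such that for some $\gamma>0$ $$\int_\Omega\min_{1\le i\le n}\log\gamma_i(\omega)\,d\mathbb P(\omega)>\gamma,\qquad \gamma_i(\omega)=\inf_{s,\ x_i\in[a_{i,s_i-1},a_{i,s_i}]}|\varphi_{\omega,i,s}'(x_i)|$$ (with $\log 0=-\infty$); and such that $\omega\mapsto\mathcal L_\omega$ is $\mathbb P$-continuous, i.e. $\Omega$ is a countable union of Borel sets on each of which this map is continuous in operator norm. Here $\mathcal L_\omega$ is the transfer operator of $f_\omega$ on $BV(I^n)$, given by $\int_A\mathcal L_\omega h\,dm=\int_{f_\omega^{-1}A}h\,dm$ for all Borel $A\subseteq I^n$ (put $\mathcal L_\omega=0$ for those $\omega$ for which no bounded operator on $BV(I^n)$ has this property). Let $\mathcal L^{(k)}_\omega=\mathcal L_{\sigma^{k-1}\omega}\circ\dots\circ\mathcal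 L_\omega$. For a bounded operator $A$ on $BV(I^n)$ let $\|A\|_{ic}$ be the infimum of all $r>0$ such that the image under $A$ of the unit ball is covered by finitely many balls of radius $r$. **Theorem.** Let $\{f_\omega\}_{\omega\in\Omega}$ be an admissible random Jabłoński map, and assume $\int_\Omega\log^+\|\mathcal L_\omega\|_{BV}\,d\mathbb P(\omega)<\infty$. Then: 1. For $\mathbb P$-a.e. $\omega$ the transfer operator of $f_\omega$ is a bounded operator on $BV(I^n)$. There are an integer $N\ge1$ and measurable functions $\alpha_1,\alpha_2:\Omega\to(0,\infty)$ such that $\log\alpha_1$ is integrable, $\int_\Omega\log\alpha_1\,d\mathbb P<0$, and for $\mathbb P$-a.e. $\omega$ $$\mathbb V\mathcal L^{(N)}_\omega h\le\alpha_1(\omega)\,\mathbb Vh+\alpha_2(\omega)\,\|h\|_1\qquad\text{for all }h\in BV(I^n).$$ 2. The cocycle is quasi-compact: the limits $$\mathcal K^*=\lim_{k\to\infty}\tfrac1k\log\|\mathcal L^{(k)}_\omega\|_{ic}\in[-\infty,\infty),\qquad \lambda^*=\lim_{k\to\infty}\tfrac1k\log\|\mathcal L^{(k)}_\omega\|_{BV}$$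 exist and are constant for $\mathbb P$-a.e. $\omega$, and $\mathcal K^*<\lambda^*$. 3. The maximal Lyapunov exponent is $\lambda^*=0$. -/

import Mathlib

open MeasureTheory Set Filter Topology
open scoped ENNReal NNReal

namespace Jab

noncomputable section

/-- The unit cube `[0,1]^n`. -/
abbrev Cube (n : ℕ) : Type := Fin n → unitInterval

/-- The variation of `g` in the `i`-th coordinate, as a function of the remaining coordinates. -/
def lineVar {d : ℕ} (i : Fin (d + 1)) (g : Cube (d + 1) → ℝ) (y : Cube d) : ℝ≥0∞ :=
  eVariationOn (fun t : unitInterval => g (i.insertNth t y)) univ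

/-- The `i`-th directional variation of an a.e.-class: the infimum of `∫ lineVar i g` over all
representatives `g` for which `lineVar i g` is (Lebesgue) measurable. -/
def dirVar {d : ℕ} (i : Fin (d + 1)) (f : Cube (d + 1) → ℝ) : ℝ≥0∞ :=
  ⨅ (g : Cube (d + 1) → ℝ) (_ : g =ᵐ[volume] f) (_ : AEMeasurable (lineVar i g) volume),
    ∫⁻ y, lineVar i g y

/-- The Tonelli–Cesari total variation: the maximum of the directional variations. -/
def totalVar {d : ℕ} (f : Cube (d + 1) → ℝ) : ℝ≥0∞ := ⨆ i, dirVar i f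


/-! ### Regularised representatives, needed for the triangle inequality of the variation -/

theorem mix_mem (m : ℕ) (t s : unitInterval) :
    (1 - 1 / ((m : ℝ) + 1)) * (t : ℝ) + 1 / ((m : ℝ) + 1) * (s : ℝ) ∈ unitInterval := by
  have h0 : (0 : ℝ) < 1 / ((m : ℝ) + 1) := Nat.one_div_pos_of_nat
  have h1 : 1 / ((m : ℝ) + 1) ≤ 1 := by
    rw [div_le_one (by positivity)]; linarith [(Nat.cast_nonneg m : (0 : ℝ) ≤ m)]
  obtain ⟨a, b⟩ := t.2
  obtain ⟨c, d⟩ := s.2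
  constructor <;> nlinarith

/-- The point at fraction `1 / (m + 1)` of the way from `t` to `s`. -/
def mix (m : ℕ) (t s : unitInterval) : unitInterval := ⟨_, mix_mem m t s⟩

/-- Averages of `u` over small intervals containing `t`. -/
def avg (m : ℕ) (u : unitInterval → ℝ) (t : unitInterval) : ℝ := ∫ s, u (mix m t s)

theorem continuous_mix (m : ℕ) :
    Continuous (fun p : unitInterval × unitInterval => mix m p.1 p.2) := by
  unfold mix; fun_prop

theorem qmp_mix (m : ℕ) (t : unitInterval) :
    Measure.QuasiMeasurePreserving (mix m t) volume volume := by
  have hm : Measurable (mix m t) := by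
    have := (continuous_mix m).comp (Continuous.prodMk_right t)
    exact this.measurable
  refine ⟨hm, Measure.AbsolutelyContinuous.mk fun N hN h0 => ?_⟩
  rw [Measure.map_apply hm hN, unitInterval.volume_apply]
  rw [unitInterval.volume_apply] at h0
  have hc : (1 : ℝ) / ((m : ℝ) + 1) ≠ 0 := by positivity
  have : Subtype.val '' (mix m t ⁻¹' N) ⊆ (fun x : ℝ => 1 / ((m : ℝ) + 1) * x) ⁻¹'
      ((fun x : ℝ => (1 - 1 / ((m : ℝ) + 1)) * (t : ℝ) + x) ⁻¹' (Subtype.val '' N)) := by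
    rintro _ ⟨s, hs, rfl⟩
    exact ⟨_, hs, rfl⟩
  refine measure_mono_null this ?_
  rw [Real.volume_preimage_mul_left hc, measure_preimage_add, h0, mul_zero]

theorem bv_countable {u : unitInterval → ℝ} (hu : eVariationOn u univ ≠ ⊤) :
    {t | ¬ ContinuousAt u t}.Countable := by
  have hu' : BoundedVariationOn u univ := hu
  obtain ⟨p, q, hp, hq, h⟩ :=
    hu'.locallyBoundedVariationOn.exists_monotoneOn_sub_monotoneOn
  rw [monotoneOn_univ] at hp hq
  refine (hp.countable_not_continuousAt.union hq.countable_not_continuousAt).mono ?_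
  intro t ht
  by_contra hc
  simp only [mem_union, mem_ofPred_eq, not_or, not_not] at hc
  exact ht (h ▸ hc.1.sub hc.2)

theorem bv_measurable {u : unitInterval → ℝ} (hu : eVariationOn u univ ≠ ⊤) : Measurable u :=
  measurable_of_countable_not_continuousAt (bv_countable hu)

theorem bv_bound {u : unitInterval → ℝ} (hu : eVariationOn u univ ≠ ⊤) :
    ∃ C, ∀ t, ‖u t‖ ≤ C := by
  have hu' : BoundedVariationOn u univ := hu
  refine ⟨|u 0| + (eVariationOn u univ).toReal, fun t => ?_⟩
  have := hu'.dist_le (mem_univ t) (mem_univ 0)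
  rw [Real.dist_eq] at this
  rw [Real.norm_eq_abs]
  linarith [abs_sub_abs_le_abs_sub (u t) (u 0)]

theorem measurable_mix_right (m : ℕ) (t : unitInterval) : Measurable (mix m t) :=
  (qmp_mix m t).measurable

theorem bv_integrable {u : unitInterval → ℝ} (hu : eVariationOn u univ ≠ ⊤) (m : ℕ)
    (t : unitInterval) : Integrable (fun s => u (mix m t s)) := by
  obtain ⟨C, hC⟩ := bv_bound hu
  exact Integrable.of_bound ((bv_measurable hu).comp (measurable_mix_right m t)).aestronglyMeasurable
    C (Eventually.of_forall fun s => hC _)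

theorem mix_mono (m : ℕ) (s : unitInterval) : Monotone fun t => mix m t s := by
  intro a b hab
  have h1 : 1 / ((m : ℝ) + 1) ≤ 1 := by
    rw [div_le_one (by positivity)]; linarith [(Nat.cast_nonneg m : (0 : ℝ) ≤ m)]
  have hab' : (a : ℝ) ≤ b := hab
  change (_ : ℝ) ≤ _
  have := mul_le_mul_of_nonneg_left hab' (sub_nonneg.2 h1)
  simpa [mix] using this

theorem var_avg_le {u : unitInterval → ℝ} (hu : eVariationOn u univ ≠ ⊤) (m : ℕ) :
    eVariationOn (avg m u) univ ≤ eVariationOn u univ := by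
  have hmeas := bv_measurable hu
  refine iSup_le fun ⟨n, v, hv, _⟩ => ?_
  dsimp only
  calc ∑ i ∈ Finset.range n, edist (avg m u (v (i + 1))) (avg m u (v i))
      ≤ ∑ i ∈ Finset.range n, ∫⁻ s, edist (u (mix m (v (i + 1)) s)) (u (mix m (v i) s)) := by
        refine Finset.sum_le_sum fun i _ => ?_
        rw [edist_eq_enorm_sub, avg, avg, ← integral_sub (bv_integrable hu m _)
          (bv_integrable hu m _)]
        refine (enorm_integral_le_lintegral_enorm _).trans (le_of_eq ?_)
        simp only [edist_eq_enorm_sub]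
    _ = ∫⁻ s, ∑ i ∈ Finset.range n, edist (u (mix m (v (i + 1)) s)) (u (mix m (v i) s)) := by
        rw [lintegral_finsetSum]
        intro i _
        exact (hmeas.comp (measurable_mix_right m _)).edist
          (hmeas.comp (measurable_mix_right m _))
    _ ≤ ∫⁻ _ : unitInterval, eVariationOn u univ := by
        refine lintegral_mono fun s => ?_
        exact eVariationOn.sum_le (f := u) (u := fun i => mix m (v i) s)
          ((mix_mono m s).comp hv) (fun _ => mem_univ _)
    _ = eVariationOn u univ := by simp

theorem tendsto_mix (t s : unitInterval) : Tendsto (fun m => mix m t s) atTop (𝓝 t) := by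
  rw [tendsto_subtype_rng]
  have h := tendsto_one_div_add_atTop_nhds_zero_nat (𝕜 := ℝ)
  have := ((tendsto_const_nhds (x := (1 : ℝ))).sub h).mul_const (t : ℝ) |>.add (h.mul_const (s : ℝ))
  simpa [mix] using this

theorem mix_gt (m : ℕ) {t s : unitInterval} (h : t < s) : t < mix m t s := by
  have h0 : (0 : ℝ) < 1 / ((m : ℝ) + 1) := Nat.one_div_pos_of_nat
  have h' : (t : ℝ) < s := h
  change (_ : ℝ) < (1 - 1 / ((m : ℝ) + 1)) * (t : ℝ) + 1 / ((m : ℝ) + 1) * (s : ℝ)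
  nlinarith

theorem mix_lt (m : ℕ) {t s : unitInterval} (h : s < t) : mix m t s < t := by
  have h0 : (0 : ℝ) < 1 / ((m : ℝ) + 1) := Nat.one_div_pos_of_nat
  have h' : (s : ℝ) < t := h
  change (1 - 1 / ((m : ℝ) + 1)) * (t : ℝ) + 1 / ((m : ℝ) + 1) * (s : ℝ) < (_ : ℝ)
  nlinarith

theorem avg_tendsto_lim {u : unitInterval → ℝ} (hu : eVariationOn u univ ≠ ⊤) (t : unitInterval) :
    ∃ l, Tendsto (fun m => avg m u t) atTop (𝓝 l) := by
  have hu' : BoundedVariationOn u univ := hu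
  obtain ⟨C, hC⟩ := bv_bound hu
  refine ⟨∫ s, if t < s then Function.rightLim u t else Function.leftLim u t, ?_⟩
  refine tendsto_integral_of_dominated_convergence (fun _ => C)
    (fun m => (bv_integrable hu m t).aestronglyMeasurable) (integrable_const _)
    (fun m => Eventually.of_forall fun s => hC _) ?_
  have hne : ∀ᵐ s : unitInterval, s ≠ t := by simp [ae_iff]
  filter_upwards [hne] with s hs
  rcases lt_or_gt_of_ne hs with h | h
  · rw [if_neg h.not_gt]
    exact (hu'.tendsto_leftLim t).comp (tendsto_nhdsWithin_iff.2
      ⟨tendsto_mix t s, Eventually.of_forall fun m => mix_lt m h⟩)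
  · rw [if_pos h]
    exact (hu'.tendsto_rightLim t).comp (tendsto_nhdsWithin_iff.2
      ⟨tendsto_mix t s, Eventually.of_forall fun m => mix_gt m h⟩)

theorem avg_tendsto_self {u : unitInterval → ℝ} (hu : eVariationOn u univ ≠ ⊤) :
    ∀ᵐ t, Tendsto (fun m => avg m u t) atTop (𝓝 (u t)) := by
  obtain ⟨C, hC⟩ := bv_bound hu
  filter_upwards [(bv_countable hu).ae_notMem volume] with t ht
  simp only [not_not] at ht
  have : u t = ∫ _ : unitInterval, u t := by simp
  rw [this]
  refine tendsto_integral_of_dominated_convergence (fun _ => C)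
    (fun m => (bv_integrable hu m t).aestronglyMeasurable) (integrable_const _)
    (fun m => Eventually.of_forall fun s => hC _) (Eventually.of_forall fun s => ?_)
  exact ht.tendsto.comp (tendsto_mix t s)

theorem mix_left_injective (m : ℕ) (t : unitInterval) : Function.Injective (mix m t) := by
  intro a b h
  have h0 : (0 : ℝ) < 1 / ((m : ℝ) + 1) := Nat.one_div_pos_of_nat
  have := congrArg Subtype.val h
  simp only [mix, add_right_inj] at this
  exact Subtype.ext (mul_left_cancel₀ h0.ne' this)

theorem avg_continuous {u : unitInterval → ℝ} (hu : eVariationOn u univ ≠ ⊤) (m : ℕ) :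
    Continuous (avg m u) := by
  obtain ⟨C, hC⟩ := bv_bound hu
  rw [continuous_iff_continuousAt]
  intro t
  refine continuousAt_of_dominated (bound := fun _ => C)
    (Eventually.of_forall fun x => (bv_integrable hu m x).aestronglyMeasurable)
    (Eventually.of_forall fun x => Eventually.of_forall fun s => hC _) (integrable_const _) ?_
  have h1 : {s | ¬ ContinuousAt u (mix m t s)}.Countable :=
    (bv_countable hu).preimage (mix_left_injective m t)
  filter_upwards [h1.ae_notMem volume] with s hs
  simp only [not_not] at hs
  have : ContinuousAt (fun x => mix m x s) t :=
    ((continuous_mix m).comp (Continuous.prodMk_left s)).continuousAt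
  exact ContinuousAt.comp (f := fun x => mix m x s) hs this

theorem avg_congr {u v : unitInterval → ℝ} (h : u =ᵐ[volume] v) (m : ℕ) : avg m u = avg m v := by
  funext t
  exact integral_congr_ae ((qmp_mix m t).ae_eq_comp h)

theorem grid_mem (k j : ℕ) (h : j ≤ k) : (j : ℝ) / ((k : ℝ)) ∈ unitInterval :=
  ⟨by positivity, div_le_one_of_le₀ (by exact_mod_cast h) (by positivity)⟩

/-- The grid point `j / k`, truncated at `1`. -/
def gridPt (k j : ℕ) : unitInterval := ⟨_, grid_mem k (min j k) (min_le_right _ _)⟩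

theorem gridPt_mono (k : ℕ) : Monotone (gridPt k) := by
  intro a b h
  change ((min a k : ℕ) : ℝ) / (k : ℝ) ≤ ((min b k : ℕ) : ℝ) / (k : ℝ)
  gcongr

/-- The variation of `w` along the grid of mesh `1 / k`. -/
def gridVar (k : ℕ) (w : unitInterval → ℝ) : ℝ≥0∞ :=
  ∑ j ∈ Finset.range k, edist (w (gridPt k (j + 1))) (w (gridPt k j))

theorem gridVar_le (k : ℕ) (w : unitInterval → ℝ) : gridVar k w ≤ eVariationOn w univ :=
  eVariationOn.sum_le (gridPt_mono k) (fun _ => mem_univ _)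

theorem var_round (k : ℕ) (w : unitInterval → ℝ) :
    eVariationOn (fun t : unitInterval => w (gridPt k ⌊(k : ℝ) * t⌋₊)) univ ≤ gridVar k w := by
  have h1 : eVariationOn (fun j : ℕ => w (gridPt k j)) (Iic k) ≤ gridVar k w := by
    have := (eVariationOn.sum' (fun j : ℕ => w (gridPt k j)) (I := fun j => j) monotone_id
      (n := k))
    have e : (Iic k : Set ℕ) = Icc 0 k := by ext; simp
    rw [e, ← this]
    refine Finset.sum_le_sum fun j _ => ?_
    have e2 : Icc j (j + 1) = ({j, j + 1} : Set ℕ) := by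
      ext x; simp only [mem_Icc, mem_insert_iff, mem_singleton_iff]; omega
    rw [e2, eVariationOn.pair, edist_comm]
  refine le_trans ?_ h1
  refine eVariationOn.comp_le_of_monotoneOn (fun j : ℕ => w (gridPt k j))
    (fun t : unitInterval => ⌊(k : ℝ) * t⌋₊) ?_ ?_
  · intro a _ b _ hab
    have : (a : ℝ) ≤ b := hab
    exact Nat.floor_mono (by gcongr)
  · intro t _
    simp only [mem_Iic]
    refine Nat.floor_le_of_le ?_
    have := t.2.2
    have hk : (0 : ℝ) ≤ k := by positivity
    nlinarith

theorem var_eq_liminf_grid {w : unitInterval → ℝ} (hw : Continuous w) :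
    eVariationOn w univ = liminf (fun k => gridVar k w) atTop := by
  refine le_antisymm ?_ ?_
  · refine le_of_forall_lt fun v hv => ?_
    obtain ⟨v', hv1, hv2⟩ := exists_between hv
    refine hv1.trans_le (le_liminf_of_le (by isBoundedDefault) ?_)
    have hr : ∀ t ∈ (univ : Set unitInterval),
        Tendsto (fun k : ℕ => w (gridPt k ⌊(k : ℝ) * t⌋₊)) atTop (𝓝 (w t)) := by
      intro t _
      refine (hw.tendsto t).comp ?_
      rw [tendsto_subtype_rng]
      have h := (tendsto_nat_floor_mul_div_atTop (R := ℝ) t.2.1).comp tendsto_natCast_atTop_atTop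
      refine h.congr fun k => ?_
      have : ⌊(k : ℝ) * t⌋₊ ≤ k := by
        refine Nat.floor_le_of_le ?_
        have := t.2.2
        have hk : (0 : ℝ) ≤ k := by positivity
        nlinarith
      change (⌊(t : ℝ) * k⌋₊ : ℝ) / k = ((min ⌊(k : ℝ) * t⌋₊ k : ℕ) : ℝ) / k
      rw [min_eq_left this, mul_comm]
    filter_upwards [eVariationOn.lowerSemicontinuous_aux hr hv2] with k hk
    exact (hk.trans_le (var_round k w)).le
  · exact (liminf_le_liminf (Eventually.of_forall fun k => gridVar_le k w)).trans (by simp)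

/-- The regularised representative of a function of one variable. -/
def reg (u : unitInterval → ℝ) (t : unitInterval) : ℝ := limUnder atTop fun m => avg m u t

theorem reg_spec {u : unitInterval → ℝ} (hu : eVariationOn u univ ≠ ⊤) (t : unitInterval) :
    Tendsto (fun m => avg m u t) atTop (𝓝 (reg u t)) :=
  tendsto_nhds_limUnder (avg_tendsto_lim hu t)

theorem var_reg_le {u : unitInterval → ℝ} (hu : eVariationOn u univ ≠ ⊤) :
    eVariationOn (reg u) univ ≤ liminf (fun m => eVariationOn (avg m u) univ) atTop := by
  refine le_of_forall_lt fun v hv => ?_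
  obtain ⟨v', hv1, hv2⟩ := exists_between hv
  refine hv1.trans_le (le_liminf_of_le (by isBoundedDefault) ?_)
  filter_upwards [eVariationOn.lowerSemicontinuous_aux (fun t _ => reg_spec hu t) hv2] with k hk
  exact hk.le

theorem var_reg_le_var {u : unitInterval → ℝ} (hu : eVariationOn u univ ≠ ⊤) :
    eVariationOn (reg u) univ ≤ eVariationOn u univ :=
  (var_reg_le hu).trans ((liminf_le_liminf (Eventually.of_forall fun m => var_avg_le hu m)).trans
    (by simp))

theorem var_reg {u : unitInterval → ℝ} (hu : eVariationOn u univ ≠ ⊤) :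
    eVariationOn (reg u) univ =
      liminf (fun m => liminf (fun k => gridVar k (avg m u)) atTop) atTop := by
  have h0 : ∀ m, liminf (fun k => gridVar k (avg m u)) atTop = eVariationOn (avg m u) univ :=
    fun m => (var_eq_liminf_grid (avg_continuous hu m)).symm
  simp only [h0]
  refine le_antisymm (var_reg_le hu) ?_
  have hr : eVariationOn (reg u) univ ≠ ⊤ := ne_top_of_le_ne_top hu (var_reg_le_var hu)
  have hae : u =ᵐ[volume] reg u := by
    filter_upwards [avg_tendsto_self hu] with t ht
    exact tendsto_nhds_unique ht (reg_spec hu t)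
  simp only [avg_congr hae]
  exact (liminf_le_liminf (Eventually.of_forall fun m => var_avg_le hr m)).trans (by simp)


theorem gridVar_avg_measurable {d : ℕ} {F : unitInterval × Cube d → ℝ} (hF : StronglyMeasurable F)
    (m k : ℕ) : Measurable fun y => gridVar k (avg m fun t => F (t, y)) := by
  have key : ∀ t, Measurable fun y : Cube d => avg m (fun t => F (t, y)) t := by
    intro t
    have h : StronglyMeasurable fun p : Cube d × unitInterval => F (mix m t p.2, p.1) :=
      hF.comp_measurable (((measurable_mix_right m t).comp measurable_snd).prodMk measurable_fst)
    exact h.integral_prod_right.measurable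
  unfold gridVar
  exact Finset.measurable_sum _ fun j _ => (key _).edist (key _)

theorem avg_joint_measurable {d : ℕ} {F : unitInterval × Cube d → ℝ} (hF : StronglyMeasurable F)
    (m : ℕ) : Measurable fun p : unitInterval × Cube d => avg m (fun t => F (t, p.2)) p.1 := by
  have h : StronglyMeasurable fun q : (unitInterval × Cube d) × unitInterval =>
      F (mix m q.1.1 q.2, q.1.2) :=
    hF.comp_measurable ((((continuous_mix m).measurable.comp
      ((measurable_fst.comp measurable_fst).prodMk measurable_snd))).prodMk
      (measurable_snd.comp measurable_fst))
  exact h.integral_prod_right.measurable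

theorem exists_reg {d : ℕ} (i : Fin (d + 1)) {f g : Cube (d + 1) → ℝ}
    (hf : AEStronglyMeasurable f volume) (hgf : g =ᵐ[volume] f)
    (hfin : ∀ᵐ y, lineVar i g y ≠ ⊤) :
    ∃ g', g' =ᵐ[volume] f ∧ AEMeasurable (lineVar i g') volume ∧
      ∀ᵐ y, lineVar i g' y ≤ lineVar i g y := by
  set e := MeasurableEquiv.piFinSuccAbove (fun _ : Fin (d + 1) => unitInterval) i with he
  have hmp : MeasurePreserving e volume volume :=
    volume_preserving_piFinSuccAbove (fun _ : Fin (d + 1) => unitInterval) i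
  have hmp' : MeasurePreserving e.symm volume volume := hmp.symm
  have hes : ∀ p, e.symm p = i.insertNth p.1 p.2 := fun p => rfl
  set F : unitInterval × Cube d → ℝ := fun p => hf.mk f (e.symm p) with hFdef
  have hF : StronglyMeasurable F := hf.stronglyMeasurable_mk.comp_measurable e.symm.measurable
  have hgF : ∀ᵐ p : unitInterval × Cube d, g (e.symm p) = F p :=
    hmp'.quasiMeasurePreserving.ae_eq_comp (hgf.trans hf.ae_eq_mk)
  have hline : ∀ᵐ y : Cube d, (fun t => g (i.insertNth t y)) =ᵐ[volume] fun t => F (t, y) := by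
    have h2 : ∀ᵐ q : Cube d × unitInterval, g (e.symm q.swap) = F q.swap :=
      (Measure.measurePreserving_swap (μ := (volume : Measure (Cube d)))
        (ν := (volume : Measure unitInterval))).quasiMeasurePreserving.ae hgF
    exact Measure.ae_ae_of_ae_prod h2
  let G : unitInterval × Cube d → ℝ := fun p => reg (fun t => F (t, p.2)) p.1
  have hG : ∀ᵐ p, G p = F p := by
    have hS : MeasurableSet {p : unitInterval × Cube d |
        Tendsto (fun m => avg m (fun t => F (t, p.2)) p.1) atTop (𝓝 (F p))} :=
      measurableSet_tendsto_fun (fun m => avg_joint_measurable hF m) hF.measurable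
    have h3 : ∀ᵐ p : unitInterval × Cube d,
        Tendsto (fun m => avg m (fun t => F (t, p.2)) p.1) atTop (𝓝 (F p)) := by
      have h4 : ∀ᵐ q : Cube d × unitInterval,
          Tendsto (fun m => avg m (fun t => F (t, q.1)) q.2) atTop (𝓝 (F (q.2, q.1))) := by
        refine (Measure.ae_prod_iff_ae_ae (measurable_swap hS)).2 ?_
        filter_upwards [hline, hfin] with y hy hy'
        filter_upwards [avg_tendsto_self hy', hy] with t ht ht'
        simp only [avg_congr hy] at ht
        change Tendsto (fun m => avg m (fun t => F (t, y)) t) atTop (𝓝 (F (t, y)))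
        rw [← ht']
        exact ht
      exact (Measure.measurePreserving_swap (μ := (volume : Measure unitInterval))
        (ν := (volume : Measure (Cube d)))).quasiMeasurePreserving.ae h4
    filter_upwards [h3] with p hp
    exact hp.limUnder_eq
  refine ⟨fun x => G (e x), ?_, ?_, ?_⟩
  · have h5 : (fun x => G (e x)) =ᵐ[volume] fun x => F (e x) :=
      hmp.quasiMeasurePreserving.ae_eq_comp hG
    refine h5.trans ?_
    have : (fun x => F (e x)) = hf.mk f := by funext x; simp [hFdef]
    rw [this]
    exact hf.ae_eq_mk.symm
  all_goals
    have hlv : ∀ᵐ y : Cube d, lineVar i (fun x => G (e x)) y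
        = eVariationOn (reg fun t => g (i.insertNth t y)) univ := by
      filter_upwards [hline] with y hy
      unfold lineVar
      congr 1
      funext t
      change G (e (i.insertNth t y)) = _
      rw [← hes (t, y), MeasurableEquiv.apply_symm_apply]
      simp only [G, reg, avg_congr hy]
  · have hm : Measurable fun y : Cube d =>
        liminf (fun m => liminf (fun k => gridVar k (avg m fun t => F (t, y))) atTop) atTop :=
      Measurable.liminf fun m => Measurable.liminf fun k => gridVar_avg_measurable hF m k
    refine ⟨_, hm, ?_⟩
    filter_upwards [hlv, hline, hfin] with y h6 h7 h8
    rw [h6, var_reg h8]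
    simp only [avg_congr h7]
  · filter_upwards [hlv, hfin] with y h6 h8
    rw [h6]
    exact var_reg_le_var h8

theorem dirVar_congr {d : ℕ} (i : Fin (d + 1)) {f g : Cube (d + 1) → ℝ} (h : f =ᵐ[volume] g) :
    dirVar i f = dirVar i g := by
  unfold dirVar
  refine iInf_congr fun k => ?_
  have : k =ᵐ[volume] f ↔ k =ᵐ[volume] g := ⟨fun h' => h'.trans h, fun h' => h'.trans h.symm⟩
  simp only [this]

theorem dirVar_zero {d : ℕ} (i : Fin (d + 1)) : dirVar i (fun _ : Cube (d + 1) => (0 : ℝ)) = 0 := by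
  have h0 : lineVar i (fun _ : Cube (d + 1) => (0 : ℝ)) = fun _ => 0 := by
    funext y
    exact eVariationOn.constant_on (by rintro _ ⟨_, _, rfl⟩ _ ⟨_, _, rfl⟩; rfl)
  refine le_antisymm ?_ zero_le
  refine (iInf₂_le_of_le (fun _ => 0) (ae_eq_refl _) (iInf_le_of_le ?_ ?_))
  · rw [h0]; exact aemeasurable_const
  · rw [h0]; simp

theorem dirVar_add_le {d : ℕ} (i : Fin (d + 1)) {f₁ f₂ : Cube (d + 1) → ℝ}
    (h₁ : AEStronglyMeasurable f₁ volume) (h₂ : AEStronglyMeasurable f₂ volume) :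
    dirVar i (f₁ + f₂) ≤ dirVar i f₁ + dirVar i f₂ := by
  conv_rhs => unfold dirVar
  simp only [ENNReal.iInf_add, ENNReal.add_iInf]
  refine le_iInf₂ fun g₂ a₂ => le_iInf fun b₂ => le_iInf₂ fun g₁ a₁ => le_iInf fun b₁ => ?_
  by_cases t₁ : ∫⁻ y, lineVar i g₁ y = ⊤
  · simp [t₁]
  by_cases t₂ : ∫⁻ y, lineVar i g₂ y = ⊤
  · simp [t₂]
  have hle : ∀ y, lineVar i (g₁ + g₂) y ≤ lineVar i g₁ y + lineVar i g₂ y := by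
    intro y
    refine iSup_le fun ⟨n, v, hv, hu⟩ => ?_
    refine le_trans ?_ (add_le_add (eVariationOn.sum_le (n := n) hv hu)
      (eVariationOn.sum_le (n := n) hv hu))
    rw [← Finset.sum_add_distrib]
    exact Finset.sum_le_sum fun j _ => edist_add_add_le _ _ _ _
  have hfin : ∀ᵐ y, lineVar i (g₁ + g₂) y ≠ ⊤ := by
    filter_upwards [ae_lt_top' b₁ t₁, ae_lt_top' b₂ t₂] with y p q
    exact ((hle y).trans_lt (ENNReal.add_lt_top.2 ⟨p, q⟩)).ne
  obtain ⟨g', c₁, c₂, c₃⟩ := exists_reg i (h₁.add h₂) (a₁.add a₂) hfin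
  refine (iInf₂_le_of_le g' c₁ (iInf_le_of_le c₂ le_rfl)).trans ?_
  rw [← lintegral_add_left' b₁]
  exact lintegral_mono_ae (c₃.mono fun y hy => hy.trans (hle y))

theorem dirVar_smul_le {d : ℕ} (i : Fin (d + 1)) (c : ℝ) (f : Cube (d + 1) → ℝ) :
    dirVar i (c • f) ≤ ‖c‖ₑ * dirVar i f := by
  rcases eq_or_ne c 0 with rfl | hc
  · have : ((0 : ℝ) • f) = fun _ => 0 := by funext x; simp
    rw [this, dirVar_zero]
    exact zero_le
  conv_rhs => unfold dirVar
  have hc' : ‖c‖ₑ ≠ 0 := enorm_ne_zero.2 hc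
  simp only [ENNReal.mul_iInf_of_ne hc' enorm_ne_top]
  refine le_iInf₂ fun g a => le_iInf fun b => ?_
  have hl : lineVar i (c • g) = fun y => ‖c‖ₑ * lineVar i g y := by
    funext y
    unfold lineVar eVariationOn
    rw [ENNReal.mul_iSup]
    refine iSup_congr fun p => ?_
    rw [Finset.mul_sum]
    refine Finset.sum_congr rfl fun j _ => ?_
    simp only [edist_eq_enorm_sub, Pi.smul_apply, ← smul_sub, enorm_smul]
  refine iInf₂_le_of_le (c • g) (a.const_smul c) (iInf_le_of_le ?_ ?_)
  · rw [hl]; exact b.const_mul _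
  · rw [hl, lintegral_const_mul' _ _ enorm_ne_top]

theorem totalVar_congr {d : ℕ} {f g : Cube (d + 1) → ℝ} (h : f =ᵐ[volume] g) :
    totalVar f = totalVar g :=
  iSup_congr fun i => dirVar_congr i h

theorem totalVar_add_le {d : ℕ} (f g : Lp ℝ 1 (volume : Measure (Cube (d + 1)))) :
    totalVar (f + g : Lp ℝ 1 (volume : Measure (Cube (d + 1)))) ≤ totalVar f + totalVar g := by
  rw [totalVar_congr (Lp.coeFn_add f g)]
  exact iSup_le fun i => (dirVar_add_le i (Lp.aestronglyMeasurable f)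
    (Lp.aestronglyMeasurable g)).trans
    (add_le_add (le_iSup (fun i => dirVar i f) i) (le_iSup (fun i => dirVar i g) i))

theorem totalVar_smul_le {d : ℕ} (c : ℝ) (f : Lp ℝ 1 (volume : Measure (Cube (d + 1)))) :
    totalVar (c • f : Lp ℝ 1 (volume : Measure (Cube (d + 1)))) ≤ ‖c‖ₑ * totalVar f := by
  rw [totalVar_congr (Lp.coeFn_smul c f)]
  exact iSup_le fun i => (dirVar_smul_le i c f).trans
    (mul_le_mul_right (le_iSup (fun i => dirVar i f) i) _)

theorem totalVar_zero {d : ℕ} : totalVar (0 : Lp ℝ 1 (volume : Measure (Cube (d + 1)))) = 0 := by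
  have h : ((0 : Lp ℝ 1 (volume : Measure (Cube (d + 1)))) : Cube (d + 1) → ℝ)
      =ᵐ[volume] fun _ => 0 := Lp.coeFn_zero ℝ 1 volume
  rw [totalVar_congr h]
  simp [totalVar, dirVar_zero]

/-- The classes in `L¹` of finite total variation. -/
def bvSubmodule (d : ℕ) : Submodule ℝ (Lp ℝ 1 (volume : Measure (Cube (d + 1)))) where
  carrier := {f | totalVar f < ⊤}
  add_mem' {f g} hf hg := (totalVar_add_le f g).trans_lt (ENNReal.add_lt_top.2 ⟨hf, hg⟩)
  zero_mem' := by
    change totalVar _ < ⊤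
    rw [totalVar_zero]
    exact ENNReal.zero_lt_top
  smul_mem' c f hf := (totalVar_smul_le c f).trans_lt (ENNReal.mul_lt_top enorm_lt_top hf)

/-- `BV d` is the space of functions of bounded variation on the cube of dimension `d + 1`. -/
def BV (d : ℕ) : Type := bvSubmodule d

namespace BV

instance (d : ℕ) : AddCommGroup (BV d) := inferInstanceAs (AddCommGroup (bvSubmodule d))

instance (d : ℕ) : Module ℝ (BV d) := inferInstanceAs (Module ℝ (bvSubmodule d))

/-- The inclusion of `BV` into `L¹`. -/
def toL1 {d : ℕ} : BV d →ₗ[ℝ] Lp ℝ 1 (volume : Measure (Cube (d + 1))) := (bvSubmodule d).subtype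

/-- The total variation, as a real number. -/
def var {d : ℕ} (h : BV d) : ℝ := (totalVar (toL1 h)).toReal

theorem totalVar_ne_top {d : ℕ} (h : BV d) : totalVar (toL1 h) ≠ ⊤ :=
  ne_of_lt (show totalVar (toL1 h) < ⊤ from Subtype.prop (p := (· ∈ bvSubmodule d)) h)

theorem toL1_injective {d : ℕ} : Function.Injective (toL1 (d := d)) := Subtype.val_injective

theorem var_add_le {d : ℕ} (h k : BV d) : var (h + k) ≤ var h + var k := by
  unfold var
  rw [← ENNReal.toReal_add h.totalVar_ne_top k.totalVar_ne_top, map_add]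
  exact ENNReal.toReal_mono (ENNReal.add_ne_top.2 ⟨h.totalVar_ne_top, k.totalVar_ne_top⟩)
    (totalVar_add_le _ _)

theorem var_smul_le {d : ℕ} (c : ℝ) (h : BV d) : var (c • h) ≤ ‖c‖ * var h := by
  unfold var
  rw [← toReal_enorm, ← ENNReal.toReal_mul, map_smul]
  exact ENNReal.toReal_mono (ENNReal.mul_ne_top enorm_ne_top h.totalVar_ne_top)
    (totalVar_smul_le _ _)

/-- The norm `‖h‖_BV = ‖h‖₁ + V h`. -/
instance (d : ℕ) : NormedAddCommGroup (BV d) :=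
  AddGroupNorm.toNormedAddCommGroup
    { toFun := fun h => ‖toL1 h‖ + var h
      map_zero' := by
        have h0 : var (0 : BV d) = 0 := by
          have h1 : totalVar (toL1 (0 : BV d)) = 0 := totalVar_zero
          rw [var, h1, ENNReal.toReal_zero]
        rw [map_zero, norm_zero, h0, add_zero]
      add_le' := fun h k => by
        have h1 := norm_add_le (toL1 h) (toL1 k)
        have h2 := var_add_le h k
        rw [map_add]
        linarith
      neg' := fun h => by
        have h1 := var_smul_le (-1) h
        have h2 := var_smul_le (-1) (-h)
        simp only [neg_smul, one_smul, neg_neg, norm_neg, norm_one, one_mul] at h1 h2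
        rw [map_neg, norm_neg, le_antisymm h1 h2]
      eq_zero_of_map_eq_zero' := fun h hh => by
        have h1 : 0 ≤ var h := ENNReal.toReal_nonneg
        have h2 : ‖toL1 h‖ = 0 := le_antisymm (by linarith) (norm_nonneg _)
        exact toL1_injective (by rw [norm_eq_zero.1 h2, map_zero]) }

theorem norm_def {d : ℕ} (h : BV d) : ‖h‖ = ‖toL1 h‖ + var h := rfl

instance (d : ℕ) : NormedSpace ℝ (BV d) where
  norm_smul_le c h := by
    rw [norm_def, norm_def, map_smul, norm_smul, mul_add]
    linarith [var_smul_le c h]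

end BV

/-! ### Random dynamical systems -/

/-- A map is `ℙ`-continuous if the space is a countable union of Borel sets on each of which the
map is continuous. -/
def PContinuous {Ω Y : Type*} [TopologicalSpace Ω] [MeasurableSpace Ω] [TopologicalSpace Y]
    (L : Ω → Y) : Prop :=
  ∃ E : ℕ → Set Ω, (∀ j, MeasurableSet (E j)) ∧ (⋃ j, E j) = univ ∧ ∀ j, ContinuousOn L (E j)

section Cocycle

variable {Ω X : Type*} [NormedAddCommGroup X] [NormedSpace ℝ X]

/-- The cocycle `L_{σ^{k-1} ω} ∘ ⋯ ∘ L_{σ ω} ∘ L_ω`. -/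
def cocycle (σ : Ω → Ω) (L : Ω → X →L[ℝ] X) : ℕ → Ω → X →L[ℝ] X
  | 0, _ => ContinuousLinearMap.id ℝ X
  | k + 1, ω => (L (σ^[k] ω)).comp (cocycle σ L k ω)

/-- The index of compactness: the infimum of the radii `r > 0` such that the image of the unit
ball is covered by finitely many balls of radius `r`. -/
def indexOfCompactness (A : X →L[ℝ] X) : ℝ :=
  sInf {r : ℝ | 0 < r ∧ ∃ t : Set X, t.Finite ∧
    A '' Metric.closedBall 0 1 ⊆ ⋃ x ∈ t, Metric.closedBall x r}

variable [MeasurableSpace Ω]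

/-- The maximal Lyapunov exponent of the cocycle is almost everywhere equal to `l`. -/
def HasMaxLyapunovExponent (P : Measure Ω) (σ : Ω → Ω) (L : Ω → X →L[ℝ] X) (l : EReal) : Prop :=
  ∀ᵐ ω ∂P, Tendsto (fun k : ℕ => (((k : ℝ)⁻¹ : ℝ) : EReal) *
    ENNReal.log (ENNReal.ofReal ‖cocycle σ L k ω‖)) atTop (𝓝 l)

/-- The index of compactness (exponent) of the cocycle is almost everywhere equal to `κ`. -/
def HasCompactnessExponent (P : Measure Ω) (σ : Ω → Ω) (L : Ω → X →L[ℝ] X) (κ : EReal) : Prop :=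
  ∀ᵐ ω ∂P, Tendsto (fun k : ℕ => (((k : ℝ)⁻¹ : ℝ) : EReal) *
    ENNReal.log (ENNReal.ofReal (indexOfCompactness (cocycle σ L k ω)))) atTop (𝓝 κ)

/-- Quasi-compactness: both exponents exist as almost everywhere constant limits, and
`κ* < λ*`. -/
def IsQuasiCompact (P : Measure Ω) (σ : Ω → Ω) (L : Ω → X →L[ℝ] X) : Prop :=
  ∃ κ l : EReal, HasCompactnessExponent P σ L κ ∧ HasMaxLyapunovExponent P σ L l ∧ κ < l

end Cocycle

/-! ### Transfer operators -/

/-- The bounded operator `A` on `BV` is the transfer operator of `f`: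
`∫_E A h = ∫_{f⁻¹ E} h` for all Borel sets `E`. -/
def IsTransferOperator {d : ℕ} (f : Cube (d + 1) → Cube (d + 1)) (A : BV d →L[ℝ] BV d) : Prop :=
  ∀ h : BV d, ∀ E : Set (Cube (d + 1)), MeasurableSet E →
    ∫ x in E, (A h).toL1 x = ∫ x in f ⁻¹' E, h.toL1 x

theorem IsTransferOperator.unique {d : ℕ} {f : Cube (d + 1) → Cube (d + 1)}
    {A A' : BV d →L[ℝ] BV d} (hA : IsTransferOperator f A) (hA' : IsTransferOperator f A') :
    A = A' := by
  ext h
  refine BV.toL1_injective (Lp.ext ?_)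
  refine (L1.integrable_coeFn _).ae_eq_of_forall_setIntegral_eq _ _ (L1.integrable_coeFn _) ?_
  intro E hE _
  rw [hA h E hE, hA' h E hE]

open Classical in
/-- The transfer operator of `f` on `BV`; it is `0` by convention if there is no bounded operator
on `BV` that satisfies the defining duality relation. -/
def transferBV {d : ℕ} (f : Cube (d + 1) → Cube (d + 1)) : BV d →L[ℝ] BV d :=
  if h : ∃ A, IsTransferOperator f A then h.choose else 0

/-! ### Jabłoński maps -/

/-- A partition of the unit cube into rectangles, given by points
`0 = a_{i,0} < a_{i,1} < ⋯ < a_{i,r_i} = 1` on each axis. -/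
structure Grid (n : ℕ) where
  r : Fin n → ℕ
  a : ∀ i, Fin (r i + 1) → ℝ
  strictMono : ∀ i, StrictMono (a i)
  first : ∀ i, a i 0 = 0
  last : ∀ i, a i (Fin.last (r i)) = 1

namespace Grid

variable {n : ℕ} (B : Grid n)

/-- The vector indices of the rectangles. -/
abbrev Index : Type := ∀ i, Fin (B.r i)

/-- The closed interval `[a_{i,j-1}, a_{i,j}]` (with `j` counted from `0`). -/
def side (i : Fin n) (j : Fin (B.r i)) : Set ℝ := Icc (B.a i j.castSucc) (B.a i j.succ)

/-- The rectangle with index `s`: a product of intervals `[a, b)` if `b < 1`, `[a, b]` if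
`b = 1`. -/
def cell (s : B.Index) : Set (Cube n) :=
  {x | ∀ i, B.a i (s i).castSucc ≤ (x i : ℝ) ∧
    ((x i : ℝ) < B.a i (s i).succ ∨ ((x i : ℝ) = 1 ∧ B.a i (s i).succ = 1))}

/-- A self-map of the cube which on each rectangle `B_s` has the form
`x ↦ (φ_{1,s}(x_1), …, φ_{n,s}(x_n))`. Only the values of `comp i s = φ_{i,s}` on the closed
interval `B.side i (s i)` are ever used. -/
structure JablonskiMap where
  toFun : Cube n → Cube n
  comp : Fin n → B.Index → ℝ → ℝ
  toFun_eq : ∀ s, ∀ x ∈ B.cell s, ∀ i, (toFun x i : ℝ) = comp i s (x i)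

variable {B}

/-- `γ_i = inf |φ_{i,s}'(x_i)|` over all `s` and all `x_i ∈ [a_{i,s_i-1}, a_{i,s_i}]`, with
one-sided derivatives at the end points. -/
def JablonskiMap.slope (T : B.JablonskiMap) (i : Fin n) : ℝ :=
  ⨅ p : (s : B.Index) × B.side i (s i),
    |derivWithin (T.comp i p.1) (B.side i (p.1 i)) (p.2 : ℝ)|

end Grid

/-- The generator `ω ↦ L_ω` on `BV` of the random map `ω ↦ F ω`. -/
def generator {Ω : Type*} {d : ℕ} {B : Grid (d + 1)} (F : Ω → B.JablonskiMap) (ω : Ω) :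
    BV d →L[ℝ] BV d := transferBV (F ω).toFun

/-- Admissible random Jabłoński maps with respect to the common partition `B`. In `expanding` the
logarithm is `-∞` at `0` in the mathematics, so that the integral is positive only if the slopes
are positive almost everywhere; as `Real.log 0 = 0`, this is recorded in `slope_pos`. -/
structure IsAdmissible {Ω : Type*} [TopologicalSpace Ω] [MeasurableSpace Ω] (P : Measure Ω)
    {d : ℕ} {B : Grid (d + 1)} (F : Ω → B.JablonskiMap) : Prop where
  contDiffOn : ∀ ω i s, ContDiffOn ℝ 2 ((F ω).comp i s) (B.side i (s i))
  monotone : ∀ ω i s, MonotoneOn ((F ω).comp i s) (B.side i (s i)) ∨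
    AntitoneOn ((F ω).comp i s) (B.side i (s i))
  slope_pos : ∀ᵐ ω ∂P, ∀ i, 0 < (F ω).slope i
  expanding : ∃ γ : ℝ, 0 < γ ∧ γ < ∫ ω, ⨅ i, Real.log ((F ω).slope i) ∂P
  pContinuous : PContinuous (generator F)

end

end Jab

/-! The whole theorem rests on one Lasota–Yorke inequality along orbits: almost surely `V L^(k) h ≤
2 exp(-S_k) V h + C ‖h‖₁`, where `S_k` is the Birkhoff sum of the logarithm of the smallest slope
and `C` depends on `k` and `ω`. The factor 2 comes from cutting a function off at the ends of an
interval. Paying it at each step would give `2^k`, which the hypothesis (a positive mean of the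
logarithm, not a mean above `log 2`) cannot absorb. It is paid only once because every inverse
branch is extended by constants beyond its image interval (`Branch`, `nonempty_branch`). The
extended density has no jumps in the chosen direction, its variation is multiplied by exactly `κ`,
and the variations over the cells of the grid add up to at most the total variation. The cut-off is
postponed to the end of the `k` steps (`exists_dirVar_iterMap_le`).

Assertion 1 follows by taking `N` with `N ∫ log slope > log 2` and choosing the remainder
measurably.

For the index of compactness, the unit ball of `BV` is totally bounded in `L¹`
(`BV.totallyBounded_toL1`), so an inequality with leading coefficient `a` and an `L¹` contraction
give an index of at most `2a` (`indexOfCompactness_le_of_var_le`). The index is submultiplicative,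
hence the subadditive ergodic theorem applies after truncation from below, and for `N` with `N ∫ log
slope > log 4` the exponent is seen to be negative.

The maximal exponent is at least 0 because transfer operators preserve integrals, so that `‖L^(k)
1‖₁ ≥ 1`. For the upper bound, `BV` is renormed by `V h + K ‖h‖₁`. In this norm `L^(N)` has operator
norm at most `max(2 exp(-S_N), 1 + C/K)`. As `K` grows, the integral of the positive part of its
logarithm becomes bounded by about `∫ max(log 2 - S_N, 0)`, and this is smaller than `εN` for
suitable `N` because `S_N` has positive drift (`exists_integral_max_sub_birkhoffSum_lt`). Equivalent
norms have the same exponent, so `λ* ≤ ε` for every `ε > 0`. Thus `λ* = 0 > κ*`. -/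

namespace Jab

/-! ### Pointwise ergodic theorems -/

section Ergodic

variable {Ω : Type*}

/-- The running maxima `max_{k ≤ n} S_k f` of the Birkhoff sums. -/
noncomputable def birkhoffMax (T : Ω → Ω) (f : Ω → ℝ) : ℕ → Ω → ℝ
  | 0, _ => 0
  | n + 1, ω => max 0 (f ω + birkhoffMax T f n (T ω))

theorem birkhoffMax_nonneg (T : Ω → Ω) (f : Ω → ℝ) (n : ℕ) (ω : Ω) : 0 ≤ birkhoffMax T f n ω := by
  cases n with
  | zero => exact le_rfl
  | succ n => exact le_max_left _ _

theorem birkhoffMax_le_succ (T : Ω → Ω) (f : Ω → ℝ) (n : ℕ) (ω : Ω) :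
    birkhoffMax T f n ω ≤ birkhoffMax T f (n + 1) ω := by
  induction n generalizing ω with
  | zero => exact le_max_left _ _
  | succ n ih => exact max_le_max le_rfl (add_le_add le_rfl (ih _))

theorem birkhoffSum_succ_left (T : Ω → Ω) (f : Ω → ℝ) (n : ℕ) (ω : Ω) :
    birkhoffSum T f (n + 1) ω = f ω + birkhoffSum T f n (T ω) := by
  rw [add_comm n 1, birkhoffSum_add, birkhoffSum_one]
  rfl

theorem birkhoffSum_le_birkhoffMax (T : Ω → Ω) (f : Ω → ℝ) (n : ℕ) (ω : Ω) :
    birkhoffSum T f n ω ≤ birkhoffMax T f n ω := by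
  induction n generalizing ω with
  | zero => simp [birkhoffMax]
  | succ n ih =>
    rw [birkhoffSum_succ_left]
    exact (add_le_add le_rfl (ih _)).trans (le_max_right _ _)

variable [MeasurableSpace Ω]

theorem measurable_birkhoffMax {T : Ω → Ω} (hT : Measurable T) {f : Ω → ℝ} (hf : Measurable f)
    (n : ℕ) : Measurable (birkhoffMax T f n) := by
  induction n with
  | zero => exact measurable_const
  | succ n ih => exact measurable_const.max (hf.add (ih.comp hT))

theorem integrable_birkhoffMax {P : Measure Ω} [IsProbabilityMeasure P] {T : Ω → Ω}
    (hT : MeasurePreserving T P P) {f : Ω → ℝ} (hi : Integrable f P) (n : ℕ) :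
    Integrable (birkhoffMax T f n) P := by
  induction n with
  | zero => exact integrable_zero _ _ _
  | succ n ih =>
    have := (hT.integrable_comp ih.aestronglyMeasurable).2 ih
    exact (integrable_zero Ω ℝ P).sup (hi.add this)

/-- The set where the running maxima `M n` stay bounded is invariant, so it is null or conull. If it
were null, `M (n + 1) - M n ∘ T` would converge to `f`, dominated by `|f|`. Its integral is
nonnegative by invariance of the measure and monotonicity in `n`, which would force `∫ f ≥ 0`. -/
theorem bddAbove_birkhoffSum_of_integral_neg {P : Measure Ω} [IsProbabilityMeasure P] {T : Ω → Ω}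
    (hT : Ergodic T P) {f : Ω → ℝ} (hf : Measurable f) (hi : Integrable f P)
    (hneg : ∫ ω, f ω ∂P < 0) :
    ∀ᵐ ω ∂P, BddAbove (range fun n => birkhoffSum T f n ω) := by
  set M := birkhoffMax T f with hM
  have hmono : ∀ ω, Monotone fun n => M n ω :=
    fun ω => monotone_nat_of_le_succ fun n => birkhoffMax_le_succ T f n ω
  set E : Set Ω := {ω | BddAbove (range fun n => M n ω)} with hE
  have hEm : MeasurableSet E :=
    measurableSet_bddAbove_range fun n => measurable_birkhoffMax hT.measurable hf n
  have hinv : T ⁻¹' E = E := by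
    ext ω
    constructor
    · rintro ⟨B, hB⟩
      refine ⟨max 0 (f ω + B), ?_⟩
      rintro _ ⟨n, rfl⟩
      refine (birkhoffMax_le_succ T f n ω).trans (max_le_max le_rfl (add_le_add le_rfl ?_))
      exact hB ⟨n, rfl⟩
    · rintro ⟨B, hB⟩
      refine ⟨B - f ω, ?_⟩
      rintro _ ⟨n, rfl⟩
      have h1 : f ω + M n (T ω) ≤ M (n + 1) ω := le_max_right _ _
      have h2 : M (n + 1) ω ≤ B := hB ⟨n + 1, rfl⟩
      change M n (T ω) ≤ _
      linarith
  rcases hT.toPreErgodic.ae_mem_or_ae_notMem hEm hinv with h | h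
  · filter_upwards [h] with ω hω
    obtain ⟨B, hB⟩ := hω
    refine ⟨B, ?_⟩
    rintro _ ⟨n, rfl⟩
    exact (birkhoffSum_le_birkhoffMax T f n ω).trans (hB ⟨n, rfl⟩)
  · exfalso
    have hmp := hT.toMeasurePreserving
    have hMi : ∀ n, Integrable (fun ω => M n ω) P := fun n => integrable_birkhoffMax hmp hi n
    have hMT : ∀ n, Integrable (fun ω => M n (T ω)) P := fun n =>
      (hmp.integrable_comp (hMi n).aestronglyMeasurable).2 (hMi n)
    have hD : ∀ n, 0 ≤ ∫ ω, (M (n + 1) ω - M n (T ω)) ∂P := by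
      intro n
      rw [integral_sub (hMi _) (hMT n)]
      have : ∫ ω, M n (T ω) ∂P = ∫ ω, M n ω ∂P := by
        have := integral_map (μ := P) hmp.measurable.aemeasurable
          (f := M n) (by rw [hmp.map_eq]; exact (hMi n).aestronglyMeasurable)
        rw [hmp.map_eq] at this
        exact this.symm
      rw [this, sub_nonneg]
      exact integral_mono (hMi _) (hMi _) fun ω => birkhoffMax_le_succ T f n ω
    -- The difference always lies between `-|f|` and `|f|`, and it equals `f` as soon as `M n (T ω)
    -- ≥ -f ω`.
    have hDeq : ∀ n ω, M (n + 1) ω - M n (T ω) = max (-M n (T ω)) (f ω) := by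
      intro n ω
      change max 0 (f ω + M n (T ω)) - M n (T ω) = _
      rw [← max_sub_sub_right]; simp
    have hlim : Tendsto (fun n => ∫ ω, (M (n + 1) ω - M n (T ω)) ∂P) atTop (𝓝 (∫ ω, f ω ∂P)) := by
      refine tendsto_integral_of_dominated_convergence (fun ω => |f ω|)
        (fun n => ((hMi _).sub (hMT n)).aestronglyMeasurable) hi.abs (fun n => ?_) ?_
      · refine Eventually.of_forall fun ω => ?_
        rw [hDeq, Real.norm_eq_abs, abs_le]
        have := birkhoffMax_nonneg T f n (T ω)
        refine ⟨(neg_abs_le _).trans (le_max_right _ _), max_le ?_ (le_abs_self _)⟩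
        exact (neg_nonpos.2 this).trans (abs_nonneg _)
      · filter_upwards [h] with ω hω
        refine tendsto_const_nhds.congr' ?_
        have hω' : ¬ BddAbove (range fun n => M n (T ω)) := by
          have : ω ∉ T ⁻¹' E := by rw [hinv]; exact hω
          exact this
        have hex : ∃ n, -f ω ≤ M n (T ω) := by
          by_contra! hcon
          exact hω' ⟨-f ω, by rintro _ ⟨n, rfl⟩; exact (hcon n).le⟩
        obtain ⟨n0, hn0⟩ := hex
        filter_upwards [eventually_ge_atTop n0] with n hn
        rw [hDeq, eq_comm, max_eq_right_iff]
        have : M n0 (T ω) ≤ M n (T ω) := hmono (T ω) hn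
        linarith
    have := ge_of_tendsto' hlim hD
    linarith

/-- Subtracting slightly more than the mean makes the mean negative. The sums are then bounded
above, and the bound disappears after division by `n`. The same applied to `-f` gives the pointwise
ergodic theorem. -/
theorem birkhoffSum_div_eventually_le {P : Measure Ω} [IsProbabilityMeasure P] {T : Ω → Ω}
    (hT : Ergodic T P) {f : Ω → ℝ} (hf : Measurable f) (hi : Integrable f P) :
    ∀ᵐ ω ∂P, ∀ ε : ℝ, 0 < ε → ∀ᶠ n : ℕ in atTop, birkhoffSum T f n ω / n ≤ ∫ ω, f ω ∂P + ε := by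
  set I := ∫ ω, f ω ∂P with hI
  have key : ∀ k : ℕ, ∀ᵐ ω ∂P,
      BddAbove (range fun n => birkhoffSum T (fun ω => f ω - (I + 1 / ((k : ℝ) + 1))) n ω) := by
    intro k
    refine bddAbove_birkhoffSum_of_integral_neg hT (hf.sub_const _)
      (hi.sub (integrable_const _)) ?_
    rw [integral_sub hi (integrable_const _)]
    have : (0 : ℝ) < 1 / ((k : ℝ) + 1) := Nat.one_div_pos_of_nat
    simp only [integral_const, probReal_univ, one_smul]
    linarith
  filter_upwards [ae_all_iff.2 key] with ω hω ε hε
  obtain ⟨k, hk⟩ := exists_nat_one_div_lt (half_pos hε)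
  obtain ⟨C, hC⟩ := hω k
  have h1 : Tendsto (fun n : ℕ => C / (n : ℝ)) atTop (𝓝 0) :=
    tendsto_const_div_atTop_nhds_zero_nat C
  filter_upwards [h1.eventually (gt_mem_nhds (half_pos hε)), eventually_gt_atTop 0] with n hn hn0
  have hn0' : (0 : ℝ) < n := by exact_mod_cast hn0
  have h2 : birkhoffSum T (fun ω => f ω - (I + 1 / ((k : ℝ) + 1))) n ω ≤ C := hC ⟨n, rfl⟩
  have h3 : birkhoffSum T (fun ω => f ω - (I + 1 / ((k : ℝ) + 1))) n ω
      = birkhoffSum T f n ω - n * (I + 1 / ((k : ℝ) + 1)) := by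
    simp [birkhoffSum, Finset.sum_sub_distrib]
    ring
  rw [div_lt_iff₀ hn0'] at hn
  rw [div_le_iff₀ hn0']
  rw [h3] at h2
  nlinarith

theorem tendsto_birkhoffSum_div {P : Measure Ω} [IsProbabilityMeasure P] {T : Ω → Ω}
    (hT : Ergodic T P) {f : Ω → ℝ} (hf : Measurable f) (hi : Integrable f P) :
    ∀ᵐ ω ∂P, Tendsto (fun n : ℕ => birkhoffSum T f n ω / n) atTop (𝓝 (∫ ω, f ω ∂P)) := by
  filter_upwards [birkhoffSum_div_eventually_le hT hf hi,
    birkhoffSum_div_eventually_le hT hf.neg hi.neg] with ω h1 h2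
  rw [Metric.tendsto_atTop']
  intro ε hε
  have := (h1 (ε / 2) (half_pos hε)).and (h2 (ε / 2) (half_pos hε))
  obtain ⟨N, hN⟩ := eventually_atTop.1 this
  refine ⟨N, fun n hn => ?_⟩
  obtain ⟨h3, h4⟩ := hN n hn.le
  have h5 : birkhoffSum T (-f) n ω = -birkhoffSum T f n ω := by simp [birkhoffSum]
  have h6 : ∫ ω, (-f) ω ∂P = -∫ ω, f ω ∂P := integral_neg _
  rw [h5, h6, neg_div] at h4
  rw [Real.dist_eq, abs_lt]
  constructor <;> linarith

end Ergodic

end Jab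

/-! ### The subadditive ergodic theorem for nonnegative processes. -/

namespace Jab

section Subadditive

variable {Ω : Type*}

theorem subadditive_le_birkhoffSum {T : Ω → Ω} {g : ℕ → Ω → ℝ} (h0 : ∀ ω, g 0 ω = 0)
    (hsub : ∀ m n ω, g (m + n) ω ≤ g m ω + g n (T^[m] ω)) (n : ℕ) (ω : Ω) :
    g n ω ≤ birkhoffSum T (g 1) n ω := by
  induction n with
  | zero => simp [h0]
  | succ n ih =>
    rw [birkhoffSum_succ]
    exact (hsub n 1 ω).trans (add_le_add ih le_rfl)

/-- The covering estimate behind the subadditive ergodic theorem: orbit segments that start in `A`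
can be shortened at rate `r`, all other steps cost `g 1`. -/
theorem subadditive_covering {T : Ω → Ω} {g : ℕ → Ω → ℝ} (h0 : ∀ ω, g 0 ω = 0)
    (hpos : ∀ n ω, 0 ≤ g n ω) (hsub : ∀ m n ω, g (m + n) ω ≤ g m ω + g n (T^[m] ω))
    {A : Set Ω} {N : ℕ} {r : ℝ} (hr : 0 ≤ r)
    (hA : ∀ ω ∈ A, ∃ l, 1 ≤ l ∧ l ≤ N ∧ g l ω ≤ r * l) (n : ℕ) (ω : Ω) :
    g n ω ≤ r * n + birkhoffSum T (Aᶜ.indicator (g 1)) n ω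
      + (birkhoffSum T (g 1) n ω - birkhoffSum T (g 1) (n - N) ω) := by
  have hθ : ∀ ω, 0 ≤ Aᶜ.indicator (g 1) ω := fun ω => indicator_nonneg (fun _ _ => hpos _ _) _
  have hθs : ∀ n ω, 0 ≤ birkhoffSum T (Aᶜ.indicator (g 1)) n ω :=
    fun n ω => Finset.sum_nonneg fun _ _ => hθ _
  have hgs : ∀ n ω, 0 ≤ birkhoffSum T (g 1) n ω := fun n ω => Finset.sum_nonneg fun _ _ => hpos _ _
  have hgm : ∀ ω, Monotone fun n => birkhoffSum T (g 1) n ω := fun ω =>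
    monotone_nat_of_le_succ fun n => by
      rw [birkhoffSum_succ]; linarith [hpos 1 (T^[n] ω)]
  induction n using Nat.strong_induction_on generalizing ω with
  | _ n ih =>
    rcases Nat.eq_zero_or_pos n with rfl | hn
    · simp [h0]
    have key : ∀ l, 1 ≤ l → l ≤ n → g l ω ≤ r * l + birkhoffSum T (Aᶜ.indicator (g 1)) l ω →
        g n ω ≤ r * n + birkhoffSum T (Aᶜ.indicator (g 1)) n ω
          + (birkhoffSum T (g 1) n ω - birkhoffSum T (g 1) (n - N) ω) := by
      intro l hl hln hgl
      have h1 := ih (n - l) (by omega) (T^[l] ω)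
      have h2 := hsub l (n - l) ω
      have e1 : l + (n - l) = n := by omega
      rw [e1] at h2
      have e2 := birkhoffSum_add T (Aᶜ.indicator (g 1)) l (n - l) ω
      have e3 := birkhoffSum_add T (g 1) l (n - l) ω
      rw [e1] at e2 e3
      have e4 : birkhoffSum T (g 1) (n - N) ω ≤
          birkhoffSum T (g 1) l ω + birkhoffSum T (g 1) (n - l - N) (T^[l] ω) := by
        rw [← birkhoffSum_add]
        exact hgm ω (by omega)
      have e5 : ((n - l : ℕ) : ℝ) = n - l := by push_cast [Nat.cast_sub hln]; ring
      rw [e5] at h1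
      rw [e2, e3]
      nlinarith
    by_cases hω : ω ∈ A
    · obtain ⟨l, hl1, hlN, hgl⟩ := hA ω hω
      rcases le_or_gt l n with hln | hln
      · exact key l hl1 hln (by linarith [hθs l ω])
      -- The good segment is longer than the time left. Then `n < N`, the error term is the full sum
      -- of `g 1`, and the trivial subadditive bound suffices.
      · have : n - N = 0 := by omega
        rw [this, birkhoffSum_zero, sub_zero]
        have h1 := subadditive_le_birkhoffSum h0 hsub n ω
        have h2 := hθs n ω
        have : 0 ≤ r * n := by positivity
        linarith
    · refine key 1 le_rfl hn ?_
      rw [birkhoffSum_one, indicator_of_mem (by exact hω)]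
      push_cast
      linarith

/-- The lower growth rate of a nonnegative process. -/
noncomputable def lowerRate (g : ℕ → Ω → ℝ) (ω : Ω) : ℝ≥0∞ :=
  liminf (fun n : ℕ => ENNReal.ofReal (g n ω / n)) atTop

/-- The first step costs `g 1 ω`, which is negligible after division by `n`. This one-sided
invariance of the sublevel sets is all that ergodicity needs. -/
theorem lowerRate_le_comp {T : Ω → Ω} {g : ℕ → Ω → ℝ}
    (hsub : ∀ m n ω, g (m + n) ω ≤ g m ω + g n (T^[m] ω)) (hpos : ∀ n ω, 0 ≤ g n ω) (ω : Ω) :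
    lowerRate g ω ≤ lowerRate g (T ω) := by
  refine le_of_forall_gt fun q hq => ?_
  obtain ⟨q2, hq2, hq2q⟩ := ENNReal.lt_iff_exists_nnreal_btwn.1 hq
  obtain ⟨q1, hq1, hq12⟩ := ENNReal.lt_iff_exists_nnreal_btwn.1 hq2
  have hq12' : (q1 : ℝ) < q2 := by exact_mod_cast hq12
  have h1 : ∃ᶠ n : ℕ in atTop, ENNReal.ofReal (g n (T ω) / n) < q1 :=
    frequently_lt_of_liminf_lt (by isBoundedDefault) hq1
  have h2 : Tendsto (fun n : ℕ => g 1 ω / (n : ℝ)) atTop (𝓝 0) :=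
    tendsto_const_div_atTop_nhds_zero_nat _
  have h3 := h1.and_eventually ((h2.eventually (gt_mem_nhds (sub_pos.2 hq12'))).and
    (eventually_gt_atTop 0))
  refine lt_of_le_of_lt ?_ hq2q
  refine liminf_le_of_frequently_le ?_ (by isBoundedDefault)
  have h4 : ∃ᶠ n : ℕ in atTop, ENNReal.ofReal (g (n + 1) ω / ((n + 1 : ℕ) : ℝ)) ≤ q2 := by
    refine h3.mono ?_
    rintro n ⟨ha, hb, hn⟩
    have hn' : (0 : ℝ) < n := by exact_mod_cast hn
    have ha' : g n (T ω) / n < q1 := by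
      rw [← ENNReal.ofReal_coe_nnreal] at ha
      exact (ENNReal.ofReal_lt_ofReal_iff_of_nonneg (div_nonneg (hpos _ _) hn'.le)).1 ha
    rw [← ENNReal.ofReal_coe_nnreal (p := q2)]
    refine ENNReal.ofReal_le_ofReal ?_
    have h5 := hsub 1 n ω
    rw [add_comm 1 n] at h5
    simp only [Function.iterate_one] at h5
    rw [div_lt_iff₀ hn'] at ha' hb
    rw [div_le_iff₀ (by positivity)]
    push_cast
    nlinarith [q2.2]
  rw [frequently_atTop] at h4 ⊢
  intro a
  obtain ⟨b, hb, hb'⟩ := h4 a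
  exact ⟨b + 1, by omega, hb'⟩

variable [MeasurableSpace Ω]

theorem measurable_lowerRate {g : ℕ → Ω → ℝ} (hm : ∀ n, Measurable (g n)) :
    Measurable (lowerRate g) :=
  Measurable.liminf fun n => ((hm n).div_const _).ennreal_ofReal

/-- By ergodicity the lower rate is below `q` almost everywhere. Hence the sets `A N` of points from
which some segment of length at most `N` has rate at most `q` exhaust the space, and `g 1` has small
integral off `A N`. The covering estimate and Birkhoff averages then turn the bound for the lower
rate into one for the upper rate. -/
theorem subadditive_eventually_le {P : Measure Ω} [IsProbabilityMeasure P] {T : Ω → Ω}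
    (hT : Ergodic T P) {g : ℕ → Ω → ℝ} (hm : ∀ n, Measurable (g n)) (h0 : ∀ ω, g 0 ω = 0)
    (hpos : ∀ n ω, 0 ≤ g n ω) (hsub : ∀ m n ω, g (m + n) ω ≤ g m ω + g n (T^[m] ω))
    (hi : Integrable (g 1) P) {q : ℝ} (hq : 0 ≤ q)
    (hE : P {ω | lowerRate g ω < ENNReal.ofReal q} ≠ 0) {ε : ℝ} (hε : 0 < ε) :
    ∀ᵐ ω ∂P, ∀ᶠ n : ℕ in atTop, g n ω / n ≤ q + ε := by
  set E : Set Ω := {ω | lowerRate g ω < ENNReal.ofReal q} with hEdef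
  have hEm : MeasurableSet E := measurable_lowerRate hm measurableSet_Iio
  have hE1 : ∀ᵐ ω ∂P, ω ∈ E := by
    have hle : T ⁻¹' E ≤ᵐ[P] E :=
      Eventually.of_forall fun ω (hω : _ < _) => (lowerRate_le_comp hsub hpos ω).trans_lt hω
    rcases hT.ae_empty_or_univ_of_preimage_ae_le hEm.nullMeasurableSet hle with h | h
    · exact absurd (by rw [measure_congr h]; simp) hE
    · exact eventuallyEq_univ.1 h
  set A : ℕ → Set Ω := fun N => {ω | ∃ l, 1 ≤ l ∧ l ≤ N ∧ g l ω ≤ q * l} with hAdef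
  have hAm : ∀ N, MeasurableSet (A N) := by
    intro N
    have : A N = ⋃ l : ℕ, ⋃ (_ : 1 ≤ l ∧ l ≤ N), {ω | g l ω ≤ q * l} := by
      ext ω; simp [hAdef, and_assoc]
    rw [this]
    exact MeasurableSet.iUnion fun l => MeasurableSet.iUnion fun _ =>
      measurableSet_le (hm l) measurable_const
  have hAanti : Antitone fun N => (A N)ᶜ := by
    intro a b hab
    refine compl_subset_compl.2 ?_
    rintro ω ⟨l, h1, h2, h3⟩
    exact ⟨l, h1, h2.trans hab, h3⟩
  have hnull : P (⋂ N, (A N)ᶜ) = 0 := by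
    have : ∀ᵐ ω ∂P, ω ∉ ⋂ N, (A N)ᶜ := by
      filter_upwards [hE1] with ω hω hc
      have h1 : ∃ᶠ n : ℕ in atTop, ENNReal.ofReal (g n ω / n) < ENNReal.ofReal q :=
        frequently_lt_of_liminf_lt (by isBoundedDefault) hω
      obtain ⟨n, hn1, hn2⟩ := (h1.and_eventually (eventually_gt_atTop 0)).exists
      have hn' : (0 : ℝ) < n := by exact_mod_cast hn2
      have := (ENNReal.ofReal_lt_ofReal_iff_of_nonneg (div_nonneg (hpos _ _) hn'.le)).1 hn1
      rw [div_lt_iff₀ hn'] at this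
      exact mem_iInter.1 hc n ⟨n, hn2, le_rfl, this.le⟩
    exact measure_eq_zero_iff_ae_notMem.2 this
  have hlim : Tendsto (fun N => ∫ ω in (A N)ᶜ, g 1 ω ∂P) atTop (𝓝 0) := by
    have := tendsto_setIntegral_of_antitone (μ := P) (f := g 1) (fun N => (hAm N).compl) hAanti
      ⟨0, hi.integrableOn⟩
    rwa [setIntegral_measure_zero _ hnull] at this
  obtain ⟨N, hN⟩ := (hlim.eventually (gt_mem_nhds (half_pos hε))).exists
  have hθi : Integrable ((A N)ᶜ.indicator (g 1)) P := hi.indicator (hAm N).compl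
  have hθI : ∫ ω, (A N)ᶜ.indicator (g 1) ω ∂P < ε / 2 := by
    rwa [integral_indicator (hAm N).compl]
  filter_upwards [tendsto_birkhoffSum_div hT ((hm 1).indicator (hAm N).compl) hθi,
    tendsto_birkhoffSum_div hT (hm 1) hi] with ω h1 h2
  -- Shifting by the fixed number `N` does not change the Birkhoff average, so the end error in the
  -- covering estimate is `o(n)`.
  have h3 : Tendsto (fun n : ℕ => birkhoffSum T (g 1) (n - N) ω / n) atTop
      (𝓝 (∫ ω, g 1 ω ∂P)) := by
    rw [← tendsto_add_atTop_iff_nat N]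
    have h4 : Tendsto (fun n : ℕ => (n : ℝ) / ((n : ℝ) + N)) atTop (𝓝 1) :=
      tendsto_natCast_div_add_atTop (N : ℝ)
    have h5 := h2.mul h4
    rw [mul_one] at h5
    refine h5.congr' ?_
    filter_upwards [eventually_gt_atTop 0] with n hn
    have hn' : (n : ℝ) ≠ 0 := by positivity
    rw [Nat.add_sub_cancel]
    push_cast
    field_simp
  have h6 := ((tendsto_const_nhds (x := q)).add h1).add (h2.sub h3)
  rw [sub_self, add_zero] at h6
  filter_upwards [h6.eventually (gt_mem_nhds (show q + _ < q + ε by linarith)),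
    eventually_gt_atTop 0] with n hn hn0
  have hn' : (0 : ℝ) < n := by exact_mod_cast hn0
  refine le_trans ?_ hn.le
  have := subadditive_covering h0 hpos hsub hq (A := A N) (N := N) (fun ω hω => hω) n ω
  rw [div_le_iff₀ hn']
  have e : (q + birkhoffSum T ((A N)ᶜ.indicator (g 1)) n ω / n + (birkhoffSum T (g 1) n ω / n
      - birkhoffSum T (g 1) (n - N) ω / n)) * n = q * n
      + birkhoffSum T ((A N)ᶜ.indicator (g 1)) n ω + (birkhoffSum T (g 1) n ω
      - birkhoffSum T (g 1) (n - N) ω) := by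
    field_simp
  rw [e]
  exact this

/-- The subadditive ergodic theorem for nonnegative processes over an ergodic map. -/
theorem exists_tendsto_subadditive {P : Measure Ω} [IsProbabilityMeasure P] {T : Ω → Ω}
    (hT : Ergodic T P) {g : ℕ → Ω → ℝ} (hm : ∀ n, Measurable (g n)) (h0 : ∀ ω, g 0 ω = 0)
    (hpos : ∀ n ω, 0 ≤ g n ω) (hsub : ∀ m n ω, g (m + n) ω ≤ g m ω + g n (T^[m] ω))
    (hi : Integrable (g 1) P) :
    ∃ c : ℝ, ∀ᵐ ω ∂P, Tendsto (fun n : ℕ => g n ω / n) atTop (𝓝 c) := by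
  -- The levels below which the lower rate falls with positive probability. Every level in `Q`
  -- bounds the upper rate almost everywhere, every smaller nonnegative level than `inf Q` bounds
  -- the lower rate from below, so the limit is `inf Q`.
  set Q : Set ℝ := {q | 0 ≤ q ∧ P {ω | lowerRate g ω < ENNReal.ofReal q} ≠ 0} with hQ
  have hbdd : BddBelow Q := ⟨0, fun q hq => hq.1⟩
  have hne : Q.Nonempty := by
    refine ⟨∫ ω, g 1 ω ∂P + 2, ?_, ?_⟩
    · have : 0 ≤ ∫ ω, g 1 ω ∂P := integral_nonneg fun ω => hpos _ _
      linarith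
    · have hI : 0 ≤ ∫ ω, g 1 ω ∂P := integral_nonneg fun ω => hpos _ _
      have : ∀ᵐ ω ∂P, lowerRate g ω < ENNReal.ofReal (∫ ω, g 1 ω ∂P + 2) := by
        filter_upwards [tendsto_birkhoffSum_div hT (hm 1) hi] with ω hω
        refine lt_of_le_of_lt (b := ENNReal.ofReal (∫ ω, g 1 ω ∂P + 1)) ?_
          ((ENNReal.ofReal_lt_ofReal_iff_of_nonneg (by linarith)).2 (by linarith))
        refine liminf_le_of_frequently_le (Eventually.frequently ?_) (by isBoundedDefault)
        filter_upwards [hω.eventually (gt_mem_nhds (lt_add_one _))] with n hn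
        refine ENNReal.ofReal_le_ofReal (le_trans ?_ hn.le)
        gcongr
        exact subadditive_le_birkhoffSum h0 hsub n ω
      exact fun h => absurd (measure_eq_zero_iff_ae_notMem.1 h) fun h' => by
        obtain ⟨ω, h1, h2⟩ := (this.and h').exists
        exact h2 h1
  set c := sInf Q with hc
  have hc0 : 0 ≤ c := le_csInf hne fun q hq => hq.1
  refine ⟨c, ?_⟩
  have hup : ∀ k : ℕ, ∀ᵐ ω ∂P, ∀ᶠ n : ℕ in atTop, g n ω / n ≤ c + 2 * (1 / ((k : ℝ) + 1)) := by
    intro k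
    have hk : (0 : ℝ) < 1 / ((k : ℝ) + 1) := Nat.one_div_pos_of_nat
    obtain ⟨q, hq, hqc⟩ := exists_lt_of_csInf_lt hne
      (show sInf Q < c + 1 / ((k : ℝ) + 1) by linarith)
    filter_upwards [subadditive_eventually_le hT hm h0 hpos hsub hi hq.1 hq.2 hk] with ω hω
    filter_upwards [hω] with n hn
    linarith
  have hlow : ∀ k : ℕ, ∀ᵐ ω ∂P, ENNReal.ofReal (c - 1 / ((k : ℝ) + 1)) ≤ lowerRate g ω := by
    intro k
    have hk : (0 : ℝ) < 1 / ((k : ℝ) + 1) := Nat.one_div_pos_of_nat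
    rcases le_or_gt (c - 1 / ((k : ℝ) + 1)) 0 with h | h
    · rw [ENNReal.ofReal_of_nonpos h]
      exact Eventually.of_forall fun ω => zero_le
    · by_contra hcon
      have : c - 1 / ((k : ℝ) + 1) ∈ Q := by
        refine ⟨h.le, fun h0 => hcon ?_⟩
        rw [ae_iff]
        simpa only [not_le] using h0
      have := csInf_le hbdd this
      linarith
  filter_upwards [ae_all_iff.2 hup, ae_all_iff.2 hlow] with ω h1 h2
  rw [Metric.tendsto_atTop']
  intro ε hε
  obtain ⟨k, hk⟩ := exists_nat_one_div_lt (half_pos hε)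
  have hk0 : (0 : ℝ) < 1 / ((k : ℝ) + 1) := Nat.one_div_pos_of_nat
  have h3 : ∀ᶠ n : ℕ in atTop, c - ε < g n ω / n := by
    rcases lt_or_ge (c - ε) 0 with h | h
    · exact Eventually.of_forall fun n => h.trans_le (div_nonneg (hpos _ _) (by positivity))
    · have : ENNReal.ofReal (c - ε) < lowerRate g ω :=
        lt_of_lt_of_le ((ENNReal.ofReal_lt_ofReal_iff_of_nonneg h).2 (by linarith)) (h2 k)
      filter_upwards [eventually_lt_of_lt_liminf this (by isBoundedDefault)] with n hn
      exact (ENNReal.ofReal_lt_ofReal_iff_of_nonneg h).1 hn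
  obtain ⟨N, hN⟩ := eventually_atTop.1 ((h1 k).and h3)
  refine ⟨N, fun n hn => ?_⟩
  obtain ⟨h4, h5⟩ := hN n hn.le
  rw [Real.dist_eq, abs_lt]
  constructor <;> linarith

theorem lintegral_iterate {P : Measure Ω} {T : Ω → Ω} (hT : MeasurePreserving T P P)
    {f : Ω → ℝ≥0∞} (hf : Measurable f) (n : ℕ) : ∫⁻ ω, f (T^[n] ω) ∂P = ∫⁻ ω, f ω ∂P :=
  (hT.iterate n).lintegral_comp hf

/-- The growth rate of a subadditive process is bounded by the normalised integral of any majorant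
of a single term. -/
theorem subadditive_limit_le {P : Measure Ω} [IsProbabilityMeasure P] {T : Ω → Ω}
    (hT : Ergodic T P) {g : ℕ → Ω → ℝ} (hm : ∀ n, Measurable (g n)) (h0 : ∀ ω, g 0 ω = 0)
    (hpos : ∀ n ω, 0 ≤ g n ω) (hsub : ∀ m n ω, g (m + n) ω ≤ g m ω + g n (T^[m] ω))
    {c : ℝ} (hc : ∀ᵐ ω ∂P, Tendsto (fun n : ℕ => g n ω / n) atTop (𝓝 c))
    {N : ℕ} (hN : 0 < N) {φ : Ω → ℝ} (hφ : Integrable φ P) (hle : ∀ᵐ ω ∂P, g N ω ≤ φ ω) :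
    c * N ≤ ∫ ω, φ ω ∂P := by
  have hN' : (0 : ℝ) < N := by exact_mod_cast hN
  have hstep : ∀ j ω, g (N * j) ω ≤ ∑ i ∈ Finset.range j, g N (T^[N * i] ω) := by
    intro j ω
    induction j with
    | zero => simp [h0]
    | succ j ih =>
      rw [Finset.sum_range_succ, Nat.mul_succ]
      exact (hsub _ _ ω).trans (add_le_add ih le_rfl)
  set I := ∫⁻ ω, ENNReal.ofReal (g N ω) ∂P with hI
  have hint : ∀ j, ∫⁻ ω, ENNReal.ofReal (g (N * j) ω) ∂P ≤ j * I := by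
    intro j
    calc ∫⁻ ω, ENNReal.ofReal (g (N * j) ω) ∂P
        ≤ ∫⁻ ω, ∑ i ∈ Finset.range j, ENNReal.ofReal (g N (T^[N * i] ω)) ∂P := by
          refine lintegral_mono fun ω => ?_
          rw [← ENNReal.ofReal_sum_of_nonneg fun _ _ => hpos _ _]
          exact ENNReal.ofReal_le_ofReal (hstep j ω)
      _ = ∑ i ∈ Finset.range j, ∫⁻ ω, ENNReal.ofReal (g N (T^[N * i] ω)) ∂P :=
          lintegral_finsetSum _ fun i _ =>
            ((hm N).comp (hT.measurable.iterate _)).ennreal_ofReal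
      _ = j * I := by
          rw [Finset.sum_congr rfl fun i _ => lintegral_iterate hT.toMeasurePreserving
            (hm N).ennreal_ofReal (N * i)]
          simp [hI]
  have hlim : ∀ᵐ ω ∂P, ENNReal.ofReal (c * N) =
      liminf (fun j : ℕ => ENNReal.ofReal (g (N * j) ω) / j) atTop := by
    filter_upwards [hc] with ω hω
    have h1 : Tendsto (fun j : ℕ => N * j) atTop atTop :=
      tendsto_id.const_mul_atTop' hN
    have h2 := (hω.comp h1).mul_const (N : ℝ)
    refine (Tendsto.liminf_eq ?_).symm
    refine (ENNReal.tendsto_ofReal h2).congr' ?_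
    filter_upwards [eventually_gt_atTop 0] with j hj
    have hj' : (0 : ℝ) < j := by exact_mod_cast hj
    rw [← ENNReal.ofReal_natCast j, ← ENNReal.ofReal_div_of_pos hj']
    congr 1
    simp only [Function.comp]
    push_cast
    field_simp
  -- Fatou's lemma along the multiples of `N`, whose normalised integrals are at most `I` by
  -- subadditivity and invariance.
  have hfin : ENNReal.ofReal (c * N) ≤ I := by
    calc ENNReal.ofReal (c * N) = ∫⁻ _, ENNReal.ofReal (c * N) ∂P := by simp
      _ = ∫⁻ ω, liminf (fun j : ℕ => ENNReal.ofReal (g (N * j) ω) / j) atTop ∂P :=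
          lintegral_congr_ae hlim
      _ ≤ liminf (fun j : ℕ => ∫⁻ ω, ENNReal.ofReal (g (N * j) ω) / j ∂P) atTop :=
          lintegral_liminf_le fun j => (hm _).ennreal_ofReal.div_const _
      _ ≤ I := by
          refine liminf_le_of_frequently_le (Eventually.frequently ?_) (by isBoundedDefault)
          filter_upwards [eventually_gt_atTop 0] with j hj
          simp only [div_eq_mul_inv]
          rw [lintegral_mul_const _ (hm _).ennreal_ofReal, ← div_eq_mul_inv]
          refine ENNReal.div_le_of_le_mul ?_
          rw [mul_comm I]
          exact hint j
  have hφ0 : 0 ≤ᵐ[P] φ := hle.mono fun ω h => (hpos N ω).trans h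
  have h3 : I ≤ ENNReal.ofReal (∫ ω, φ ω ∂P) := by
    rw [ofReal_integral_eq_lintegral_ofReal hφ hφ0]
    exact lintegral_mono_ae (hle.mono fun ω h => ENNReal.ofReal_le_ofReal h)
  exact (ENNReal.ofReal_le_ofReal_iff (integral_nonneg_of_ae hφ0)).1 (hfin.trans h3)

theorem integral_birkhoffSum {P : Measure Ω} {T : Ω → Ω} (hT : MeasurePreserving T P P)
    {f : Ω → ℝ} (hi : Integrable f P) (n : ℕ) :
    Integrable (birkhoffSum T f n) P ∧ ∫ ω, birkhoffSum T f n ω ∂P = n * ∫ ω, f ω ∂P := by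
  have h1 : ∀ k, Integrable (fun ω => f (T^[k] ω)) P := fun k =>
    ((hT.iterate k).integrable_comp hi.aestronglyMeasurable).2 hi
  have h2 : ∀ k, ∫ ω, f (T^[k] ω) ∂P = ∫ ω, f ω ∂P := by
    intro k
    have hk := hT.iterate k
    have := integral_map (μ := P) hk.measurable.aemeasurable
      (f := f) (by rw [hk.map_eq]; exact hi.aestronglyMeasurable)
    rw [hk.map_eq] at this
    exact this.symm
  refine ⟨integrable_finsetSum _ fun k _ => h1 k, ?_⟩
  simp only [birkhoffSum]
  rw [integral_finsetSum _ fun k _ => h1 k, Finset.sum_congr rfl fun k _ => h2 k]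
  simp

/-- For an observable with positive mean, the negative parts of the Birkhoff sums grow
sublinearly in the mean. -/
theorem exists_integral_max_sub_birkhoffSum_lt {P : Measure Ω} [IsProbabilityMeasure P] {T : Ω → Ω}
    (hT : Ergodic T P) {G : Ω → ℝ} (hm : Measurable G) (hi : Integrable G P)
    (hG : 0 < ∫ ω, G ω ∂P) (a : ℝ) {ε : ℝ} (hε : 0 < ε) (N₀ : ℕ) :
    ∃ N : ℕ, N₀ < N ∧ ∫ ω, max (a - birkhoffSum T G N ω) 0 ∂P < ε * N := by
  by_contra! hcon
  set Gm : Ω → ℝ := fun ω => max (-G ω) 0 with hGm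
  have hGmi : Integrable Gm P := hi.neg.sup (integrable_zero _ _ _)
  have hGmm : Measurable Gm := hm.neg.max measurable_const
  set J := ∫ ω, Gm ω ∂P with hJ
  have hJ0 : 0 ≤ J := integral_nonneg fun ω => le_max_right _ _
  have hSm : ∀ n, Measurable (birkhoffSum T G n) := fun n =>
    Finset.measurable_sum _ fun k _ => hm.comp (hT.measurable.iterate k)
  have hSmm : ∀ n, Measurable (birkhoffSum T Gm n) := fun n =>
    Finset.measurable_sum _ fun k _ => hGmm.comp (hT.measurable.iterate k)
  have hle : ∀ n ω, -birkhoffSum T G n ω ≤ birkhoffSum T Gm n ω := by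
    intro n ω
    simp only [birkhoffSum, ← Finset.sum_neg_distrib]
    exact Finset.sum_le_sum fun k _ => le_max_left _ _
  have hS0 : ∀ n ω, 0 ≤ birkhoffSum T Gm n ω := fun n ω =>
    Finset.sum_nonneg fun k _ => le_max_right _ _
  -- Chosen for Fatou's lemma. `X n` is nonnegative because the negative part of the sum is
  -- dominated by the sum of the negative parts. It tends to `J + ε` because `S_n` tends to infinity
  -- and the maximum vanishes. If the claim failed, its integral would stay below `J + ε / 2`.
  set X : ℕ → Ω → ℝ := fun n ω =>
    (birkhoffSum T Gm n ω + |a| - max (a - birkhoffSum T G n ω) 0) / n + ε with hX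
  have hX0 : ∀ n ω, 0 ≤ X n ω := by
    intro n ω
    have : max (a - birkhoffSum T G n ω) 0 ≤ birkhoffSum T Gm n ω + |a| := by
      refine max_le ?_ (add_nonneg (hS0 n ω) (abs_nonneg a))
      linarith [hle n ω, le_abs_self a]
    have := div_nonneg (sub_nonneg.2 this) (Nat.cast_nonneg (α := ℝ) n)
    simp only [hX]
    linarith
  have hmp := hT.toMeasurePreserving
  have hmi : ∀ n, Integrable (fun ω => max (a - birkhoffSum T G n ω) 0) P := fun n =>
    ((integrable_const a).sub (integral_birkhoffSum hmp hi n).1).sup (integrable_zero _ _ _)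
  have hXi : ∀ n, Integrable (X n) P := fun n =>
    ((((integral_birkhoffSum hmp hGmi n).1.add (integrable_const _)).sub
      (hmi n)).div_const _).add (integrable_const _)
  have hXm : ∀ n, Measurable (X n) := fun n =>
    ((((hSmm n).add_const _).sub ((measurable_const.sub (hSm n)).max
      measurable_const)).div_const _).add_const _
  have hXI : ∀ᶠ n : ℕ in atTop, ∫⁻ ω, ENNReal.ofReal (X n ω) ∂P ≤ ENNReal.ofReal (J + ε / 2) := by
    have h1 : Tendsto (fun n : ℕ => |a| / (n : ℝ)) atTop (𝓝 0) :=
      tendsto_const_div_atTop_nhds_zero_nat _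
    filter_upwards [h1.eventually (gt_mem_nhds (half_pos hε)), eventually_gt_atTop N₀] with n hn hn0
    have hn' : (0 : ℝ) < n := by exact_mod_cast (Nat.zero_le _).trans_lt hn0
    rw [← ofReal_integral_eq_lintegral_ofReal (hXi n) (Eventually.of_forall (hX0 n))]
    refine ENNReal.ofReal_le_ofReal ?_
    have e : ∫ ω, X n ω ∂P
        = (n * J + |a| - ∫ ω, max (a - birkhoffSum T G n ω) 0 ∂P) / n + ε := by
      simp only [hX]
      rw [integral_add _ (integrable_const _), integral_div, integral_sub _ (hmi n),
        integral_add (integral_birkhoffSum hmp hGmi n).1 (integrable_const _),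
        (integral_birkhoffSum hmp hGmi n).2]
      · simp [hJ]
      · exact (integral_birkhoffSum hmp hGmi n).1.add (integrable_const _)
      · exact (((integral_birkhoffSum hmp hGmi n).1.add (integrable_const _)).sub
          (hmi n)).div_const _
    rw [e]
    have h2 := hcon n hn0
    have h3 : (n * J + |a| - ∫ ω, max (a - birkhoffSum T G n ω) 0 ∂P) / n
        ≤ J + |a| / n - ε := by
      rw [div_le_iff₀ hn']
      have : (J + |a| / n - ε) * n = n * J + |a| - ε * n := by field_simp
      rw [this]
      linarith
    linarith
  have hlim : ∀ᵐ ω ∂P, ENNReal.ofReal (J + ε) =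
      liminf (fun n : ℕ => ENNReal.ofReal (X n ω)) atTop := by
    filter_upwards [tendsto_birkhoffSum_div hT hm hi, tendsto_birkhoffSum_div hT hGmm hGmi]
      with ω h1 h2
    refine (Tendsto.liminf_eq ?_).symm
    refine ENNReal.tendsto_ofReal ?_
    have h3 : Tendsto (fun n : ℕ => |a| / (n : ℝ)) atTop (𝓝 0) :=
      tendsto_const_div_atTop_nhds_zero_nat _
    have h4 : Tendsto (fun n : ℕ => a / (n : ℝ)) atTop (𝓝 0) :=
      tendsto_const_div_atTop_nhds_zero_nat _
    have h5 := (h2.add h3).add_const ε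
    rw [add_zero] at h5
    refine h5.congr' ?_
    filter_upwards [h1.eventually (lt_mem_nhds (half_lt_self hG)),
      h4.eventually (gt_mem_nhds (half_pos hG)), eventually_gt_atTop 0] with n hn hn' hn0
    have hn0' : (0 : ℝ) < n := by exact_mod_cast hn0
    have : a - birkhoffSum T G n ω ≤ 0 := by
      have h6 := hn'.trans hn
      rw [div_lt_div_iff_of_pos_right hn0'] at h6
      linarith
    simp only [hX]
    rw [max_eq_right this, sub_zero, add_div]
  have hfin : ENNReal.ofReal (J + ε) ≤ ENNReal.ofReal (J + ε / 2) := by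
    calc ENNReal.ofReal (J + ε) = ∫⁻ _, ENNReal.ofReal (J + ε) ∂P := by simp
      _ = ∫⁻ ω, liminf (fun n : ℕ => ENNReal.ofReal (X n ω)) atTop ∂P := lintegral_congr_ae hlim
      _ ≤ liminf (fun n : ℕ => ∫⁻ ω, ENNReal.ofReal (X n ω) ∂P) atTop :=
          lintegral_liminf_le fun n => (hXm n).ennreal_ofReal
      _ ≤ ENNReal.ofReal (J + ε / 2) :=
          liminf_le_of_frequently_le hXI.frequently (by isBoundedDefault)
  have := (ENNReal.ofReal_le_ofReal_iff (by positivity)).1 hfin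
  linarith

end Subadditive

end Jab

namespace Jab

/-! ### Functions of bounded variation on intervals -/

/-- The point `c` is one where `|u|` does not exceed its mean. It trades pointwise values for `L¹`
norms in the two estimates that follow. -/
theorem exists_enorm_mul_le_setLIntegral {a b : unitInterval} (hab : a < b) {u : unitInterval → ℝ}
    (hu : Measurable u) :
    ∃ c ∈ Icc a b, ‖u c‖ₑ * ENNReal.ofReal (b - a) ≤ ∫⁻ t in Icc a b, ‖u t‖ₑ := by
  have hab' : (0 : ℝ) < b - a := sub_pos.2 hab
  have hvol : (volume.restrict (Icc a b)) univ = ENNReal.ofReal (b - a) := by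
    rw [Measure.restrict_apply_univ, unitInterval.volume_Icc]
  have hne : volume.restrict (Icc a b) ≠ 0 := by
    intro h
    rw [h] at hvol
    simp only [Measure.coe_zero, Pi.zero_apply] at hvol
    exact absurd hvol.symm (by simpa using hab')
  have hnull : (volume.restrict (Icc a b)) (Icc a b)ᶜ = 0 := by
    rw [Measure.restrict_apply measurableSet_Icc.compl]; simp
  obtain ⟨c, hc, hle⟩ := exists_notMem_null_le_laverage hne
    (f := fun t => ‖u t‖ₑ) hu.enorm.aemeasurable hnull
  refine ⟨c, not_not.1 hc, ?_⟩
  rw [laverage_eq, hvol] at hle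
  exact ENNReal.mul_le_of_le_div hle

/-- On each step `[s, t]` of a subdivision, pass through a point `c` with `|u c|` at most the mean:
`p t u t - p s u s = p t (u t - u c) + p s (u c - u s) + (p t - p s) u c`. The first two terms cost
`κ` times the variation, with no loss in the constant, and the last is bounded by the integral of
`|u|`. -/
theorem eVariationOn_mul_le {a b : unitInterval} {u : unitInterval → ℝ} (hu : Measurable u)
    {p : unitInterval → ℝ≥0} {κ K : ℝ≥0} (hκ : ∀ t ∈ Icc a b, p t ≤ κ)
    (hK : ∀ s ∈ Icc a b, ∀ t ∈ Icc a b, |(p s : ℝ) - p t| ≤ K * |(s : ℝ) - t|) :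
    eVariationOn (fun t => (p t : ℝ) * u t) (Icc a b)
      ≤ κ * eVariationOn u (Icc a b) + K * ∫⁻ t in Icc a b, ‖u t‖ₑ := by
  -- Half-open intervals, so that the integrals over consecutive steps add up without overlap.
  have term : ∀ s ∈ Icc a b, ∀ t ∈ Icc a b, s ≤ t →
      edist ((p t : ℝ) * u t) ((p s : ℝ) * u s)
        ≤ κ * eVariationOn u (Icc s t) + K * ∫⁻ r in Ioc s t, ‖u r‖ₑ := by
    intro s hs t ht hst
    rcases hst.eq_or_lt with rfl | hlt
    · simp
    obtain ⟨c, hc, hle⟩ := exists_enorm_mul_le_setLIntegral hlt hu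
    have hst' : (0 : ℝ) ≤ t - s := sub_nonneg.2 hst
    have hpt : (p t : ℝ) ≤ κ := hκ t ht
    have hps : (p s : ℝ) ≤ κ := hκ s hs
    have hreal : dist ((p t : ℝ) * u t) ((p s : ℝ) * u s)
        ≤ κ * (dist (u c) (u s) + dist (u t) (u c)) + K * (‖u c‖ * (t - s)) := by
      have e : (p t : ℝ) * u t - p s * u s
          = p t * (u t - u c) + p s * (u c - u s) + (p t - p s) * u c := by ring
      rw [Real.dist_eq, Real.dist_eq, Real.dist_eq, e]
      have h1 := hK t ht s hs
      rw [abs_of_nonneg hst'] at h1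
      have h2 : |(p t : ℝ) * (u t - u c)| ≤ κ * |u t - u c| := by
        rw [abs_mul, abs_of_nonneg (p t).coe_nonneg]; gcongr
      have h3 : |(p s : ℝ) * (u c - u s)| ≤ κ * |u c - u s| := by
        rw [abs_mul, abs_of_nonneg (p s).coe_nonneg]; gcongr
      have h4 : |((p t : ℝ) - p s) * u c| ≤ K * (‖u c‖ * (t - s)) := by
        rw [abs_mul, Real.norm_eq_abs]
        calc |(p t : ℝ) - p s| * |u c| ≤ (K * (t - s)) * |u c| := by gcongr
          _ = _ := by ring
      have h5 := abs_add_three (p t * (u t - u c)) (p s * (u c - u s)) ((p t - p s) * u c)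
      linarith
    have hen : edist ((p t : ℝ) * u t) ((p s : ℝ) * u s)
        ≤ κ * (edist (u c) (u s) + edist (u t) (u c))
          + K * (‖u c‖ₑ * ENNReal.ofReal (t - s)) := by
      rw [edist_dist]
      refine (ENNReal.ofReal_le_ofReal hreal).trans (le_of_eq ?_)
      rw [ENNReal.ofReal_add (by positivity) (by positivity), ENNReal.ofReal_mul κ.coe_nonneg,
        ENNReal.ofReal_mul K.coe_nonneg, ENNReal.ofReal_add dist_nonneg dist_nonneg, ← edist_dist,
        ← edist_dist, ENNReal.ofReal_mul (norm_nonneg _), ofReal_norm]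
      simp
    refine hen.trans ?_
    have hv : edist (u c) (u s) + edist (u t) (u c) ≤ eVariationOn u (Icc s t) := by
      have := eVariationOn.Icc_add_Icc u (s := univ) hc.1 hc.2 (mem_univ c)
      simp only [univ_inter] at this
      rw [← this]
      exact add_le_add (eVariationOn.edist_le u ⟨hc.1, le_rfl⟩ ⟨le_rfl, hc.1⟩)
        (eVariationOn.edist_le u ⟨hc.2, le_rfl⟩ ⟨le_rfl, hc.2⟩)
    have hint : ∫⁻ r in Ioc s t, ‖u r‖ₑ = ∫⁻ r in Icc s t, ‖u r‖ₑ :=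
      setLIntegral_congr Ioc_ae_eq_Icc
    rw [hint]
    gcongr
  refine iSup_le fun ⟨n, v, hv, hmem⟩ => ?_
  dsimp only
  calc ∑ i ∈ Finset.range n, edist ((p (v (i + 1)) : ℝ) * u (v (i + 1))) ((p (v i) : ℝ) * u (v i))
      ≤ ∑ i ∈ Finset.range n, (κ * eVariationOn u (Icc (v i) (v (i + 1)))
          + K * ∫⁻ r in Ioc (v i) (v (i + 1)), ‖u r‖ₑ) :=
        Finset.sum_le_sum fun i _ => term _ (hmem i) _ (hmem _) (hv (Nat.le_succ i))
    _ = κ * eVariationOn u (Icc (v 0) (v n))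
          + K * ∑ i ∈ Finset.range n, ∫⁻ r in Ioc (v i) (v (i + 1)), ‖u r‖ₑ := by
        rw [Finset.sum_add_distrib, ← Finset.mul_sum, ← Finset.mul_sum, eVariationOn.sum' u hv]
    _ ≤ κ * eVariationOn u (Icc a b) + K * ∫⁻ t in Icc a b, ‖u t‖ₑ := by
        have h1 : eVariationOn u (Icc (v 0) (v n)) ≤ eVariationOn u (Icc a b) :=
          eVariationOn.mono u (Icc_subset_Icc (hmem 0).1 (hmem n).2)
        have h2 : ∑ i ∈ Finset.range n, ∫⁻ r in Ioc (v i) (v (i + 1)), ‖u r‖ₑ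
            ≤ ∫⁻ t in Icc a b, ‖u t‖ₑ := by
          have hd : ((Finset.range n : Finset ℕ) : Set ℕ).PairwiseDisjoint
              fun i => Ioc (v i) (v (i + 1)) := hv.pairwise_disjoint_on_Ioc_succ.set_pairwise _
          rw [← lintegral_biUnion_finset hd (fun _ _ => measurableSet_Ioc)]
          refine lintegral_mono_set (iUnion₂_subset fun i _ => ?_)
          exact Ioc_subset_Icc_self.trans (Icc_subset_Icc (hmem i).1 (hmem _).2)
        gcongr

/-- The cut-off creates jumps of size at most `|u a|` and `|u b|`. Comparing both with a point where
`|u|` is at most its mean costs the variation on `[a, b]` once more, whence the factor 2. -/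
theorem eVariationOn_indicator_Icc_le {a b : unitInterval} (hab : a < b) (u : unitInterval → ℝ) :
    eVariationOn ((Icc a b).indicator u) univ
      ≤ 2 * eVariationOn u univ + 2 / ENNReal.ofReal (b - a) * ∫⁻ t in Icc a b, ‖u t‖ₑ := by
  by_cases htop : eVariationOn u univ = ⊤
  · simp [htop]
  have hu := bv_measurable htop
  set f := (Icc a b).indicator u with hf
  have hfa : f a = u a := indicator_of_mem (left_mem_Icc.2 hab.le) u
  have hfb : f b = u b := indicator_of_mem (right_mem_Icc.2 hab.le) u
  -- On `[0, a]` the function factors monotonically through the two points `0` and `a`, so its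
  -- variation is that of a single jump.
  have h0 : eVariationOn f (Icc 0 a) ≤ ‖u a‖ₑ := by
    have heq : EqOn f (f ∘ fun t => if t < a then 0 else a) (Icc 0 a) := by
      intro t ht
      simp only [Function.comp]
      split_ifs with h
      · have h1 : t ∉ Icc a b := fun h' => absurd h (not_lt.2 h'.1)
        have h2 : (0 : unitInterval) ∉ Icc a b := fun h' =>
          absurd (unitInterval.nonneg'.trans_lt h) (not_lt.2 h'.1)
        rw [hf, indicator_of_notMem h1, indicator_of_notMem h2]
      · rw [le_antisymm ht.2 (not_lt.1 h)]
    rw [eVariationOn.congr heq]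
    refine (eVariationOn.comp_le_of_monotoneOn f (s := {0, a})
      (fun t : unitInterval => if t < a then 0 else a) ?_ ?_).trans ?_
    · intro s hs t ht hst
      dsimp only
      split_ifs with h1 h2 h2
      · exact le_rfl
      · exact unitInterval.nonneg'
      · exact absurd (hst.trans_lt h2) h1
      · exact le_rfl
    · intro t ht
      dsimp only
      split_ifs <;> simp
    · rw [eVariationOn.pair]
      rcases eq_or_ne a 0 with rfl | ha
      · simp
      · have : (0 : unitInterval) ∉ Icc a b := fun h' =>
          ha (le_antisymm h'.1 unitInterval.nonneg')
        rw [hfa, hf, indicator_of_notMem this, edist_zero_left]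
        exact le_rfl
  have h1 : eVariationOn f (Icc b 1) ≤ ‖u b‖ₑ := by
    have heq : EqOn f (f ∘ fun t => if b < t then 1 else b) (Icc b 1) := by
      intro t ht
      simp only [Function.comp]
      split_ifs with h
      · have h1 : t ∉ Icc a b := fun h' => absurd h (not_lt.2 h'.2)
        have h2 : (1 : unitInterval) ∉ Icc a b := fun h' =>
          absurd (h.trans_le unitInterval.le_one') (not_lt.2 h'.2)
        rw [hf, indicator_of_notMem h1, indicator_of_notMem h2]
      · rw [le_antisymm (not_lt.1 h) ht.1]
    rw [eVariationOn.congr heq]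
    refine (eVariationOn.comp_le_of_monotoneOn f (s := {b, 1})
      (fun t : unitInterval => if b < t then 1 else b) ?_ ?_).trans ?_
    · intro s hs t ht hst
      dsimp only
      split_ifs with h1 h2 h2
      · exact le_rfl
      · exact absurd (h1.trans_le hst) h2
      · exact unitInterval.le_one'
      · exact le_rfl
    · intro t ht
      dsimp only
      split_ifs <;> simp
    · rw [eVariationOn.pair]
      rcases eq_or_ne b 1 with rfl | hb
      · simp
      · have : (1 : unitInterval) ∉ Icc a b := fun h' =>
          hb (le_antisymm unitInterval.le_one' h'.2)
        rw [hfb, hf, indicator_of_notMem this, edist_zero_right]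
  have h2 : eVariationOn f (Icc a b) = eVariationOn u (Icc a b) :=
    eVariationOn.congr fun t ht => indicator_of_mem ht u
  have hsplit : eVariationOn f univ
      = eVariationOn f (Icc 0 a) + eVariationOn f (Icc a b) + eVariationOn f (Icc b 1) := by
    have e1 := eVariationOn.Icc_add_Icc f (s := univ) (unitInterval.nonneg' (t := a)) hab.le
      (mem_univ a)
    have e2 := eVariationOn.Icc_add_Icc f (s := univ) (unitInterval.nonneg' (t := b))
      (unitInterval.le_one' (t := b)) (mem_univ b)
    simp only [univ_inter] at e1 e2
    rw [e1, e2]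
    congr 1
    ext t
    simp [unitInterval.le_one']
  obtain ⟨c, hc, hle⟩ := exists_enorm_mul_le_setLIntegral hab hu
  have hab' : ENNReal.ofReal (b - a) ≠ 0 := by
    simpa using hab
  have hcle : ‖u c‖ₑ ≤ 1 / ENNReal.ofReal (b - a) * ∫⁻ t in Icc a b, ‖u t‖ₑ := by
    rw [one_div, mul_comm, ← div_eq_mul_inv]
    exact (ENNReal.le_div_iff_mul_le (Or.inl hab') (Or.inl ENNReal.ofReal_ne_top)).2 hle
  have hends : ‖u a‖ₑ + ‖u b‖ₑ ≤ eVariationOn u (Icc a b) + 2 * ‖u c‖ₑ := by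
    have e := eVariationOn.Icc_add_Icc u (s := univ) hc.1 hc.2 (mem_univ c)
    simp only [univ_inter] at e
    have e1 : edist (u a) (u c) ≤ eVariationOn u (Icc a c) :=
      eVariationOn.edist_le u ⟨le_rfl, hc.1⟩ ⟨hc.1, le_rfl⟩
    have e2 : edist (u b) (u c) ≤ eVariationOn u (Icc c b) :=
      eVariationOn.edist_le u ⟨hc.2, le_rfl⟩ ⟨le_rfl, hc.2⟩
    have e3 : ∀ x : ℝ, ‖x‖ₑ ≤ edist x (u c) + ‖u c‖ₑ := fun x => by
      rw [← edist_zero_right x, ← edist_zero_right (u c)]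
      exact edist_triangle _ _ _
    calc ‖u a‖ₑ + ‖u b‖ₑ ≤ (edist (u a) (u c) + ‖u c‖ₑ) + (edist (u b) (u c) + ‖u c‖ₑ) :=
          add_le_add (e3 _) (e3 _)
      _ = (edist (u a) (u c) + edist (u b) (u c)) + 2 * ‖u c‖ₑ := by ring
      _ ≤ _ := by rw [← e]; gcongr
  have hmono : eVariationOn u (Icc a b) ≤ eVariationOn u univ := eVariationOn.mono u (subset_univ _)
  calc eVariationOn f univ
      ≤ ‖u a‖ₑ + eVariationOn u (Icc a b) + ‖u b‖ₑ := by rw [hsplit, h2]; gcongr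
    _ = (‖u a‖ₑ + ‖u b‖ₑ) + eVariationOn u (Icc a b) := by ring
    _ ≤ (eVariationOn u univ + 2 * (1 / ENNReal.ofReal (b - a) * ∫⁻ t in Icc a b, ‖u t‖ₑ))
        + eVariationOn u univ := by
        refine add_le_add (hends.trans ?_) hmono
        gcongr
    _ = _ := by rw [← mul_assoc, mul_one_div]; ring

end Jab

namespace Jab

/-! ### Inverse branches in one variable -/

/-- The inverse branch of a monotone map `φ` on `[a, b]` together with its weight, extended to the
whole unit interval, and the one-dimensional estimate for the variation. -/
structure Branch (φ : ℝ → ℝ) (κ : ℝ≥0) (a b : unitInterval) where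
  c : unitInterval
  d : unitInterval
  lt : c < d
  ψ : unitInterval → unitInterval
  w : unitInterval → ℝ≥0
  K : ℝ≥0
  measurable_ψ : Measurable ψ
  measurable_w : Measurable w
  right_inv : ∀ t ∈ Icc c d, φ (ψ t) = t
  map_eq : Measure.map ψ ((volume.restrict (Icc c d)).withDensity fun t => (w t : ℝ≥0∞))
    = volume.restrict (Icc a b)
  var_le : ∀ u : unitInterval → ℝ, eVariationOn (fun t => (w t : ℝ) * u (ψ t)) univ
    ≤ κ * eVariationOn u univ + K * ∫⁻ t in Icc a b, ‖u t‖ₑ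

theorem coe_image_Icc (a b : unitInterval) :
    (Subtype.val '' Icc a b : Set ℝ) = Icc (a : ℝ) b := by
  ext x
  constructor
  · rintro ⟨t, ht, rfl⟩; exact ht
  · intro hx
    exact ⟨⟨x, a.2.1.trans hx.1, hx.2.trans b.2.2⟩, hx, rfl⟩

theorem setLIntegral_unitInterval_Icc (a b : unitInterval) (G : ℝ → ℝ≥0∞) :
    ∫⁻ t in Icc a b, G (t : unitInterval) = ∫⁻ x in Icc (a : ℝ) b, G x := by
  have := setLIntegral_subtype (μ := (volume : Measure ℝ)) (s := unitInterval)
    measurableSet_Icc (Icc a b) G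
  rw [coe_image_Icc] at this
  exact this

/-- The inverse of `φ` is precomposed with the projection onto `[c, d]`, hence constant on either
side of it. The weighted function therefore has no jump at `c` or `d`, and the coefficient of the
variation is `κ` instead of `2κ`. The price is that the transferred density has to be cut off later.
-/
theorem nonempty_branch {φ : ℝ → ℝ} {x y : ℝ}
    (hφ : ContDiffOn ℝ 2 φ (Icc x y))
    (hmono : MonotoneOn φ (Icc x y) ∨ AntitoneOn φ (Icc x y)) {κ : ℝ≥0} (hκ : 0 < κ)
    (hD : ∀ t ∈ Icc x y, (κ : ℝ)⁻¹ ≤ |derivWithin φ (Icc x y) t|)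
    (hmaps : MapsTo φ (Icc x y) (Icc 0 1)) {a b : unitInterval} (hab : a < b)
    (ha : x ≤ a) (hb : (b : ℝ) ≤ y) : Nonempty (Branch φ κ a b) := by
  have hab' : (a : ℝ) < b := hab
  have hxy : x < y := ha.trans_lt (hab'.trans_le hb)
  have hU : UniqueDiffOn ℝ (Icc x y) := uniqueDiffOn_Icc hxy
  set D := derivWithin φ (Icc x y) with hDdef
  have hDiff : DifferentiableOn ℝ φ (Icc x y) := hφ.differentiableOn (by norm_num)
  have hDC : ContDiffOn ℝ 1 D (Icc x y) := hφ.derivWithin hU (by norm_num)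
  have hDc : ContinuousOn D (Icc x y) := hDC.continuousOn
  obtain ⟨L, hL⟩ : ∃ L : ℝ≥0, LipschitzOnWith L D (Icc x y) := by
    have h1 := hDC.continuousOn_derivWithin hU le_rfl
    obtain ⟨C, hC⟩ := isCompact_Icc.exists_bound_of_continuousOn h1
    refine ⟨C.toNNReal, (convex_Icc x y).lipschitzOnWith_of_nnnorm_derivWithin_le
      (hDC.differentiableOn one_ne_zero) fun t ht => ?_⟩
    rw [← NNReal.coe_le_coe, coe_nnnorm]
    exact (hC t ht).trans (Real.le_coe_toNNReal C)
  have hκ' : (0 : ℝ) < κ := hκ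
  -- Monotonicity is only weak. Two equal values would give a zero of the derivative by Rolle's
  -- theorem, against the lower bound for the slope.
  have hinj : InjOn φ (Icc x y) := by
    have aux : ∀ s ∈ Icc x y, ∀ t ∈ Icc x y, s < t → φ s ≠ φ t := by
      intro s hs t ht hst heq
      have hsub : Icc s t ⊆ Icc x y := Icc_subset_Icc hs.1 ht.2
      obtain ⟨ξ, hξ, hξ0⟩ := exists_deriv_eq_zero hst (hφ.continuousOn.mono hsub) heq
      have hn : Icc x y ∈ 𝓝 ξ := Icc_mem_nhds (hs.1.trans_lt hξ.1) (hξ.2.trans_le ht.2)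
      have h1 := hD ξ (hsub (Ioo_subset_Icc_self hξ))
      rw [hDdef, derivWithin_of_mem_nhds hn, hξ0, abs_zero] at h1
      exact absurd h1 (not_le.2 (inv_pos.2 hκ'))
    intro s hs t ht heq
    rcases lt_trichotomy s t with h | h | h
    · exact absurd heq (aux s hs t ht h)
    · exact h
    · exact absurd heq.symm (aux t ht s hs h)
  have hmem : ∀ t ∈ Icc a b, (t : ℝ) ∈ Icc x y := fun t ht =>
    ⟨ha.trans (show (a : ℝ) ≤ t from ht.1), (show (t : ℝ) ≤ b from ht.2).trans hb⟩
  set φI : unitInterval → unitInterval := fun t => projIcc 0 1 zero_le_one (φ t) with hφI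
  have hφIv : ∀ t ∈ Icc a b, (φI t : ℝ) = φ t := fun t ht => by
    simp only [hφI]
    rw [projIcc_of_mem zero_le_one (hmaps (hmem t ht))]
  have hφIc : ContinuousOn φI (Icc a b) :=
    continuous_projIcc.comp_continuousOn
      (hφ.continuousOn.comp continuous_subtype_val.continuousOn hmem)
  have hφIinj : InjOn φI (Icc a b) := by
    intro s hs t ht h
    have : φ s = φ t := by rw [← hφIv s hs, ← hφIv t ht, h]
    exact Subtype.ext (hinj (hmem s hs) (hmem t ht) this)
  set c := min (φI a) (φI b) with hc
  set d := max (φI a) (φI b) with hd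
  have hne : φI a ≠ φI b := fun h =>
    hab.ne (hφIinj (left_mem_Icc.2 hab.le) (right_mem_Icc.2 hab.le) h)
  have hcd : c < d := min_lt_max.2 hne
  have hmonoI : StrictMonoOn φI (Icc a b) ∨ StrictAntiOn φI (Icc a b) := by
    rcases hmono with h | h
    · left
      refine MonotoneOn.strictMonoOn_of_injOn (fun s hs t ht hst => ?_) hφIinj
      change (φI s : ℝ) ≤ φI t
      rw [hφIv s hs, hφIv t ht]
      exact h (hmem s hs) (hmem t ht) hst
    · right
      refine AntitoneOn.strictAntiOn_of_injOn (fun s hs t ht hst => ?_) hφIinj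
      change (φI t : ℝ) ≤ φI s
      rw [hφIv s hs, hφIv t ht]
      exact h (hmem s hs) (hmem t ht) hst
  have himg : φI '' Icc a b = Icc c d := by
    apply Subset.antisymm
    · rintro _ ⟨t, ht, rfl⟩
      have hat : a ∈ Icc a b := left_mem_Icc.2 hab.le
      have hbt : b ∈ Icc a b := right_mem_Icc.2 hab.le
      rcases hmonoI with h | h
      · exact ⟨(min_le_left _ _).trans (h.monotoneOn hat ht ht.1),
          (h.monotoneOn ht hbt ht.2).trans (le_max_right _ _)⟩
      · exact ⟨(min_le_right _ _).trans (h.antitoneOn ht hbt ht.2),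
          (h.antitoneOn hat ht ht.1).trans (le_max_left _ _)⟩
    · have := intermediate_value_uIcc (f := φI) (a := a) (b := b)
        (by rwa [uIcc_of_le hab.le])
      rwa [uIcc_of_le hab.le] at this
  have himgR : φ '' Icc (a : ℝ) b = Icc (c : ℝ) d := by
    rw [← coe_image_Icc, ← coe_image_Icc, ← himg, image_image, image_image]
    exact image_congr fun t ht => (hφIv t ht).symm
  set ψ : unitInterval → unitInterval := fun t =>
    Function.invFunOn φI (Icc a b) (projIcc c d hcd.le t) with hψ
  have hproj : ∀ t, (projIcc c d hcd.le t : unitInterval) ∈ φI '' Icc a b := fun t => by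
    rw [himg]; exact Subtype.prop _
  have hψmem : ∀ t, ψ t ∈ Icc a b := fun t => Function.invFunOn_mem (hproj t)
  have hφψ : ∀ t, φI (ψ t) = projIcc c d hcd.le t := fun t => Function.invFunOn_eq (hproj t)
  have hψφ : ∀ t ∈ Icc a b, ψ (φI t) = t := by
    intro t ht
    refine hφIinj (hψmem _) ht ?_
    have : φI t ∈ Icc c d := himg ▸ mem_image_of_mem _ ht
    rw [hφψ, projIcc_of_mem _ this]
  have hψmono : Monotone ψ ∨ Antitone ψ := by
    rcases hmonoI with h | h
    · left
      intro s t hst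
      rw [← h.le_iff_le (hψmem s) (hψmem t), hφψ, hφψ]
      exact monotone_projIcc hcd.le hst
    · right
      intro s t hst
      rw [← h.le_iff_ge (hψmem s) (hψmem t), hφψ, hφψ]
      exact monotone_projIcc hcd.le hst
  have hψm : Measurable ψ := hψmono.elim Monotone.measurable Antitone.measurable
  -- The derivative, continued by its one-sided boundary values, so that the weight is Borel on the
  -- whole unit interval.
  set D' : ℝ → ℝ := IccExtend hxy.le ((Icc x y).domRestrict D) with hD'
  have hD'c : Continuous D' := (continuousOn_iff_continuous_domRestrict.1 hDc).Icc_extend'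
  have hD'v : ∀ t ∈ Icc x y, D' t = D t := fun t ht => IccExtend_of_mem hxy.le _ ht
  set p : unitInterval → ℝ≥0 := fun t => ‖D' t‖₊⁻¹ with hp
  have hD'lb : ∀ t ∈ Icc a b, (κ : ℝ)⁻¹ ≤ ‖D' (t : unitInterval)‖ := fun t ht => by
    rw [hD'v _ (hmem t ht)]; exact hD _ (hmem t ht)
  have hD'pos : ∀ t ∈ Icc a b, 0 < ‖D' (t : unitInterval)‖ := fun t ht =>
    (inv_pos.2 hκ').trans_le (hD'lb t ht)
  have hpκ : ∀ t ∈ Icc a b, p t ≤ κ := by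
    intro t ht
    rw [← NNReal.coe_le_coe]
    simp only [hp, NNReal.coe_inv, coe_nnnorm]
    exact inv_le_of_inv_le₀ hκ' (hD'lb t ht)
  -- The constant comes from `1/x - 1/y = (y - x)/(xy)` with both reciprocals at most `κ` and `L` a
  -- Lipschitz constant of the derivative, which exists because `φ` is `C²`.
  have hpL : ∀ s ∈ Icc a b, ∀ t ∈ Icc a b,
      |(p s : ℝ) - p t| ≤ ((κ * κ * L : ℝ≥0) : ℝ) * |(s : ℝ) - t| := by
    intro s hs t ht
    have h1 := hL.dist_le_mul _ (hmem s hs) _ (hmem t ht)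
    rw [← hD'v _ (hmem s hs), ← hD'v _ (hmem t ht), Real.dist_eq, Real.dist_eq] at h1
    simp only [hp, NNReal.coe_inv, coe_nnnorm]
    have hs0 := hD'pos s hs
    have ht0 := hD'pos t ht
    have h2 : ‖D' s‖⁻¹ - ‖D' t‖⁻¹ = ‖D' s‖⁻¹ * ‖D' t‖⁻¹ * (‖D' t‖ - ‖D' s‖) := by
      field_simp
    have h3 : |‖D' t‖ - ‖D' s‖| ≤ |D' s - D' t| := by
      rw [abs_sub_comm (D' s)]
      exact abs_abs_sub_abs_le_abs_sub _ _
    have hs1 : ‖D' s‖⁻¹ ≤ κ := inv_le_of_inv_le₀ hκ' (hD'lb s hs)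
    have ht1 : ‖D' t‖⁻¹ ≤ κ := inv_le_of_inv_le₀ hκ' (hD'lb t ht)
    rw [h2, abs_mul, abs_of_nonneg (by positivity)]
    push_cast
    calc ‖D' s‖⁻¹ * ‖D' t‖⁻¹ * |‖D' t‖ - ‖D' s‖| ≤ κ * κ * (L * |(s : ℝ) - t|) := by
          gcongr
          exact h3.trans h1
      _ = _ := by ring
  refine ⟨⟨c, d, hcd, ψ, fun t => p (ψ t), κ * κ * L, hψm, ?_, ?_, ?_, ?_⟩⟩
  · have : Measurable p :=
      ((hD'c.comp continuous_subtype_val).nnnorm.measurable).inv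
    exact this.comp hψm
  · intro t ht
    rw [← hφIv _ (hψmem t), hφψ, projIcc_of_mem _ ht]
  -- Change of variables on the line: `[c, d]` is the image of `[a, b]` under `φ`, and the Jacobian
  -- cancels the weight.
  · refine Measure.ext fun E hE => ?_
    rw [Measure.map_apply hψm hE, withDensity_apply _ (hψm hE), Measure.restrict_restrict (hψm hE),
      Measure.restrict_apply hE]
    set G : ℝ → ℝ≥0∞ := fun r =>
      (ψ ⁻¹' E).indicator (fun t => (p (ψ t) : ℝ≥0∞)) (projIcc 0 1 zero_le_one r) with hG
    have hmp : Measurable fun t => (p (ψ t) : ℝ≥0∞) :=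
      ((((hD'c.comp continuous_subtype_val).nnnorm.measurable).inv).comp hψm).coe_nnreal_ennreal
    have e1 : ∫⁻ t in ψ ⁻¹' E ∩ Icc c d, (p (ψ t) : ℝ≥0∞)
        = ∫⁻ t in Icc c d, G (t : unitInterval) := by
      rw [← setLIntegral_indicator (hψm hE)]
      refine lintegral_congr fun t => ?_
      simp only [hG, projIcc_val]
    rw [e1, setLIntegral_unitInterval_Icc, ← himgR,
      lintegral_image_eq_lintegral_abs_deriv_mul (f' := D) measurableSet_Icc (fun r hr => ?_)
        (hinj.mono (Icc_subset_Icc ha hb)), ← setLIntegral_unitInterval_Icc]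
    · have e2 : ∀ t ∈ Icc a b, ENNReal.ofReal |D (t : unitInterval)| * G (φ t)
          = E.indicator (fun _ => 1) t := by
        intro t ht
        have hψt : ψ (projIcc 0 1 zero_le_one (φ t)) = t := hψφ t ht
        have h0 := hD'pos t ht
        by_cases htE : t ∈ E
        · have h1 : projIcc 0 1 zero_le_one (φ t) ∈ ψ ⁻¹' E := by
            rw [mem_preimage, hψt]; exact htE
          rw [indicator_of_mem htE]
          simp only [hG]
          rw [indicator_of_mem h1, hψt]
          simp only [hp]
          rw [← hD'v _ (hmem t ht), ← Real.norm_eq_abs, ofReal_norm,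
            ENNReal.coe_inv (by simpa using h0), ← enorm_eq_nnnorm]
          exact ENNReal.mul_inv_cancel (by simpa using h0) enorm_ne_top
        · have h1 : projIcc 0 1 zero_le_one (φ t) ∉ ψ ⁻¹' E := by
            rw [mem_preimage, hψt]; exact htE
          rw [indicator_of_notMem htE]
          simp only [hG]
          rw [indicator_of_notMem h1, mul_zero]
      rw [setLIntegral_congr_fun measurableSet_Icc e2, lintegral_indicator hE]
      simp [Measure.restrict_apply hE]
    · have hr' : r ∈ Icc x y := ⟨ha.trans hr.1, hr.2.trans hb⟩
      exact ((hDiff r hr').hasDerivWithinAt).mono (Icc_subset_Icc ha hb)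
  · intro u
    -- If the variation is infinite, so is the right-hand side, because `κ > 0`. Otherwise `u` is
    -- measurable.
    by_cases htop : eVariationOn u univ = ⊤
    · rw [htop, ENNReal.mul_top (by simpa using hκ.ne')]
      simp
    have h1 : eVariationOn ((fun t => (p t : ℝ) * u t) ∘ ψ) univ
        ≤ eVariationOn (fun t => (p t : ℝ) * u t) (Icc a b) := by
      rcases hψmono with h | h
      · exact eVariationOn.comp_le_of_monotoneOn _ ψ (h.monotoneOn _) fun t _ => hψmem t
      · exact eVariationOn.comp_le_of_antitoneOn _ ψ (h.antitoneOn _) fun t _ => hψmem t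
    refine h1.trans ((eVariationOn_mul_le (bv_measurable htop) hpκ hpL).trans ?_)
    gcongr
    exact eVariationOn.mono u (subset_univ _)

end Jab

namespace Jab

/-! ### Splitting off one coordinate -/

theorem insertNth_measurePreserving {d : ℕ} (i : Fin (d + 1)) :
    MeasurePreserving (fun p : unitInterval × Cube d => (i.insertNth p.1 p.2 : Cube (d + 1)))
      volume volume :=
  (volume_preserving_piFinSuccAbove (fun _ : Fin (d + 1) => unitInterval) i).symm

theorem measurable_insertNth {d : ℕ} (i : Fin (d + 1)) :
    Measurable (fun p : unitInterval × Cube d => (i.insertNth p.1 p.2 : Cube (d + 1))) :=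
  (insertNth_measurePreserving i).measurable

theorem measurable_removeNth {d : ℕ} (i : Fin (d + 1)) :
    Measurable (fun x : Cube (d + 1) => (i.removeNth x : Cube d)) :=
  measurable_pi_lambda _ fun j => measurable_pi_apply (i.succAbove j)

theorem lintegral_insertNth {d : ℕ} (i : Fin (d + 1)) {H : Cube (d + 1) → ℝ≥0∞}
    (hH : Measurable H) : ∫⁻ x, H x = ∫⁻ y : Cube d, ∫⁻ t, H (i.insertNth t y) := by
  rw [← (insertNth_measurePreserving i).lintegral_comp hH]
  exact lintegral_prod_symm' _ (hH.comp (measurable_insertNth i))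

theorem ae_insertNth {d : ℕ} (i : Fin (d + 1)) {p : Cube (d + 1) → Prop} (h : ∀ᵐ x, p x) :
    ∀ᵐ y : Cube d, ∀ᵐ t, p (i.insertNth t y) := by
  have h1 : ∀ᵐ q : unitInterval × Cube d, p (i.insertNth q.1 q.2) :=
    (insertNth_measurePreserving i).quasiMeasurePreserving.ae h
  have h2 : ∀ᵐ q : Cube d × unitInterval, p (i.insertNth q.swap.1 q.swap.2) :=
    (Measure.measurePreserving_swap (μ := (volume : Measure (Cube d)))
      (ν := (volume : Measure unitInterval))).quasiMeasurePreserving.ae h1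
  exact Measure.ae_ae_of_ae_prod h2

theorem indicator_Icc_insertNth {d : ℕ} {M : Type*} [Zero M] (i : Fin (d + 1))
    (a b : Cube (d + 1)) (H : Cube (d + 1) → M) (t : unitInterval) (y : Cube d) :
    (Icc a b).indicator H (i.insertNth t y)
      = (Icc (i.removeNth a) (i.removeNth b)).indicator
          (fun y => (Icc (a i) (b i)).indicator (fun t => H (i.insertNth t y)) t) y := by
  have : (i.insertNth t y : Cube (d + 1)) ∈ Icc a b ↔
      t ∈ Icc (a i) (b i) ∧ y ∈ Icc (i.removeNth a) (i.removeNth b) := Fin.insertNth_mem_Icc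
  by_cases hy : y ∈ Icc (i.removeNth a) (i.removeNth b)
  · rw [indicator_of_mem hy]
    by_cases ht : t ∈ Icc (a i) (b i)
    · rw [indicator_of_mem ht, indicator_of_mem (this.2 ⟨ht, hy⟩)]
    · rw [indicator_of_notMem ht, indicator_of_notMem fun h => ht (this.1 h).1]
  · rw [indicator_of_notMem hy, indicator_of_notMem fun h => hy (this.1 h).2]

theorem setLIntegral_Icc_insertNth {d : ℕ} (i : Fin (d + 1)) (a b : Cube (d + 1))
    {H : Cube (d + 1) → ℝ≥0∞} (hH : Measurable H) :
    ∫⁻ x in Icc a b, H x = ∫⁻ y in Icc (i.removeNth a) (i.removeNth b),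
      ∫⁻ t in Icc (a i) (b i), H (i.insertNth t y) := by
  rw [← lintegral_indicator measurableSet_Icc,
    lintegral_insertNth i (hH.indicator measurableSet_Icc),
    ← lintegral_indicator measurableSet_Icc]
  refine lintegral_congr fun y => ?_
  simp only [indicator_Icc_insertNth]
  by_cases hy : y ∈ Icc (i.removeNth a) (i.removeNth b)
  · simp only [indicator_of_mem hy]
    rw [lintegral_indicator measurableSet_Icc]
  · simp only [indicator_of_notMem hy, lintegral_zero]

theorem measurable_lintegral_insertNth {d : ℕ} (i : Fin (d + 1)) (s : Set unitInterval)
    {H : Cube (d + 1) → ℝ≥0∞} (hH : Measurable H) :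
    Measurable fun y : Cube d => ∫⁻ t in s, H (i.insertNth t y) :=
  (hH.comp (measurable_insertNth i)).lintegral_prod_left'

theorem lintegral_prod_pi {n : ℕ} {f : Fin n → unitInterval → ℝ≥0∞} (hf : ∀ j, Measurable (f j)) :
    ∫⁻ x : Cube n, ∏ j, f j (x j) = ∏ j, ∫⁻ t, f j t := by
  induction n with
  | zero => simp
  | succ n ih =>
    rw [lintegral_insertNth 0]
    · simp only [Fin.prod_univ_succ, Fin.insertNth_zero', Fin.cons_zero, Fin.cons_succ]
      have h1 : ∀ y : Cube n, ∫⁻ t, f 0 t * ∏ j, f j.succ (y j)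
          = (∫⁻ t, f 0 t) * ∏ j, f j.succ (y j) := fun y =>
        lintegral_mul_const _ (hf 0)
      simp only [h1]
      rw [lintegral_const_mul _ (Finset.measurable_prod _ fun j _ =>
        (hf j.succ).comp (measurable_pi_apply j)), ih fun j => hf j.succ]
    · exact Finset.measurable_prod _ fun j _ => (hf j).comp (measurable_pi_apply j)

/-! ### Products of inverse branches -/

section BranchProd

variable {n : ℕ} {φ : Fin n → ℝ → ℝ} {κ : ℝ≥0} {a b : Cube n}
  (β : ∀ j, Branch (φ j) κ (a j) (b j))

/-- The product of one-dimensional inverse branches. -/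
def branchMap (x : Cube n) : Cube n := fun j => (β j).ψ (x j)

/-- The weight of a product of inverse branches. -/
def branchWeight (x : Cube n) : ℝ≥0 := ∏ j, (β j).w (x j)

/-- The lower corner of the image rectangle. -/
def branchLo : Cube n := fun j => (β j).c

/-- The upper corner of the image rectangle. -/
def branchHi : Cube n := fun j => (β j).d

theorem measurable_branchMap : Measurable (branchMap β) :=
  measurable_pi_lambda _ fun j => (β j).measurable_ψ.comp (measurable_pi_apply j)

theorem measurable_branchWeight : Measurable (branchWeight β) :=
  Finset.measurable_prod _ fun j _ => (β j).measurable_w.comp (measurable_pi_apply j)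

/-- Weight and rectangle both factor over the coordinates, so the weighted measure is a product, and
the image of a product measure is the product of the images. Each factor is finite because its image
is Lebesgue measure on an interval. -/
theorem map_branchMap :
    Measure.map (branchMap β) ((volume.restrict (Icc (branchLo β) (branchHi β))).withDensity
      fun x => (branchWeight β x : ℝ≥0∞)) = volume.restrict (Icc a b) := by
  set μ : Fin n → Measure unitInterval := fun j =>
    (volume.restrict (Icc (β j).c (β j).d)).withDensity fun t => ((β j).w t : ℝ≥0∞) with hμ
  have hfin : ∀ j, IsFiniteMeasure (μ j) := by
    intro j
    refine ⟨?_⟩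
    have h1 : Measure.map (β j).ψ (μ j) univ = μ j univ := by
      rw [Measure.map_apply (β j).measurable_ψ MeasurableSet.univ, preimage_univ]
    rw [← h1, (β j).map_eq]
    exact measure_lt_top _ _
  have hpi : (volume.restrict (Icc (branchLo β) (branchHi β))).withDensity
      (fun x => (branchWeight β x : ℝ≥0∞)) = Measure.pi μ := by
    refine (Measure.pi_eq fun s hs => ?_).symm
    have hsm : MeasurableSet (univ.pi s) := MeasurableSet.univ_pi hs
    rw [withDensity_apply _ hsm, ← lintegral_indicator hsm, ← lintegral_indicator measurableSet_Icc]
    have h1 : ∀ x : Cube n, (Icc (branchLo β) (branchHi β)).indicator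
        (fun x => (univ.pi s).indicator (fun x => (branchWeight β x : ℝ≥0∞)) x) x
        = ∏ j, (Icc (β j).c (β j).d ∩ s j).indicator (fun t => ((β j).w t : ℝ≥0∞)) (x j) := by
      intro x
      by_cases hx : x ∈ Icc (branchLo β) (branchHi β) ∩ univ.pi s
      · rw [indicator_of_mem hx.1, indicator_of_mem hx.2, branchWeight, ENNReal.ofNNReal_finsetProd]
        refine Finset.prod_congr rfl fun j _ => ?_
        rw [indicator_of_mem]
        exact ⟨⟨hx.1.1 j, hx.1.2 j⟩, hx.2 j (mem_univ j)⟩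
      · rw [indicator_indicator, indicator_of_notMem hx]
        have : ∃ j, x j ∉ Icc (β j).c (β j).d ∩ s j := by
          by_contra! hcon
          exact hx ⟨⟨fun j => (hcon j).1.1, fun j => (hcon j).1.2⟩, fun j _ => (hcon j).2⟩
        obtain ⟨j, hj⟩ := this
        exact (Finset.prod_eq_zero (Finset.mem_univ j) (indicator_of_notMem hj _)).symm
    rw [lintegral_congr h1, lintegral_prod_pi fun j =>
      (β j).measurable_w.coe_nnreal_ennreal.indicator (measurableSet_Icc.inter (hs j))]
    refine Finset.prod_congr rfl fun j _ => ?_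
    rw [lintegral_indicator (measurableSet_Icc.inter (hs j)), hμ]
    simp only
    rw [withDensity_apply _ (hs j), Measure.restrict_restrict (hs j), inter_comm]
  rw [hpi]
  have h2 : ∀ j, Measure.map (β j).ψ (μ j) = volume.restrict (Icc (a j) (b j)) :=
    fun j => (β j).map_eq
  have h3 : Measure.map (branchMap β) (Measure.pi μ)
      = Measure.pi fun j => Measure.map (β j).ψ (μ j) := by
    have : ∀ j, IsFiniteMeasure (Measure.map (β j).ψ (μ j)) := fun j => by
      rw [h2]; infer_instance
    exact Measure.pi_map_pi (μ := μ) (f := fun j => (β j).ψ)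
      fun j => (β j).measurable_ψ.aemeasurable
  rw [h3]
  simp only [h2]
  rw [← Measure.restrict_pi_pi, pi_univ_Icc]
  rfl

theorem setLIntegral_branch {H : Cube n → ℝ≥0∞} (hH : Measurable H) :
    ∫⁻ x in Icc (branchLo β) (branchHi β), branchWeight β x * H (branchMap β x)
      = ∫⁻ x in Icc a b, H x := by
  rw [← map_branchMap β, lintegral_map hH (measurable_branchMap β),
    lintegral_withDensity_eq_lintegral_mul _ (measurable_branchWeight β).coe_nnreal_ennreal
      (g := fun x => H (branchMap β x)) (hH.comp (measurable_branchMap β))]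
  rfl

/-- Null sets pull back to null sets only for the weighted measure, hence the exception where the
weight vanishes. -/
theorem ae_branch {p : Cube n → Prop} (h : ∀ᵐ x ∂volume.restrict (Icc a b), p x) :
    ∀ᵐ x ∂volume.restrict (Icc (branchLo β) (branchHi β)), branchWeight β x ≠ 0 →
      p (branchMap β x) := by
  rw [← map_branchMap β] at h
  have := ae_of_ae_map (measurable_branchMap β).aemeasurable h
  rw [ae_withDensity_iff (measurable_branchWeight β).coe_nnreal_ennreal] at this
  simpa using this

end BranchProd

end Jab

namespace Jab

/-! ### Densities of image measures -/

/-- `F` is the density of the image under `f` of the signed measure with density `g`. -/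
def IsPush {n : ℕ} (f : Cube n → Cube n) (g F : Cube n → ℝ) : Prop :=
  ∀ E : Set (Cube n), MeasurableSet E → ∫ x in E, F x = ∫ x in f ⁻¹' E, g x

namespace IsPush

variable {n : ℕ} {f f' : Cube n → Cube n} {g g' F F' : Cube n → ℝ}

theorem ae_unique (h : IsPush f g F) (h' : IsPush f g F') (hF : Integrable F)
    (hF' : Integrable F') : F =ᵐ[volume] F' :=
  hF.ae_eq_of_forall_setIntegral_eq _ _ hF' fun E hE _ => by rw [h E hE, h' E hE]

theorem congr_left (h : IsPush f g F) (hg : g =ᵐ[volume] g') : IsPush f g' F :=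
  fun E hE => (h E hE).trans (integral_congr_ae (ae_restrict_of_ae hg))

theorem congr_right (h : IsPush f g F) (hF : F =ᵐ[volume] F') : IsPush f g F' :=
  fun E hE => (integral_congr_ae (ae_restrict_of_ae hF.symm)).trans (h E hE)

theorem comp (h : IsPush f g F) (h' : IsPush f' F F') (hf' : Measurable f') :
    IsPush (f' ∘ f) g F' := fun E hE => by
  rw [h' E hE, h _ (hf' hE), preimage_comp]

theorem sum {ι : Type*} {s : Finset ι} {g F : ι → Cube n → ℝ} (h : ∀ k ∈ s, IsPush f (g k) (F k))
    (hg : ∀ k ∈ s, Integrable (g k)) (hF : ∀ k ∈ s, Integrable (F k)) :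
    IsPush f (fun x => ∑ k ∈ s, g k x) (fun x => ∑ k ∈ s, F k x) := fun E hE => by
  rw [integral_finsetSum _ fun k hk => (hF k hk).integrableOn,
    integral_finsetSum _ fun k hk => (hg k hk).integrableOn]
  exact Finset.sum_congr rfl fun k hk => h k hk E hE

theorem add (h : IsPush f g F) (h' : IsPush f g' F') (hg : Integrable g) (hg' : Integrable g')
    (hF : Integrable F) (hF' : Integrable F') :
    IsPush f (fun x => g x + g' x) (fun x => F x + F' x) := fun E hE => by
  rw [integral_add hF.integrableOn hF'.integrableOn, integral_add hg.integrableOn hg'.integrableOn,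
    h E hE, h' E hE]

theorem const_mul (h : IsPush f g F) (c : ℝ) :
    IsPush f (fun x => c * g x) (fun x => c * F x) := fun E hE => by
  rw [integral_const_mul, integral_const_mul, h E hE]

/-- Test the duality relation on the set where a Borel version of `F` is nonnegative and on its
complement; on each of them `|F|` integrates to plus or minus an integral of `g` over a preimage. -/
theorem integral_abs_le (h : IsPush f g F) (hf : Measurable f) (hg : Integrable g)
    (hF : Integrable F) : ∫ x, |F x| ≤ ∫ x, |g x| := by
  set F0 := hF.aestronglyMeasurable.mk F with hF0
  have hae : F =ᵐ[volume] F0 := hF.aestronglyMeasurable.ae_eq_mk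
  have hF0m : Measurable F0 := hF.aestronglyMeasurable.stronglyMeasurable_mk.measurable
  have hE : MeasurableSet {x | 0 ≤ F0 x} := measurableSet_le measurable_const hF0m
  set E : Set (Cube n) := {x | 0 ≤ F0 x} with hEdef
  have h1 : ∫ x in E, |F x| = ∫ x in f ⁻¹' E, g x := by
    rw [← h E hE]
    refine setIntegral_congr_ae hE ?_
    filter_upwards [hae] with x hx hxE
    rw [abs_of_nonneg]
    rw [hx]; exact hxE
  have h2 : ∫ x in Eᶜ, |F x| = -∫ x in (f ⁻¹' E)ᶜ, g x := by
    rw [← preimage_compl, ← h _ hE.compl, ← integral_neg]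
    refine setIntegral_congr_ae hE.compl ?_
    filter_upwards [hae] with x hx hxE
    rw [abs_of_nonpos]
    rw [hx]; exact (not_le.1 (show ¬ 0 ≤ F0 x from hxE)).le
  rw [← integral_add_compl hE hF.abs, h1, h2, ← integral_add_compl (hf hE) hg.abs]
  have h3 : ∫ x in f ⁻¹' E, g x ≤ ∫ x in f ⁻¹' E, |g x| :=
    integral_mono hg.integrableOn hg.abs.integrableOn fun x => le_abs_self _
  have h4 : -∫ x in (f ⁻¹' E)ᶜ, g x ≤ ∫ x in (f ⁻¹' E)ᶜ, |g x| := by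
    rw [← integral_neg]
    exact integral_mono hg.neg.integrableOn hg.abs.integrableOn fun x => neg_le_abs _
  exact add_le_add h3 h4

end IsPush

/-! ### Transfer of a density along one product branch. -/

section BranchPush

variable {n : ℕ} {φ : Fin n → ℝ → ℝ} {κ : ℝ≥0} {a b : Cube n}
  (β : ∀ j, Branch (φ j) κ (a j) (b j))

/-- The transfer of `g` along a product of branches. -/
noncomputable def branchPush (g : Cube n → ℝ) : Cube n → ℝ :=
  (Icc (branchLo β) (branchHi β)).indicator fun x => (branchWeight β x : ℝ) * g (branchMap β x)

theorem lintegral_branchPush {g : Cube n → ℝ} (hg : Measurable g) :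
    ∫⁻ x, ‖branchPush β g x‖ₑ = ∫⁻ x in Icc a b, ‖g x‖ₑ := by
  rw [← setLIntegral_branch β hg.enorm, ← lintegral_indicator measurableSet_Icc]
  refine lintegral_congr fun x => ?_
  unfold branchPush
  by_cases hx : x ∈ Icc (branchLo β) (branchHi β)
  · rw [indicator_of_mem hx, indicator_of_mem hx, enorm_mul]
    congr 1
    simp
  · rw [indicator_of_notMem hx, indicator_of_notMem hx, enorm_zero]

theorem integrable_branchPush {g : Cube n → ℝ} (hg : Measurable g) (hi : IntegrableOn g (Icc a b)) :
    Integrable (branchPush β g) := by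
  have hm : Measurable (branchPush β g) :=
    (((measurable_branchWeight β).coe_nnreal_real.mul
      (hg.comp (measurable_branchMap β))).indicator measurableSet_Icc)
  refine ⟨hm.aestronglyMeasurable, ?_⟩
  rw [HasFiniteIntegral, lintegral_branchPush β hg]
  exact hi.2

/-- The branch is a right inverse of `f` wherever its weight is nonzero, so a point of the image
rectangle lies in `E` exactly when the branch maps it into `f⁻¹ E`. Where the weight vanishes, both
sides contribute zero. -/
theorem isPush_branchPush {f : Cube n → Cube n} (hfm : Measurable f)
    (hf : ∀ᵐ x ∂volume.restrict (Icc a b), ∀ j, (f x j : ℝ) = φ j (x j))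
    {g : Cube n → ℝ} (hg : Measurable g) :
    IsPush f ((Icc a b).indicator g) (branchPush β g) := by
  intro E hE
  have hinv : ∀ᵐ x ∂volume.restrict (Icc (branchLo β) (branchHi β)),
      branchWeight β x ≠ 0 → f (branchMap β x) = x := by
    filter_upwards [ae_branch β hf, ae_restrict_mem measurableSet_Icc] with x hx hxm h0
    funext j
    refine Subtype.ext ?_
    rw [hx h0 j]
    exact (β j).right_inv (x j) ⟨hxm.1 j, hxm.2 j⟩
  rw [← integral_indicator (hfm hE), indicator_indicator, inter_comm, ← indicator_indicator,
    integral_indicator measurableSet_Icc, ← map_branchMap β,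
    integral_map (measurable_branchMap β).aemeasurable
      (hg.indicator (hfm hE)).aestronglyMeasurable,
    integral_withDensity_eq_integral_smul (measurable_branchWeight β),
    ← integral_indicator hE, branchPush, indicator_indicator, inter_comm, ← indicator_indicator,
    integral_indicator measurableSet_Icc]
  refine integral_congr_ae ?_
  filter_upwards [hinv] with x hx
  by_cases h0 : branchWeight β x = 0
  · simp [h0]
  · have : branchMap β x ∈ f ⁻¹' E ↔ x ∈ E := by rw [mem_preimage, hx h0]
    by_cases hxE : x ∈ E
    · rw [indicator_of_mem hxE, indicator_of_mem (this.2 hxE)]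
      rfl
    · rw [indicator_of_notMem hxE, indicator_of_notMem (fun h => hxE (this.1 h)), smul_zero]

end BranchPush

/-! ### Directional variation -/

/-- A Borel version of the regularised representative. -/
theorem exists_measurable_reg {d : ℕ} (i : Fin (d + 1)) {f g : Cube (d + 1) → ℝ}
    (hf : AEStronglyMeasurable f volume) (hgf : g =ᵐ[volume] f)
    (hfin : ∀ᵐ y, lineVar i g y ≠ ⊤) :
    ∃ g', Measurable g' ∧ g' =ᵐ[volume] f ∧ AEMeasurable (lineVar i g') volume ∧
      ∀ᵐ y, lineVar i g' y ≤ lineVar i g y := by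
  have hmk : StronglyMeasurable (hf.mk f) := hf.stronglyMeasurable_mk
  set F : unitInterval × Cube d → ℝ := fun p => hf.mk f (i.insertNth p.1 p.2) with hFdef
  have hF : StronglyMeasurable F := hmk.comp_measurable (measurable_insertNth i)
  have hline : ∀ᵐ y : Cube d, (fun t => g (i.insertNth t y)) =ᵐ[volume] fun t => F (t, y) :=
    ae_insertNth i (hgf.trans hf.ae_eq_mk)
  have hsp : Measurable fun x : Cube (d + 1) => (x i, (i.removeNth x : Cube d)) :=
    (measurable_pi_apply i).prodMk (measurable_removeNth i)
  set G : Cube (d + 1) → ℝ := fun x =>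
    limUnder atTop fun m => avg m (fun t => F (t, i.removeNth x)) (x i) with hGdef
  have hGm : Measurable G := by
    refine StronglyMeasurable.measurable (StronglyMeasurable.limUnder fun m => ?_)
    exact ((avg_joint_measurable hF m).comp hsp).stronglyMeasurable
  have hGline : ∀ y : Cube d, (fun t => G (i.insertNth t y)) = reg fun t => F (t, y) := by
    intro y
    funext t
    simp only [hGdef, Fin.removeNth_insertNth, Fin.insertNth_apply_same]
    rfl
  have hlv : ∀ᵐ y : Cube d, lineVar i G y
      = eVariationOn (reg fun t => g (i.insertNth t y)) univ := by
    filter_upwards [hline] with y hy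
    unfold lineVar
    rw [hGline]
    congr 1
    funext t
    simp only [reg, avg_congr hy]
  have hGF : G =ᵐ[volume] hf.mk f := by
    have hS : MeasurableSet {x : Cube (d + 1) | G x = hf.mk f x} :=
      measurableSet_eq_fun hGm hmk.measurable
    have h1 : ∀ᵐ y : Cube d, ∀ᵐ t, G (i.insertNth t y) = hf.mk f (i.insertNth t y) := by
      filter_upwards [hline, hfin] with y hy hy'
      filter_upwards [avg_tendsto_self hy', hy] with t ht ht'
      simp only [avg_congr hy] at ht
      have : G (i.insertNth t y) = reg (fun t => F (t, y)) t := congrFun (hGline y) t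
      rw [this]
      exact (ht.limUnder_eq).trans ht'
    have h2 : ∫⁻ x, {x | G x = hf.mk f x}ᶜ.indicator (fun _ => (1 : ℝ≥0∞)) x = 0 := by
      rw [lintegral_insertNth i (measurable_const.indicator hS.compl)]
      rw [lintegral_congr_ae (g := fun _ => 0), lintegral_zero]
      filter_upwards [h1] with y hy
      rw [lintegral_congr_ae (g := fun _ => 0), lintegral_zero]
      filter_upwards [hy] with t ht
      exact indicator_of_notMem (not_not.2 ht) _
    rw [lintegral_indicator hS.compl] at h2
    simpa [EventuallyEq, ae_iff, compl_ofPred] using h2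
  refine ⟨G, hGm, hGF.trans hf.ae_eq_mk.symm, ?_, ?_⟩
  · have hm : Measurable fun y : Cube d =>
        liminf (fun m => liminf (fun k => gridVar k (avg m fun t => F (t, y))) atTop) atTop :=
      Measurable.liminf fun m => Measurable.liminf fun k => gridVar_avg_measurable hF m k
    refine ⟨_, hm, ?_⟩
    filter_upwards [hlv, hline, hfin] with y h6 h7 h8
    rw [h6, var_reg h8]
    simp only [avg_congr h7]
  · filter_upwards [hlv, hfin] with y h6 h8
    rw [h6]
    exact var_reg_le_var h8

/-- Regularising `g` along lines produces an admissible representative of no larger variation. A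
measurable majorant is therefore enough, and measurability of `lineVar i g` itself need not be
checked. -/
theorem dirVar_le_lintegral {d : ℕ} (i : Fin (d + 1)) {f g : Cube (d + 1) → ℝ}
    (hf : AEStronglyMeasurable f volume) (hgf : g =ᵐ[volume] f) {W : Cube d → ℝ≥0∞}
    (hW : AEMeasurable W volume) (hle : ∀ᵐ y, lineVar i g y ≤ W y) : dirVar i f ≤ ∫⁻ y, W y := by
  by_cases htop : ∫⁻ y, W y = ⊤
  · rw [htop]; exact le_top
  have hfin : ∀ᵐ y, lineVar i g y ≠ ⊤ := by
    filter_upwards [hle, ae_lt_top' hW htop] with y h1 h2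
    exact (h1.trans_lt h2).ne
  obtain ⟨g', c₁, c₂, c₃⟩ := exists_reg i hf hgf hfin
  refine (iInf₂_le_of_le g' c₁ (iInf_le_of_le c₂ le_rfl)).trans ?_
  refine lintegral_mono_ae ?_
  filter_upwards [c₃, hle] with y h1 h2 using h1.trans h2

theorem aestronglyMeasurable_finset_sum {n : ℕ} {ι : Type*} (s : Finset ι) {f : ι → Cube n → ℝ}
    (hf : ∀ k ∈ s, AEStronglyMeasurable (f k) volume) :
    AEStronglyMeasurable (fun x => ∑ k ∈ s, f k x) volume :=
  s.aestronglyMeasurable_fun_sum hf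

theorem dirVar_sum_le {d : ℕ} (i : Fin (d + 1)) {ι : Type*} (s : Finset ι)
    {f : ι → Cube (d + 1) → ℝ} (hf : ∀ k ∈ s, AEStronglyMeasurable (f k) volume) :
    dirVar i (fun x => ∑ k ∈ s, f k x) ≤ ∑ k ∈ s, dirVar i (f k) := by
  classical
  induction s using Finset.induction_on with
  | empty => simp [dirVar_zero]
  | insert k s hk ih =>
    have h1 : (fun x => ∑ l ∈ insert k s, f l x) = f k + fun x => ∑ l ∈ s, f l x := by
      funext x; simp [Finset.sum_insert hk]
    have hs := fun l hl => hf l (Finset.mem_insert_of_mem hl)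
    rw [h1, Finset.sum_insert hk]
    exact (dirVar_add_le i (hf k (Finset.mem_insert_self _ _))
      (aestronglyMeasurable_finset_sum s hs)).trans (add_le_add le_rfl (ih hs))

theorem eVariationOn_const_mul (c : ℝ) (u : unitInterval → ℝ) (s : Set unitInterval) :
    eVariationOn (fun t => c * u t) s = ‖c‖ₑ * eVariationOn u s := by
  unfold eVariationOn
  rw [ENNReal.mul_iSup]
  refine iSup_congr fun p => ?_
  rw [Finset.mul_sum]
  refine Finset.sum_congr rfl fun j _ => ?_
  rw [edist_eq_enorm_sub, edist_eq_enorm_sub, ← mul_sub, enorm_mul]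

/-! ### Variation in one direction of the density transferred along a branch. -/

section BranchVar

variable {d : ℕ} {φ : Fin (d + 1) → ℝ → ℝ} {κ : ℝ≥0} {a b : Cube (d + 1)}
  (β : ∀ j, Branch (φ j) κ (a j) (b j))

/-- The branches in the coordinates other than `i`. -/
def branchRemove (i : Fin (d + 1)) :
    ∀ j : Fin d, Branch (φ (i.succAbove j)) κ (i.removeNth a j) (i.removeNth b j) :=
  fun j => β (i.succAbove j)

/-- The transfer of `g` along a product of branches, not cut off in the `i`-th coordinate. -/
noncomputable def branchExt (i : Fin (d + 1)) (g : Cube (d + 1) → ℝ) (x : Cube (d + 1)) : ℝ :=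
  (Icc (branchLo (branchRemove β i)) (branchHi (branchRemove β i))).indicator
    (fun y => (branchWeight (branchRemove β i) y : ℝ)) (i.removeNth x)
    * (((β i).w (x i) : ℝ) * g (branchMap β x))

theorem branchMap_insertNth (i : Fin (d + 1)) (t : unitInterval) (y : Cube d) :
    branchMap β (i.insertNth t y) = i.insertNth ((β i).ψ t) (branchMap (branchRemove β i) y) := by
  funext j
  refine Fin.succAboveCases i ?_ (fun k => ?_) j
  · simp [branchMap]
  · simp [branchMap, branchRemove]

theorem measurable_branchExt (i : Fin (d + 1)) {g : Cube (d + 1) → ℝ} (hg : Measurable g) :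
    Measurable (branchExt β i g) := by
  refine Measurable.mul ?_ (((β i).measurable_w.coe_nnreal_real.comp (measurable_pi_apply i)).mul
    (hg.comp (measurable_branchMap β)))
  exact (((measurable_branchWeight _).coe_nnreal_real).indicator measurableSet_Icc).comp
    (measurable_removeNth i)

/-- The extension and the true transferred density agree on the image rectangle, so cutting off only
at the very end recovers the latter. -/
theorem indicator_branchExt (i : Fin (d + 1)) (g : Cube (d + 1) → ℝ) :
    (Icc (branchLo β) (branchHi β)).indicator (branchExt β i g) = branchPush β g := by
  funext x
  unfold branchPush
  by_cases hx : x ∈ Icc (branchLo β) (branchHi β)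
  · rw [indicator_of_mem hx, indicator_of_mem hx, branchExt, indicator_of_mem, ← mul_assoc]
    · congr 1
      rw [← NNReal.coe_mul, mul_comm]
      congr 1
      exact (Fin.prod_univ_succAbove (fun j => (β j).w (x j)) i).symm
    · exact ⟨fun j => hx.1 _, fun j => hx.2 _⟩
  · rw [indicator_of_notMem hx, indicator_of_notMem hx]

/-- The one-dimensional bound for the variation of a branch, as a function of the remaining
coordinates. -/
noncomputable def branchLine (i : Fin (d + 1)) (g : Cube (d + 1) → ℝ) (W : Cube d → ℝ≥0∞)
    (z : Cube d) : ℝ≥0∞ :=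
  κ * W z + (β i).K * ∫⁻ t in Icc (a i) (b i), ‖g (i.insertNth t z)‖ₑ

theorem measurable_branchLine (i : Fin (d + 1)) {g : Cube (d + 1) → ℝ} (hg : Measurable g)
    {W : Cube d → ℝ≥0∞} (hW : Measurable W) : Measurable (branchLine β i g W) :=
  (hW.const_mul _).add ((measurable_lintegral_insertNth i _ hg.enorm).const_mul _)

/-- The majorant for the variation of `branchExt` along lines. -/
noncomputable def branchVar (i : Fin (d + 1)) (g : Cube (d + 1) → ℝ) (W : Cube d → ℝ≥0∞) :
    Cube d → ℝ≥0∞ :=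
  (Icc (branchLo (branchRemove β i)) (branchHi (branchRemove β i))).indicator
    fun y => branchWeight (branchRemove β i) y *
      branchLine β i g W (branchMap (branchRemove β i) y)

theorem measurable_branchVar (i : Fin (d + 1)) {g : Cube (d + 1) → ℝ} (hg : Measurable g)
    {W : Cube d → ℝ≥0∞} (hW : Measurable W) : Measurable (branchVar β i g W) :=
  ((measurable_branchWeight _).coe_nnreal_ennreal.mul ((measurable_branchLine β i hg hW).comp
    (measurable_branchMap _))).indicator measurableSet_Icc

theorem lineVar_branchExt (i : Fin (d + 1)) (g : Cube (d + 1) → ℝ) (y : Cube d) :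
    lineVar i (branchExt β i g) y =
      ‖(Icc (branchLo (branchRemove β i)) (branchHi (branchRemove β i))).indicator
        (fun y => (branchWeight (branchRemove β i) y : ℝ)) y‖ₑ *
      eVariationOn (fun t => ((β i).w t : ℝ) *
        g (i.insertNth ((β i).ψ t) (branchMap (branchRemove β i) y))) univ := by
  rw [← eVariationOn_const_mul]
  unfold lineVar
  congr 1
  funext t
  simp only [branchExt, Fin.removeNth_insertNth, Fin.insertNth_apply_same, branchMap_insertNth]

/-- On a line in direction `i` the weight of the other coordinates is a constant, and the rest is
the one-dimensional estimate `Branch.var_le`. The exceptional null set of `hle` is pulled back by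
`ae_branch`; where the transverse weight vanishes, so does the left-hand side. -/
theorem lineVar_branchExt_le (i : Fin (d + 1)) {g : Cube (d + 1) → ℝ}
    {W : Cube d → ℝ≥0∞} (hle : ∀ᵐ y, lineVar i g y ≤ W y) :
    ∀ᵐ y, lineVar i (branchExt β i g) y ≤ branchVar β i g W y := by
  have h1 := ae_branch (branchRemove β i) (ae_restrict_of_ae hle)
  rw [ae_restrict_iff' measurableSet_Icc] at h1
  filter_upwards [h1] with y hy
  rw [lineVar_branchExt, branchVar]
  by_cases hm : y ∈ Icc (branchLo (branchRemove β i)) (branchHi (branchRemove β i))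
  · rw [indicator_of_mem hm, indicator_of_mem hm]
    have h2 : ‖(branchWeight (branchRemove β i) y : ℝ)‖ₑ
        = (branchWeight (branchRemove β i) y : ℝ≥0∞) := by simp
    rw [h2]
    by_cases h0 : branchWeight (branchRemove β i) y = 0
    · rw [h0, ENNReal.coe_zero, zero_mul, zero_mul]
    · refine mul_le_mul_right (((β i).var_le
        fun s => g (i.insertNth s (branchMap (branchRemove β i) y))).trans ?_) _
      exact add_le_add (mul_le_mul_right (hy hm h0) _) le_rfl
  · rw [indicator_of_notMem hm, indicator_of_notMem hm, enorm_zero, zero_mul]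

/-- The transverse weight is the Jacobian of the branches in the other coordinates, so integration
over those coordinates is a change of variables, without any loss in the constant `κ`. -/
theorem lintegral_branchVar (i : Fin (d + 1)) {g : Cube (d + 1) → ℝ} (hg : Measurable g)
    {W : Cube d → ℝ≥0∞} (hW : Measurable W) :
    ∫⁻ y, branchVar β i g W y ≤ κ * (∫⁻ y, W y) + (β i).K * ∫⁻ x in Icc a b, ‖g x‖ₑ := by
  have hm := (measurable_lintegral_insertNth i (Icc (a i) (b i)) hg.enorm).const_mul
    ((β i).K : ℝ≥0∞)
  unfold branchVar
  rw [lintegral_indicator measurableSet_Icc, setLIntegral_branch (branchRemove β i)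
    (measurable_branchLine β i hg hW)]
  unfold branchLine
  rw [lintegral_add_right _ hm, lintegral_const_mul _ hW,
    lintegral_const_mul _ (measurable_lintegral_insertNth i _ hg.enorm),
    setLIntegral_Icc_insertNth i a b hg.enorm]
  exact add_le_add (mul_le_mul_right (lintegral_mono' Measure.restrict_le_self le_rfl) _) le_rfl

end BranchVar

end Jab

namespace Jab

/-! ### Cells of a grid -/

namespace Grid

variable {n : ℕ} (B : Grid n)

theorem r_pos (i : Fin n) : 0 < B.r i := by
  rcases Nat.eq_zero_or_pos (B.r i) with h | h
  · exfalso
    have h1 : (0 : Fin (B.r i + 1)) = Fin.last (B.r i) := Fin.ext (by simp [h])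
    have h2 := B.first i
    rw [h1, B.last i] at h2
    exact one_ne_zero h2
  · exact h

theorem a_mem (i : Fin n) (k : Fin (B.r i + 1)) : B.a i k ∈ unitInterval := by
  constructor
  · rw [← B.first i]; exact (B.strictMono i).monotone (Fin.zero_le k)
  · rw [← B.last i]; exact (B.strictMono i).monotone (Fin.le_last k)

/-- The grid points, as points of the unit interval. -/
def pt (i : Fin n) (k : Fin (B.r i + 1)) : unitInterval := ⟨B.a i k, B.a_mem i k⟩

theorem pt_strictMono (i : Fin n) : StrictMono (B.pt i) := fun _ _ h => B.strictMono i h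

/-- The lower corner of a cell. -/
def lo (s : B.Index) : Cube n := fun j => B.pt j (s j).castSucc

/-- The upper corner of a cell. -/
def hi (s : B.Index) : Cube n := fun j => B.pt j (s j).succ

/-- The points that do not lie on any of the hyperplanes of the grid. -/
def Generic (x : Cube n) : Prop := ∀ j k, x j ≠ B.pt j k

theorem _root_.Jab.ae_apply_ne {n : ℕ} (j : Fin n) (p : unitInterval) :
    ∀ᵐ x : Cube n, x j ≠ p := by
  have : (volume : Measure (Cube n)) {x | x j = p} = 0 :=
    Measure.pi_hyperplane (fun _ : Fin n => (volume : Measure unitInterval)) j p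
  rw [ae_iff]
  simpa using this

theorem ae_generic : ∀ᵐ x, B.Generic x :=
  ae_all_iff.2 fun j => ae_all_iff.2 fun k => ae_apply_ne j (B.pt j k)

theorem exists_side (i : Fin n) (t : unitInterval) : ∃ k : Fin (B.r i),
    B.a i k.castSucc ≤ t ∧ ((t : ℝ) < B.a i k.succ ∨ ((t : ℝ) = 1 ∧ B.a i k.succ = 1)) := by
  by_cases ht : (t : ℝ) = 1
  · have hlast : (⟨B.r i - 1, Nat.sub_lt (B.r_pos i) one_pos⟩ : Fin (B.r i)).succ
        = Fin.last (B.r i) := by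
      have := B.r_pos i
      exact Fin.ext (by simp; omega)
    refine ⟨⟨B.r i - 1, Nat.sub_lt (B.r_pos i) one_pos⟩, ?_, Or.inr ⟨ht, ?_⟩⟩
    · rw [ht]; exact (B.a_mem i _).2
    · rw [hlast, B.last]
  · by_contra! hcon
    have key : ∀ k : Fin (B.r i + 1), B.a i k ≤ t := by
      intro k
      induction k using Fin.induction with
      | zero => rw [B.first]; exact t.2.1
      | succ k ih => exact (hcon k ih).1
    have := key (Fin.last _)
    rw [B.last] at this
    exact ht (le_antisymm t.2.2 this)

theorem exists_mem_cell (x : Cube n) : ∃ s, x ∈ B.cell s := by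
  choose s hs using fun i => B.exists_side i (x i)
  exact ⟨s, hs⟩

theorem cell_subset (s : B.Index) : B.cell s ⊆ Icc (B.lo s) (B.hi s) := by
  intro x hx
  refine ⟨fun j => (hx j).1, fun j => ?_⟩
  change (x j : ℝ) ≤ B.a j (s j).succ
  rcases (hx j).2 with h | ⟨h1, h2⟩
  · exact h.le
  · rw [h1, h2]

theorem Generic.mem_cell {B : Grid n} {x : Cube n} (hx : B.Generic x) {s : B.Index}
    (h : x ∈ Icc (B.lo s) (B.hi s)) : x ∈ B.cell s := fun j =>
  ⟨h.1 j, Or.inl (lt_of_le_of_ne (h.2 j) fun h' => hx j _ (Subtype.ext h'))⟩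

theorem side_unique {i : Fin n} {t : unitInterval} (ht : ∀ k, t ≠ B.pt i k) {k l : Fin (B.r i)}
    (hk : B.pt i k.castSucc ≤ t ∧ t ≤ B.pt i k.succ)
    (hl : B.pt i l.castSucc ≤ t ∧ t ≤ B.pt i l.succ) : k = l := by
  have aux : ∀ {k l : Fin (B.r i)}, (t ≤ B.pt i k.succ) → (B.pt i l.castSucc ≤ t) → ¬ k < l := by
    intro k l hk hl hkl
    have h1 : B.pt i k.succ ≤ B.pt i l.castSucc := (B.pt_strictMono i).monotone hkl
    exact ht _ (le_antisymm hk (h1.trans hl))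
  rcases lt_trichotomy k l with h | h | h
  · exact absurd h (aux hk.2 hl.1)
  · exact h
  · exact absurd h (aux hl.2 hk.1)

theorem Generic.unique {B : Grid n} {x : Cube n} (hx : B.Generic x) {s s' : B.Index}
    (h : x ∈ Icc (B.lo s) (B.hi s)) (h' : x ∈ Icc (B.lo s') (B.hi s')) : s = s' :=
  funext fun j => B.side_unique (hx j) ⟨h.1 j, h.2 j⟩ ⟨h'.1 j, h'.2 j⟩

theorem measurableSet_cell (s : B.Index) : MeasurableSet (B.cell s) := by
  have : B.cell s = ⋂ i, {x : Cube n | B.a i (s i).castSucc ≤ (x i : ℝ) ∧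
      ((x i : ℝ) < B.a i (s i).succ ∨ ((x i : ℝ) = 1 ∧ B.a i (s i).succ = 1))} := by
    ext x; simp [cell]
  rw [this]
  refine MeasurableSet.iInter fun i => ?_
  have hm : Measurable fun x : Cube n => (x i : ℝ) :=
    measurable_subtype_coe.comp (measurable_pi_apply i)
  refine (measurableSet_le measurable_const hm).inter
    ((measurableSet_lt hm measurable_const).union ?_)
  exact (measurableSet_eq_fun hm measurable_const).inter (MeasurableSet.const _)

theorem lo_lt_hi (s : B.Index) (j : Fin n) : B.lo s j < B.hi s j :=
  B.pt_strictMono j Fin.castSucc_lt_succ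

theorem sum_eVariationOn_side_le (i : Fin n) (u : unitInterval → ℝ) :
    ∑ k : Fin (B.r i), eVariationOn u (Icc (B.pt i k.castSucc) (B.pt i k.succ))
      ≤ eVariationOn u univ := by
  set I : ℕ → unitInterval := fun m => B.pt i ⟨min m (B.r i), by omega⟩ with hI
  have hmono : Monotone I := fun a b hab =>
    (B.pt_strictMono i).monotone (by simp only [Fin.mk_le_mk]; omega)
  have h1 := eVariationOn.sum' u hmono (n := B.r i)
  refine le_trans (le_of_eq ?_) (h1.le.trans (eVariationOn.mono u (subset_univ _)))
  rw [Finset.sum_range]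
  refine Finset.sum_congr rfl fun k _ => ?_
  have e1 : I k = B.pt i k.castSucc := congrArg (B.pt i) (Fin.ext (by simp))
  have e2 : I (k + 1) = B.pt i k.succ := congrArg (B.pt i) (Fin.ext (by simp))
  rw [e1, e2]

/-- The lower corner of the intersection of a rectangle with a cell. -/
def subLo (a : Cube n) (s : B.Index) : Cube n := fun j => max (a j) (B.lo s j)

/-- The upper corner of the intersection of a rectangle with a cell. -/
def subHi (b : Cube n) (s : B.Index) : Cube n := fun j => min (b j) (B.hi s j)

open Classical in
/-- The cells whose intersection with the given rectangle is nondegenerate. -/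
noncomputable def sub (a b : Cube n) : Finset B.Index :=
  Finset.univ.filter fun s => ∀ j, B.subLo a s j < B.subHi b s j

theorem mem_sub {a b : Cube n} {s : B.Index} :
    s ∈ B.sub a b ↔ ∀ j, B.subLo a s j < B.subHi b s j := by simp [sub]

theorem mem_Icc_sub {a b x : Cube n} {s : B.Index} :
    x ∈ Icc (B.subLo a s) (B.subHi b s) ↔ x ∈ Icc a b ∧ x ∈ Icc (B.lo s) (B.hi s) := by
  simp only [mem_Icc, Pi.le_def, subLo, subHi, max_le_iff, le_min_iff, forall_and]
  tauto

/-- A point off all the hyperplanes involved lies in exactly one closed cell, and this cell meets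
the rectangle in a nondegenerate rectangle whenever the point is in it. The discarded cells thus
contribute nothing. -/
theorem ae_indicator_eq_sum (a b : Cube n) (g : Cube n → ℝ) :
    ∀ᵐ x, (Icc a b).indicator g x
      = ∑ s ∈ B.sub a b, (Icc (B.subLo a s) (B.subHi b s)).indicator g x := by
  filter_upwards [B.ae_generic, ae_all_iff.2 fun j => ae_apply_ne j (a j),
    ae_all_iff.2 fun j => ae_apply_ne j (b j)] with x hx hxa hxb
  obtain ⟨s, hs⟩ := B.exists_mem_cell x
  have hs' := B.cell_subset s hs
  by_cases hxR : x ∈ Icc a b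
  · have hsub : s ∈ B.sub a b := by
      rw [mem_sub]
      intro j
      have h1 : a j < x j := lt_of_le_of_ne (hxR.1 j) (hxa j).symm
      have h2 : x j < b j := lt_of_le_of_ne (hxR.2 j) (hxb j)
      have h3 : B.lo s j < x j := lt_of_le_of_ne (hs'.1 j) (hx j _).symm
      have h4 : x j < B.hi s j := lt_of_le_of_ne (hs'.2 j) (hx j _)
      exact (max_lt h1 h3).trans (lt_min h2 h4)
    rw [Finset.sum_eq_single_of_mem s hsub, indicator_of_mem hxR,
      indicator_of_mem (B.mem_Icc_sub.2 ⟨hxR, hs'⟩)]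
    intro s' _ hne
    refine indicator_of_notMem (fun h => hne ?_) _
    exact hx.unique (B.mem_Icc_sub.1 h).2 hs'
  · rw [indicator_of_notMem hxR, Finset.sum_eq_zero]
    intro s' _
    exact indicator_of_notMem (fun h => hxR (B.mem_Icc_sub.1 h).1) _

theorem setLIntegral_sub_le (a b : Cube n) (H : Cube n → ℝ≥0∞) (s : B.Index) :
    ∫⁻ x in Icc (B.subLo a s) (B.subHi b s), H x ≤ ∫⁻ x in Icc a b, H x :=
  lintegral_mono_set fun _ hx => (B.mem_Icc_sub.1 hx).1

end Grid

/-! ### Jabłoński maps with a lower bound for the slopes -/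

namespace Grid.JablonskiMap

variable {n : ℕ} {B : Grid n}

/-- The components are `C²` and monotonic, with slopes at least `κ⁻¹`. -/
structure SlopeBound (T : B.JablonskiMap) (κ : ℝ≥0) : Prop where
  pos : 0 < κ
  contDiffOn : ∀ i s, ContDiffOn ℝ 2 (T.comp i s) (B.side i (s i))
  monotone : ∀ i s, MonotoneOn (T.comp i s) (B.side i (s i)) ∨
    AntitoneOn (T.comp i s) (B.side i (s i))
  le_deriv : ∀ i s, ∀ t ∈ B.side i (s i),
    (κ : ℝ)⁻¹ ≤ |derivWithin (T.comp i s) (B.side i (s i)) t|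

variable {T : B.JablonskiMap} {κ : ℝ≥0}

/-- On the half-open side the values are coordinates of points of the cube, obtained by keeping the
other coordinates at the lower corner of the cell. Continuity extends this to the closed side. -/
theorem SlopeBound.mapsTo (h : T.SlopeBound κ) (i : Fin n) (s : B.Index) :
    MapsTo (T.comp i s) (B.side i (s i)) (Icc 0 1) := by
  have h1 : MapsTo (T.comp i s) (Ico (B.lo s i : ℝ) (B.hi s i)) (Icc 0 1) := by
    intro t ht
    have htI : t ∈ unitInterval := ⟨(B.lo s i).2.1.trans ht.1, ht.2.le.trans (B.hi s i).2.2⟩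
    have hmem : Function.update (B.lo s) i ⟨t, htI⟩ ∈ B.cell s := by
      intro j
      rcases eq_or_ne j i with rfl | hj
      · simp only [Function.update_self]
        exact ⟨ht.1, Or.inl ht.2⟩
      · simp only [Function.update_of_ne hj]
        exact ⟨le_rfl, Or.inl (B.lo_lt_hi s j)⟩
    have := T.toFun_eq s _ hmem i
    simp only [Function.update_self] at this
    rw [← this]
    exact Subtype.prop _
  have hlt : (B.lo s i : ℝ) < B.hi s i := B.lo_lt_hi s i
  have h2 := h1.closure_of_continuousOn (f := T.comp i s) (by
    rw [closure_Ico hlt.ne]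
    exact (h.contDiffOn i s).continuousOn)
  rwa [closure_Ico hlt.ne, isClosed_Icc.closure_eq] at h2

theorem SlopeBound.measurable (h : T.SlopeBound κ) : Measurable T.toFun := by
  set G : B.Index → Cube n → Cube n := fun s x i => projIcc 0 1 zero_le_one
    (IccExtend (B.lo_lt_hi s i).le
      (fun t : Icc (B.lo s i) (B.hi s i) => T.comp i s (t : unitInterval))
      (x i)) with hG
  have hGm : ∀ s, Measurable (G s) := by
    intro s
    refine measurable_pi_lambda _ fun i => ?_
    have h1 : Continuous (IccExtend (B.lo_lt_hi s i).le
        fun t : Icc (B.lo s i) (B.hi s i) => T.comp i s (t : unitInterval)) :=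
      Continuous.Icc_extend'
        ((h.contDiffOn i s).continuousOn.comp_continuous (by fun_prop) fun t => t.2)
    exact continuous_projIcc.measurable.comp (h1.measurable.comp (measurable_pi_apply i))
  have hGeq : ∀ s, ∀ x ∈ B.cell s, T.toFun x = G s x := by
    intro s x hx
    funext i
    have hxi : x i ∈ Icc (B.lo s i) (B.hi s i) :=
      ⟨(B.cell_subset s hx).1 i, (B.cell_subset s hx).2 i⟩
    refine Subtype.ext ?_
    simp only [hG]
    rw [IccExtend_of_mem _ _ hxi]
    simp only [← T.toFun_eq s x hx i, projIcc_val]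
  intro E hE
  have : T.toFun ⁻¹' E = ⋃ s, B.cell s ∩ G s ⁻¹' E := by
    ext x
    simp only [mem_preimage, mem_iUnion, mem_inter_iff]
    constructor
    · intro hx
      obtain ⟨s, hs⟩ := B.exists_mem_cell x
      exact ⟨s, hs, by rwa [← hGeq s x hs]⟩
    · rintro ⟨s, hs, hx⟩
      rwa [hGeq s x hs]
  rw [this]
  exact MeasurableSet.iUnion fun s => (B.measurableSet_cell s).inter (hGm s hE)

theorem SlopeBound.nonempty_branch (h : T.SlopeBound κ) {a b : Cube n} {s : B.Index}
    (hs : s ∈ B.sub a b) :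
    Nonempty (∀ j, Branch (T.comp j s) κ (B.subLo a s j) (B.subHi b s j)) := by
  have : ∀ j, Nonempty (Branch (T.comp j s) κ (B.subLo a s j) (B.subHi b s j)) := fun j =>
    Jab.nonempty_branch (x := B.lo s j) (y := B.hi s j) (h.contDiffOn j s) (h.monotone j s)
      h.pos (h.le_deriv j s) (h.mapsTo j s) (B.mem_sub.1 hs j)
      (show B.lo s j ≤ B.subLo a s j from le_max_right _ _)
      (show B.subHi b s j ≤ B.hi s j from min_le_right _ _)
  exact ⟨fun j => (this j).some⟩

/-- The inverse branches on the intersections of a rectangle with the cells. -/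
noncomputable def SlopeBound.branch (h : T.SlopeBound κ) (a b : Cube n) (s : B.sub a b) :
    ∀ j, Branch (T.comp j s.1) κ (B.subLo a s.1 j) (B.subHi b s.1 j) :=
  (h.nonempty_branch s.2).some

theorem ae_toFun_eq (T : B.JablonskiMap) (a b : Cube n) (s : B.Index) :
    ∀ᵐ x ∂volume.restrict (Icc (B.subLo a s) (B.subHi b s)),
      ∀ j, (T.toFun x j : ℝ) = T.comp j s (x j) := by
  filter_upwards [ae_restrict_of_ae B.ae_generic, ae_restrict_mem measurableSet_Icc] with x hx hxm
  exact T.toFun_eq s x (hx.mem_cell (B.mem_Icc_sub.1 hxm).2)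

theorem SlopeBound.isPush_branch (h : T.SlopeBound κ) (a b : Cube n) (s : B.sub a b)
    {g : Cube n → ℝ} (hg : Measurable g) :
    IsPush T.toFun ((Icc (B.subLo a s.1) (B.subHi b s.1)).indicator g)
      (branchPush (h.branch a b s) g) :=
  isPush_branchPush _ h.measurable (ae_toFun_eq T a b s.1) hg

/-- The density is the sum over all cells of the densities transferred along the branches. -/
theorem SlopeBound.exists_isPush (h : T.SlopeBound κ) {g : Cube n → ℝ} (hg : Integrable g) :
    ∃ F, Integrable F ∧ IsPush T.toFun g F := by
  set g0 := hg.aestronglyMeasurable.mk g with hg0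
  have hae : g =ᵐ[volume] g0 := hg.aestronglyMeasurable.ae_eq_mk
  have hm : Measurable g0 := hg.aestronglyMeasurable.stronglyMeasurable_mk.measurable
  have hi : Integrable g0 := hg.congr hae
  refine ⟨fun x => ∑ s : B.sub 0 1, branchPush (h.branch 0 1 s) g0 x, ?_, ?_⟩
  · exact integrable_finsetSum _ fun s _ => integrable_branchPush _ hm hi.integrableOn
  · refine IsPush.congr_left (IsPush.sum (fun s _ => h.isPush_branch 0 1 s hm)
      (fun s _ => hi.indicator measurableSet_Icc)
      (fun s _ => integrable_branchPush _ hm hi.integrableOn)) ?_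
    filter_upwards [hae, B.ae_indicator_eq_sum 0 1 g0] with x hx hx1
    rw [hx, Finset.sum_coe_sort (B.sub 0 1)
      (fun s => (Icc (B.subLo 0 s) (B.subHi 1 s)).indicator g0 x), ← hx1, indicator_of_mem]
    exact ⟨fun j => unitInterval.nonneg', fun j => unitInterval.le_one'⟩

end Grid.JablonskiMap

/-- The composition `T (k-1) ∘ ⋯ ∘ T 0`. -/
def iterMap {α : Type*} (T : ℕ → α → α) : ℕ → α → α
  | 0 => id
  | k + 1 => iterMap (fun j => T (j + 1)) k ∘ T 0

theorem measurable_iterMap {α : Type*} [MeasurableSpace α] {T : ℕ → α → α}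
    (h : ∀ j, Measurable (T j)) (k : ℕ) : Measurable (iterMap T k) := by
  induction k generalizing T with
  | zero => exact measurable_id
  | succ k ih => exact (ih fun j => h (j + 1)).comp (h 0)

theorem exists_isPush_iterMap {n : ℕ} {B : Grid n} {T : ℕ → B.JablonskiMap} {κ : ℕ → ℝ≥0}
    (h : ∀ j, (T j).SlopeBound (κ j)) (k : ℕ) {g : Cube n → ℝ} (hg : Integrable g) :
    ∃ F, Integrable F ∧ IsPush (iterMap (fun j => (T j).toFun) k) g F := by
  induction k generalizing T κ g with
  | zero => exact ⟨g, hg, fun E _ => rfl⟩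
  | succ k ih =>
    obtain ⟨F, hF, hF'⟩ := (h 0).exists_isPush hg
    obtain ⟨G, hG, hG'⟩ := ih (fun j => h (j + 1)) hF
    exact ⟨G, hG, hF'.comp hG' (measurable_iterMap (fun j => (h (j + 1)).measurable) k)⟩

end Jab

namespace Jab

/-! ### The variation of iterated densities -/

/-- The variation of `g` along the line with remaining coordinates `y`, over the part of the line
in the rectangle with corners `a`, `b`. -/
noncomputable def rectVar {d : ℕ} (i : Fin (d + 1)) (a b : Cube (d + 1)) (g : Cube (d + 1) → ℝ) :
    Cube d → ℝ≥0∞ :=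
  (Icc (i.removeNth a) (i.removeNth b)).indicator
    fun y => eVariationOn (fun t => g (i.insertNth t y)) (Icc (a i) (b i))

theorem rectVar_le_lineVar {d : ℕ} (i : Fin (d + 1)) (a b : Cube (d + 1))
    (g : Cube (d + 1) → ℝ) (y : Cube d) : rectVar i a b g y ≤ lineVar i g y := by
  unfold rectVar
  refine (indicator_le_self' (fun _ _ => zero_le) y).trans ?_
  exact eVariationOn.mono _ (subset_univ _)

/-- A function on a rectangle has a Borel representative whose variation along lines is controlled
by a Borel function that is bounded by the variation within the rectangle. -/
theorem exists_rect_rep {d : ℕ} (i : Fin (d + 1)) {a b : Cube (d + 1)} (hab : a i ≤ b i)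
    {g : Cube (d + 1) → ℝ} (hg : Measurable g) (hfin : ∀ᵐ y, lineVar i g y ≠ ⊤) :
    ∃ (g' : Cube (d + 1) → ℝ) (W' : Cube d → ℝ≥0∞), Measurable g' ∧ Measurable W' ∧
      (∀ᵐ x, x ∈ Icc a b → g' x = g x) ∧ (∀ᵐ y, lineVar i g' y ≤ W' y) ∧
      ∀ᵐ y, W' y ≤ rectVar i a b g y := by
  -- In direction `i` the function is extended from the rectangle by clamping, which creates no
  -- jumps. In the other directions it is cut off by an indicator, which is constant along lines in
  -- direction `i`.
  set cl : unitInterval → unitInterval := fun t => max (a i) (min (b i) t) with hcl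
  have hclm : Monotone cl := fun s t h => max_le_max le_rfl (min_le_min le_rfl h)
  have hclmem : ∀ t, cl t ∈ Icc (a i) (b i) := fun t =>
    ⟨le_max_left _ _, max_le hab (min_le_left _ _)⟩
  have hclid : ∀ t ∈ Icc (a i) (b i), cl t = t := fun t ht => by
    simp only [hcl]; rw [min_eq_right ht.2, max_eq_right ht.1]
  set R : Set (Cube d) := Icc (i.removeNth a) (i.removeNth b) with hR
  set G : Cube (d + 1) → ℝ := fun x =>
    R.indicator (fun _ => (1 : ℝ)) (i.removeNth x) * g (i.insertNth (cl (x i)) (i.removeNth x))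
    with hG
  have hGm : Measurable G := by
    refine ((measurable_const.indicator measurableSet_Icc).comp (measurable_removeNth i)).mul
      (hg.comp ?_)
    exact (measurable_insertNth i).comp
      ((hclm.measurable.comp (measurable_pi_apply i)).prodMk (measurable_removeNth i))
  have hGl : ∀ y, lineVar i G y ≤ rectVar i a b g y := by
    intro y
    have e : (fun t => G (i.insertNth t y)) = fun t =>
        R.indicator (fun _ => (1 : ℝ)) y * ((fun s => g (i.insertNth s y)) ∘ cl) t := by
      funext t
      simp only [hG, Fin.removeNth_insertNth, Fin.insertNth_apply_same, Function.comp]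
    unfold lineVar rectVar
    rw [e, eVariationOn_const_mul]
    by_cases hy : y ∈ R
    · rw [indicator_of_mem hy, indicator_of_mem hy, enorm_one, one_mul]
      exact eVariationOn.comp_le_of_monotoneOn _ cl (hclm.monotoneOn _) fun t _ => hclmem t
    · rw [indicator_of_notMem hy, enorm_zero, zero_mul]
      exact zero_le
  have hGfin : ∀ᵐ y, lineVar i G y ≠ ⊤ := by
    filter_upwards [hfin] with y hy
    exact ne_top_of_le_ne_top hy ((hGl y).trans (rectVar_le_lineVar i a b g y))
  obtain ⟨g', h1, h2, h3, h4⟩ := exists_measurable_reg i hGm.aestronglyMeasurable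
    (ae_eq_refl G) hGfin
  refine ⟨g', h3.mk _, h1, h3.measurable_mk, ?_, ?_, ?_⟩
  · filter_upwards [h2] with x hx hxm
    rw [hx]
    have hy : i.removeNth x ∈ R := ⟨fun j => hxm.1 _, fun j => hxm.2 _⟩
    simp only [hG]
    rw [indicator_of_mem hy, one_mul, hclid _ ⟨hxm.1 i, hxm.2 i⟩, Fin.insertNth_self_removeNth]
  · filter_upwards [h3.ae_eq_mk] with y hy using hy.le
  · filter_upwards [h3.ae_eq_mk, h4] with y hy hy'
    rw [← hy]
    exact hy'.trans (hGl y)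

/-- For `y` off the hyperplanes of the grid, the cells met by the line over `y` are determined by
their index in direction `i`. The sum is therefore over consecutive intervals of one line, and
variation is additive there. -/
theorem Grid.sum_rectVar_le {d : ℕ} (B : Grid (d + 1)) (i : Fin (d + 1)) (a b : Cube (d + 1))
    (g : Cube (d + 1) → ℝ) :
    ∀ᵐ y, ∑ s ∈ B.sub a b, rectVar i (B.subLo a s) (B.subHi b s) g y ≤ lineVar i g y := by
  classical
  have hgen : ∀ᵐ y : Cube d, ∀ j k, y j ≠ B.pt (i.succAbove j) k :=
    ae_all_iff.2 fun j => ae_all_iff.2 fun k => ae_apply_ne j _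
  filter_upwards [hgen] with y hy
  set e : Fin (B.r i) → ℝ≥0∞ := fun k =>
    eVariationOn (fun t => g (i.insertNth t y)) (Icc (B.pt i k.castSucc) (B.pt i k.succ)) with he
  set S := (B.sub a b).filter fun s =>
    y ∈ Icc (i.removeNth (B.subLo a s)) (i.removeNth (B.subHi b s)) with hS
  have hterm : ∀ s ∈ B.sub a b, rectVar i (B.subLo a s) (B.subHi b s) g y
      ≤ if y ∈ Icc (i.removeNth (B.subLo a s)) (i.removeNth (B.subHi b s)) then e (s i) else 0 := by
    intro s _
    unfold rectVar
    rw [indicator_apply]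
    split_ifs
    · exact eVariationOn.mono _ (Icc_subset_Icc (le_max_right _ _) (min_le_right _ _))
    · exact le_rfl
  have hinj : ∀ s ∈ S, ∀ s' ∈ S, s i = s' i → s = s' := by
    intro s hs s' hs' heq
    rw [hS, Finset.mem_filter] at hs hs'
    funext j
    refine Fin.succAboveCases i heq (fun k => ?_) j
    refine B.side_unique (hy k) ?_ ?_
    · exact ⟨(le_max_right _ _).trans (hs.2.1 k), (hs.2.2 k).trans (min_le_right _ _)⟩
    · exact ⟨(le_max_right _ _).trans (hs'.2.1 k), (hs'.2.2 k).trans (min_le_right _ _)⟩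
  calc ∑ s ∈ B.sub a b, rectVar i (B.subLo a s) (B.subHi b s) g y
      ≤ ∑ s ∈ S, e (s i) := by
        rw [hS, Finset.sum_filter]
        exact Finset.sum_le_sum hterm
    _ = ∑ k ∈ S.image (fun s => s i), e k :=
        (Finset.sum_image fun s hs s' hs' h => hinj s hs s' hs' h).symm
    _ ≤ ∑ k, e k := Finset.sum_le_sum_of_subset (Finset.subset_univ _)
    _ ≤ lineVar i g y := B.sum_eVariationOn_side_le i _

/-- The only place where a function is cut off in the direction of the variation, and the only
source of the factor 2. Lines that miss the rectangle contribute nothing. -/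
theorem dirVar_indicator_Icc_le {d : ℕ} (i : Fin (d + 1)) {a b : Cube (d + 1)} (hab : a i < b i)
    {g : Cube (d + 1) → ℝ} (hg : Measurable g) {W : Cube d → ℝ≥0∞} (hW : Measurable W)
    (hle : ∀ᵐ y, lineVar i g y ≤ W y) :
    dirVar i ((Icc a b).indicator g) ≤ 2 * (∫⁻ y, W y)
      + 2 / ENNReal.ofReal (b i - a i) * ∫⁻ x in Icc a b, ‖g x‖ₑ := by
  set R : Set (Cube d) := Icc (i.removeNth a) (i.removeNth b) with hR
  set c : ℝ≥0∞ := 2 / ENNReal.ofReal (b i - a i) with hc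
  set V : Cube d → ℝ≥0∞ := fun y => ∫⁻ t in Icc (a i) (b i), ‖g (i.insertNth t y)‖ₑ with hV
  have hVm : Measurable V := measurable_lintegral_insertNth i _ hg.enorm
  have hVRm : Measurable (R.indicator fun y => c * V y) :=
    (hVm.const_mul c).indicator measurableSet_Icc
  refine (dirVar_le_lintegral i (hg.indicator measurableSet_Icc).aestronglyMeasurable (ae_eq_refl _)
    ((hW.const_mul 2).add hVRm).aemeasurable ?_).trans (le_of_eq ?_)
  · filter_upwards [hle] with y hy
    unfold lineVar
    by_cases hyR : y ∈ R
    · have e : (fun t => (Icc a b).indicator g (i.insertNth t y))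
          = (Icc (a i) (b i)).indicator fun t => g (i.insertNth t y) := by
        funext t
        rw [indicator_Icc_insertNth, indicator_of_mem hyR]
      rw [e]
      refine (eVariationOn_indicator_Icc_le hab _).trans ?_
      simp only [Pi.add_apply]
      rw [indicator_of_mem hyR]
      exact add_le_add (mul_le_mul_right hy _) le_rfl
    · have e : (fun t => (Icc a b).indicator g (i.insertNth t y)) = fun _ => 0 := by
        funext t
        rw [indicator_Icc_insertNth, indicator_of_notMem hyR]
      rw [e, eVariationOn.constant_on]
      · exact zero_le
      · rintro _ ⟨_, _, rfl⟩ _ ⟨_, _, rfl⟩; rfl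
  · simp only [Pi.add_apply]
    rw [lintegral_add_right _ hVRm, lintegral_const_mul _ hW, lintegral_indicator measurableSet_Icc,
      lintegral_const_mul _ hVm, setLIntegral_Icc_insertNth i a b hg.enorm]

/-- The Lasota–Yorke inequality for compositions of Jabłoński maps, with a constant that is
uniform for functions supported on a fixed rectangle. -/
theorem exists_dirVar_iterMap_le {d : ℕ} {B : Grid (d + 1)} (k : ℕ) {T : ℕ → B.JablonskiMap}
    {κ : ℕ → ℝ≥0} (h : ∀ j, (T j).SlopeBound (κ j)) {a b : Cube (d + 1)}
    (hab : ∀ j, a j < b j) : ∃ C : ℝ≥0, ∀ (i : Fin (d + 1)) (g G : Cube (d + 1) → ℝ)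
      (W : Cube d → ℝ≥0∞), Measurable g → IntegrableOn g (Icc a b) → Measurable W →
      (∀ᵐ y, lineVar i g y ≤ W y) → Integrable G →
      IsPush (iterMap (fun j => (T j).toFun) k) ((Icc a b).indicator g) G →
      dirVar i G ≤ (2 * ∏ j ∈ Finset.range k, κ j : ℝ≥0) * (∫⁻ y, W y)
        + C * ∫⁻ x in Icc a b, ‖g x‖ₑ := by
  induction k generalizing T κ a b with
  | zero =>
    -- No map is left to apply, so the function is finally cut off to the rectangle. The sum over
    -- `i` makes the constant serve all directions.
    refine ⟨∑ i, 2 / Real.toNNReal (b i - a i), fun i g G W hg hgi hW hle hG hpush => ?_⟩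
    have hGe : G =ᵐ[volume] (Icc a b).indicator g := by
      refine IsPush.ae_unique hpush (fun E _ => rfl) hG ?_
      exact hgi.integrable_indicator measurableSet_Icc
    rw [dirVar_congr i hGe]
    refine (dirVar_indicator_Icc_le i (hab i) hg hW hle).trans ?_
    simp only [Finset.range_zero, Finset.prod_empty, mul_one]
    refine add_le_add le_rfl (mul_le_mul_left ?_ _)
    have hpos : 0 < Real.toNNReal (b i - a i) := by simpa using hab i
    have e : 2 / ENNReal.ofReal (b i - a i) = ((2 / Real.toNNReal (b i - a i) : ℝ≥0) : ℝ≥0∞) := by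
      rw [ENNReal.coe_div hpos.ne']; rfl
    rw [e, ENNReal.coe_le_coe]
    exact Finset.single_le_sum (f := fun i => 2 / Real.toNNReal (b i - a i))
      (fun _ _ => zero_le) (Finset.mem_univ i)
  | succ k ih =>
    have hlt : ∀ (s : B.sub a b) j, branchLo ((h 0).branch a b s) j
        < branchHi ((h 0).branch a b s) j := fun s j => ((h 0).branch a b s j).lt
    -- The induction hypothesis is used on the image rectangles of the branches of `T 0`. They
    -- depend only on the maps and the given rectangle, which makes the constant uniform in `g`.
    choose C hC using fun s : B.sub a b => ih (fun j => h (j + 1)) (hlt s)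
    set D : ℝ≥0 := 2 * ∏ j ∈ Finset.range k, κ (j + 1) with hD
    refine ⟨∑ s, (D * ∑ i, ((h 0).branch a b s i).K + C s),
      fun i g G W hg hgi hW hle hG hpush => ?_⟩
    have hprod : (2 * ∏ j ∈ Finset.range (k + 1), κ j : ℝ≥0) = D * κ 0 := by
      rw [Finset.prod_range_succ', hD]; ring
    rw [hprod]
    by_cases htop : ∫⁻ y, W y = ⊤
    · have : ((D * κ 0 : ℝ≥0) : ℝ≥0∞) ≠ 0 := by
        have h1 : 0 < D * κ 0 :=
          mul_pos (mul_pos two_pos (Finset.prod_pos fun j _ => (h (j + 1)).pos)) (h 0).pos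
        exact_mod_cast h1.ne'
      rw [htop, ENNReal.mul_top this, top_add]
      exact le_top
    have hfin : ∀ᵐ y, lineVar i g y ≠ ⊤ := by
      filter_upwards [hle, ae_lt_top hW htop] with y h1 h2
      exact (h1.trans_lt h2).ne
    -- Each piece of `g` is extended without jumps from its subrectangle. Its majorant is controlled
    -- by the variation inside that subrectangle, so that the integrals of all majorants add up to
    -- at most that of `W`.
    choose g' W' hg' hW' hgeq hle' hWle using fun s : B.sub a b =>
      exists_rect_rep i (B.mem_sub.1 s.2 i).le hg hfin
    have hsum : ∑ s, ∫⁻ y, W' s y ≤ ∫⁻ y, W y := by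
      rw [← lintegral_finsetSum _ fun s _ => hW' s]
      refine lintegral_mono_ae ?_
      filter_upwards [ae_all_iff.2 hWle, B.sum_rectVar_le i a b g, hle] with y h1 h2 h3
      refine (Finset.sum_le_sum fun s _ => h1 s).trans (le_trans ?_ (h2.trans h3))
      exact (Finset.sum_coe_sort (B.sub a b)
        (fun s => rectVar i (B.subLo a s) (B.subHi b s) g y)).le
    have hind : ∀ s : B.sub a b, (Icc (B.subLo a s.1) (B.subHi b s.1)).indicator (g' s)
        =ᵐ[volume] (Icc (B.subLo a s.1) (B.subHi b s.1)).indicator g := by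
      intro s
      filter_upwards [hgeq s] with x hx
      by_cases hxm : x ∈ Icc (B.subLo a s.1) (B.subHi b s.1)
      · rw [indicator_of_mem hxm, indicator_of_mem hxm, hx hxm]
      · rw [indicator_of_notMem hxm, indicator_of_notMem hxm]
    have hnorm : ∀ s : B.sub a b, ∫⁻ x in Icc (B.subLo a s.1) (B.subHi b s.1), ‖g' s x‖ₑ
        ≤ ∫⁻ x in Icc a b, ‖g x‖ₑ := by
      intro s
      refine le_trans (le_of_eq ?_) (B.setLIntegral_sub_le a b _ s.1)
      refine setLIntegral_congr_fun_ae measurableSet_Icc ?_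
      filter_upwards [hgeq s] with x hx hxm
      rw [hx hxm]
    have hgi' : ∀ s : B.sub a b, IntegrableOn (g' s) (Icc (B.subLo a s.1) (B.subHi b s.1)) := by
      intro s
      refine ⟨(hg' s).aestronglyMeasurable, ?_⟩
      exact (hnorm s).trans_lt hgi.2
    have hFi : ∀ s, Integrable (branchPush ((h 0).branch a b s) (g' s)) := fun s =>
      integrable_branchPush _ (hg' s) (hgi' s)
    have hmeas := measurable_iterMap (fun j => (h (j + 1)).measurable) k
    choose F hF hFpush using fun s => exists_isPush_iterMap (fun j => h (j + 1)) k (hFi s)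
    have hpushs : ∀ s, IsPush (iterMap (fun j => (T j).toFun) (k + 1))
        ((Icc (B.subLo a s.1) (B.subHi b s.1)).indicator (g' s)) (F s) := fun s =>
      ((h 0).isPush_branch a b s (hg' s)).comp (hFpush s) hmeas
    have hGe : G =ᵐ[volume] fun x => ∑ s, F s x := by
      refine IsPush.ae_unique hpush ?_ hG (integrable_finsetSum _ fun s _ => hF s)
      refine IsPush.congr_left (IsPush.sum (fun s _ => hpushs s)
        (fun s _ => (hgi' s).integrable_indicator measurableSet_Icc) fun s _ => hF s) ?_
      filter_upwards [ae_all_iff.2 hind, B.ae_indicator_eq_sum a b g] with x hx hx1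
      rw [hx1, Finset.sum_congr rfl fun s _ => hx s]
      exact Finset.sum_coe_sort (B.sub a b)
        (fun s => (Icc (B.subLo a s) (B.subHi b s)).indicator g x)
    set N := ∫⁻ x in Icc a b, ‖g x‖ₑ with hN
    have hone : ∀ s, dirVar i (F s) ≤ (D * κ 0 : ℝ≥0) * (∫⁻ y, W' s y)
        + (D * ∑ i, ((h 0).branch a b s i).K + C s : ℝ≥0) * N := by
      intro s
      -- The induction hypothesis is applied to the density that is not yet cut off in direction
      -- `i`. It pays `κ 0` for this step and leaves the single factor 2 to the later cut-off.
      have h1 := hC s i (branchExt ((h 0).branch a b s) i (g' s)) (F s)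
        (branchVar ((h 0).branch a b s) i (g' s) (W' s)) (measurable_branchExt _ i (hg' s))
        (by
          rw [← integrable_indicator_iff measurableSet_Icc, indicator_branchExt]
          exact hFi s)
        (measurable_branchVar _ i (hg' s) (hW' s)) (lineVar_branchExt_le _ i (hle' s)) (hF s)
        (by rw [indicator_branchExt]; exact hFpush s)
      have h2 : ∫⁻ x in Icc (branchLo ((h 0).branch a b s)) (branchHi ((h 0).branch a b s)),
          ‖branchExt ((h 0).branch a b s) i (g' s) x‖ₑ ≤ N := by
        refine le_trans (le_of_eq ?_) (hnorm s)
        rw [← lintegral_branchPush ((h 0).branch a b s) (hg' s), ← indicator_branchExt _ i,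
          ← lintegral_indicator measurableSet_Icc]
        refine lintegral_congr fun x => ?_
        rw [enorm_indicator_eq_indicator_enorm]
      have h3 := (lintegral_branchVar ((h 0).branch a b s) i (hg' s) (hW' s)).trans
        (add_le_add le_rfl (mul_le_mul_right (hnorm s) _))
      have h4 : (((h 0).branch a b s i).K : ℝ≥0∞)
          ≤ ((∑ i, ((h 0).branch a b s i).K : ℝ≥0) : ℝ≥0∞) :=
        ENNReal.coe_le_coe.2 (Finset.single_le_sum (f := fun i => ((h 0).branch a b s i).K)
          (fun _ _ => zero_le) (Finset.mem_univ i))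
      calc dirVar i (F s)
          ≤ D * (κ 0 * (∫⁻ y, W' s y) + ((∑ i, ((h 0).branch a b s i).K : ℝ≥0) : ℝ≥0∞) * N)
            + C s * N := by
            refine h1.trans (add_le_add (mul_le_mul_right (h3.trans ?_) _) (mul_le_mul_right h2 _))
            exact add_le_add le_rfl (mul_le_mul_left h4 _)
        _ = _ := by push_cast; ring
    calc dirVar i G ≤ ∑ s, dirVar i (F s) := by
          rw [dirVar_congr i hGe]
          exact dirVar_sum_le i _ fun s _ => (hF s).aestronglyMeasurable
      _ ≤ ∑ s, ((D * κ 0 : ℝ≥0) * (∫⁻ y, W' s y)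
          + (D * ∑ i, ((h 0).branch a b s i).K + C s : ℝ≥0) * N) :=
          Finset.sum_le_sum fun s _ => hone s
      _ = (D * κ 0 : ℝ≥0) * (∑ s, ∫⁻ y, W' s y)
          + ((∑ s, (D * ∑ i, ((h 0).branch a b s i).K + C s) : ℝ≥0) : ℝ≥0∞) * N := by
          rw [Finset.sum_add_distrib, ← Finset.mul_sum, ← Finset.sum_mul,
            ENNReal.ofNNReal_finsetSum]
      _ ≤ _ := add_le_add (mul_le_mul_right hsum _) le_rfl

end Jab

namespace Jab

/-! ### Lasota–Yorke inequality and transfer operators on `BV` -/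

section LasotaYorke

variable {d : ℕ} {B : Grid (d + 1)}

/-- The rectangle is the whole cube. The estimate for a representative and its line variation passes
to the infimum over representatives, after replacing each by a Borel regularisation. -/
theorem exists_totalVar_iterMap_le (k : ℕ) {T : ℕ → B.JablonskiMap} {κ : ℕ → ℝ≥0}
    (h : ∀ j, (T j).SlopeBound (κ j)) :
    ∃ C : ℝ≥0, ∀ g G : Cube (d + 1) → ℝ, Integrable g → Integrable G →
      IsPush (iterMap (fun j => (T j).toFun) k) g G →
      totalVar G ≤ (2 * ∏ j ∈ Finset.range k, κ j : ℝ≥0) * totalVar g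
        + C * ∫⁻ x, ‖g x‖ₑ := by
  obtain ⟨C, hC⟩ := exists_dirVar_iterMap_le k h (a := (0 : Cube (d + 1))) (b := 1)
    (fun _ => zero_lt_one)
  have hu : Icc (0 : Cube (d + 1)) 1 = univ := eq_univ_of_forall fun x =>
    ⟨fun j => unitInterval.nonneg', fun j => unitInterval.le_one'⟩
  refine ⟨C, fun g G hg hG hpush => iSup_le fun i => ?_⟩
  set D : ℝ≥0 := 2 * ∏ j ∈ Finset.range k, κ j with hD
  have hD0 : (D : ℝ≥0∞) ≠ 0 := by
    rw [ENNReal.coe_ne_zero]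
    exact mul_ne_zero two_ne_zero (Finset.prod_ne_zero_iff.2 fun j _ => (h j).pos.ne')
  have key : dirVar i G ≤ D * dirVar i g + C * ∫⁻ x, ‖g x‖ₑ := by
    conv_rhs => unfold dirVar
    simp only [ENNReal.mul_iInf_of_ne hD0 ENNReal.coe_ne_top, ENNReal.iInf_add]
    refine le_iInf₂ fun g₀ a => le_iInf fun b => ?_
    by_cases htop : ∫⁻ y, lineVar i g₀ y = ⊤
    · rw [htop, ENNReal.mul_top hD0, top_add]
      exact le_top
    obtain ⟨g', hg', hae, hm, hle⟩ := exists_measurable_reg i hg.aestronglyMeasurable a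
      ((ae_lt_top' b htop).mono fun y hy => hy.ne)
    have h1 := hC i g' G (hm.mk _) hg' ((hg.congr hae.symm).integrableOn) hm.measurable_mk
      (hm.ae_eq_mk.mono fun y hy => hy.le) hG
      (by rw [hu, indicator_univ]; exact hpush.congr_left hae.symm)
    rw [hu, setLIntegral_univ, ← lintegral_congr_ae hm.ae_eq_mk] at h1
    refine h1.trans (add_le_add (mul_le_mul_right (lintegral_mono_ae hle) _) ?_)
    exact mul_le_mul_right (lintegral_congr_ae (hae.mono fun x hx => congrArg _ hx)).le _
  exact key.trans (add_le_add (mul_le_mul_right (le_iSup (fun i => dirVar i g) i) _) le_rfl)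

namespace BV

/-- The element of `BV` given by an integrable function of finite variation. -/
noncomputable def ofFun (f : Cube (d + 1) → ℝ) (hf : Integrable f) (h : totalVar f ≠ ⊤) : BV d :=
  (⟨hf.toL1 f, by
    change totalVar _ < ⊤
    rw [totalVar_congr hf.coeFn_toL1]
    exact h.lt_top⟩ : bvSubmodule d)

theorem ofFun_ae (f : Cube (d + 1) → ℝ) (hf : Integrable f) (h : totalVar f ≠ ⊤) :
    (ofFun f hf h).toL1 =ᵐ[volume] f := hf.coeFn_toL1

theorem integrable_toL1 (h : BV d) : Integrable h.toL1 := L1.integrable_coeFn _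

theorem norm_toL1 (h : BV d) : ‖h.toL1‖ = ∫ x, |h.toL1 x| := L1.norm_eq_integral_norm _

theorem lintegral_toL1 (h : BV d) : ∫⁻ x, ‖h.toL1 x‖ₑ = ENNReal.ofReal ‖h.toL1‖ := by
  rw [L1.norm_def, ENNReal.ofReal_toReal h.integrable_toL1.2.ne]

theorem var_nonneg (h : BV d) : 0 ≤ h.var := ENNReal.toReal_nonneg

theorem norm_toL1_le (h : BV d) : ‖h.toL1‖ ≤ ‖h‖ := by
  rw [norm_def]; linarith [h.var_nonneg]

theorem var_le_norm (h : BV d) : h.var ≤ ‖h‖ := by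
  rw [norm_def]; linarith [norm_nonneg h.toL1]

theorem ofReal_var (h : BV d) : ENNReal.ofReal h.var = totalVar h.toL1 :=
  ENNReal.ofReal_toReal h.totalVar_ne_top

theorem ext_ae {h k : BV d} (e : h.toL1 =ᵐ[volume] k.toL1) : h = k := toL1_injective (Lp.ext e)

/-- The bound for the variation of `totalVar` type, in terms of real numbers. -/
theorem var_le_of_totalVar_le {h k : BV d} {a c : ℝ≥0}
    (hle : totalVar k.toL1 ≤ a * totalVar h.toL1 + c * ∫⁻ x, ‖h.toL1 x‖ₑ) :
    k.var ≤ a * h.var + c * ‖h.toL1‖ := by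
  rw [lintegral_toL1, ← ofReal_var, ← ofReal_var, ← ENNReal.ofReal_coe_nnreal,
    ← ENNReal.ofReal_coe_nnreal, ← ENNReal.ofReal_mul a.coe_nonneg,
    ← ENNReal.ofReal_mul c.coe_nonneg,
    ← ENNReal.ofReal_add (mul_nonneg a.coe_nonneg h.var_nonneg)
      (mul_nonneg c.coe_nonneg (norm_nonneg h.toL1))] at hle
  exact (ENNReal.ofReal_le_ofReal_iff (add_nonneg (mul_nonneg a.coe_nonneg h.var_nonneg)
    (mul_nonneg c.coe_nonneg (norm_nonneg _)))).1 hle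

theorem totalVar_one : totalVar (fun _ : Cube (d + 1) => (1 : ℝ)) = 0 := by
  refine le_antisymm (iSup_le fun i => ?_) zero_le
  have hl : lineVar i (fun _ : Cube (d + 1) => (1 : ℝ)) = fun _ => 0 := by
    funext y
    exact eVariationOn.constant_on (subsingleton_singleton.anti (by rintro _ ⟨t, -, rfl⟩; rfl))
  refine iInf₂_le_of_le (fun _ => 1) EventuallyEq.rfl (iInf_le_of_le ?_ ?_) <;> rw [hl]
  · exact aemeasurable_const
  · simp

variable (d) in
/-- The constant function `1`. -/
noncomputable def one : BV d := ofFun (fun _ => 1) (integrable_const _) (by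
  rw [totalVar_one]
  exact ENNReal.zero_ne_top)

theorem one_ae : (one d).toL1 =ᵐ[volume] fun _ => 1 := ofFun_ae _ _ _

theorem var_one : (one d).var = 0 := by
  rw [var, totalVar_congr one_ae, totalVar_one, ENNReal.toReal_zero]

theorem norm_one : ‖one d‖ = 1 := by
  rw [norm_def, var_one, norm_toL1, integral_congr_ae (one_ae.mono fun x hx => by rw [hx])]
  simp

end BV

theorem IsTransferOperator.isPush {f : Cube (d + 1) → Cube (d + 1)} {A : BV d →L[ℝ] BV d}
    (hA : IsTransferOperator f A) (h : BV d) : IsPush f h.toL1 (A h).toL1 := hA h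

/-- The densities are chosen arbitrarily for each function. Linearity follows from their almost
everywhere uniqueness, boundedness from the one-step inequality for the variation and the
contraction in `L¹`. -/
theorem Grid.JablonskiMap.SlopeBound.exists_isTransferOperator {T : B.JablonskiMap} {κ : ℝ≥0}
    (h : T.SlopeBound κ) : ∃ A, IsTransferOperator T.toFun A := by
  obtain ⟨C, hC⟩ := exists_totalVar_iterMap_le 1 (T := fun _ => T) (κ := fun _ => κ) fun _ => h
  choose F hF hpush using fun g : BV d => h.exists_isPush g.integrable_toL1
  have hle := fun g : BV d => hC g.toL1 (F g) g.integrable_toL1 (hF g) (hpush g)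
  have htop : ∀ g : BV d, totalVar (F g) ≠ ⊤ := fun g => by
    refine ne_top_of_le_ne_top ?_ (hle g)
    rw [BV.lintegral_toL1]
    exact ENNReal.add_ne_top.2 ⟨ENNReal.mul_ne_top ENNReal.coe_ne_top g.totalVar_ne_top,
      ENNReal.mul_ne_top ENNReal.coe_ne_top ENNReal.ofReal_ne_top⟩
  have hae := fun g => BV.ofFun_ae (F g) (hF g) (htop g)
  have hpush' : ∀ g : BV d, IsPush T.toFun g.toL1 (BV.ofFun (F g) (hF g) (htop g)).toL1 :=
    fun g => (hpush g).congr_right (hae g).symm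
  let A₀ : BV d →ₗ[ℝ] BV d :=
    { toFun := fun g => BV.ofFun (F g) (hF g) (htop g)
      map_add' := fun g g' => BV.ext_ae (by
        rw [map_add]
        refine ((hpush' _).ae_unique ?_ (BV.integrable_toL1 _) (L1.integrable_coeFn _))
        exact (((hpush' g).add (hpush' g') (BV.integrable_toL1 _) (BV.integrable_toL1 _)
          (BV.integrable_toL1 _) (BV.integrable_toL1 _)).congr_left
          (by rw [map_add]; exact (Lp.coeFn_add _ _).symm)).congr_right (Lp.coeFn_add _ _).symm)
      map_smul' := fun c g => BV.ext_ae (by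
        rw [RingHom.id_apply, map_smul]
        refine ((hpush' _).ae_unique ?_ (BV.integrable_toL1 _) (L1.integrable_coeFn _))
        exact (((hpush' g).const_mul c).congr_left
          (by rw [map_smul]; exact (Lp.coeFn_smul c g.toL1).symm)).congr_right
          (Lp.coeFn_smul c (BV.toL1 _)).symm) }
  have hbound : ∀ g : BV d, ‖A₀ g‖ ≤ (2 * κ + C + 1 : ℝ≥0) * ‖g‖ := fun g => by
    have h1 : ‖(A₀ g).toL1‖ ≤ ‖g.toL1‖ := by
      rw [BV.norm_toL1, BV.norm_toL1]
      exact (hpush' g).integral_abs_le h.measurable g.integrable_toL1 (BV.integrable_toL1 _)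
    have h2 : (A₀ g).var ≤ (2 * ∏ j ∈ Finset.range 1, κ : ℝ≥0) * g.var + C * ‖g.toL1‖ :=
      BV.var_le_of_totalVar_le ((totalVar_congr (hae g)).trans_le (hle g))
    simp only [Finset.range_one, Finset.prod_singleton] at h2
    rw [BV.norm_def, BV.norm_def]
    push_cast at h2 ⊢
    have := g.var_nonneg
    have := norm_nonneg g.toL1
    have := κ.2
    have := C.2
    have e1 : 0 ≤ (κ : ℝ) * ‖g.toL1‖ := by positivity
    have e2 : 0 ≤ (C : ℝ) * g.var := by positivity
    nlinarith
  exact ⟨A₀.mkContinuous _ hbound, fun g E hE => hpush' g E hE⟩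

theorem isTransferOperator_transferBV {f : Cube (d + 1) → Cube (d + 1)}
    (h : ∃ A, IsTransferOperator f A) : IsTransferOperator f (transferBV f) := by
  rw [transferBV, dif_pos h]
  exact h.choose_spec

end LasotaYorke

/-! ### The cocycle of transfer operators along an orbit. -/

section Cocycle

variable {Ω X : Type*} [NormedAddCommGroup X] [NormedSpace ℝ X]

theorem cocycle_add (σ : Ω → Ω) (L : Ω → X →L[ℝ] X) (m n : ℕ) (ω : Ω) :
    cocycle σ L (m + n) ω = (cocycle σ L n (σ^[m] ω)).comp (cocycle σ L m ω) := by
  induction n with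
  | zero => rfl
  | succ n ih =>
    change (L (σ^[m + n] ω)).comp (cocycle σ L (m + n) ω) = _
    rw [ih, add_comm m n, Function.iterate_add_apply]
    rfl

theorem cocycle_one (σ : Ω → Ω) (L : Ω → X →L[ℝ] X) (ω : Ω) : cocycle σ L 1 ω = L ω := rfl

end Cocycle

section RandomMap

variable {Ω : Type*} {d : ℕ} {B : Grid (d + 1)} {σ : Ω → Ω} {F : Ω → B.JablonskiMap}

theorem isPush_cocycle (k : ℕ) {ω : Ω}
    (hT : ∀ j, IsTransferOperator (F (σ^[j] ω)).toFun (generator F (σ^[j] ω)))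
    (hm : ∀ j, Measurable (F (σ^[j] ω)).toFun) (h : BV d) :
    IsPush (iterMap (fun j => (F (σ^[j] ω)).toFun) k) h.toL1
      (cocycle σ (generator F) k ω h).toL1 := by
  induction k generalizing ω h with
  | zero => exact fun E _ => rfl
  | succ k ih =>
    have h1 := ih (ω := σ ω) (fun j => hT (j + 1)) (fun j => hm (j + 1)) (generator F ω h)
    -- `cocycle` appends the last operator while `iterMap` splits off the first map, so the cocycle
    -- is rewritten to split off the first operator as well.
    have e : cocycle σ (generator F) (k + 1) ω
        = (cocycle σ (generator F) k (σ ω)).comp (generator F ω) := by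
      rw [add_comm k 1, cocycle_add]
      rfl
    rw [e]
    exact ((hT 0).isPush h).comp h1 (measurable_iterMap (fun j => hm (j + 1)) k)

/-- The logarithm of the smallest slope. -/
noncomputable def logSlope (F : Ω → B.JablonskiMap) (ω : Ω) : ℝ := ⨅ i, Real.log ((F ω).slope i)

/-- Slope bounds are known along the orbit of `ω`. -/
def IsRegular (σ : Ω → Ω) (F : Ω → B.JablonskiMap) (ω : Ω) : Prop :=
  ∀ j, (F (σ^[j] ω)).SlopeBound (Real.toNNReal (Real.exp (-logSlope F (σ^[j] ω))))

theorem Grid.JablonskiMap.slope_le {n : ℕ} {B : Grid n} (T : B.JablonskiMap) (i : Fin n)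
    (s : B.Index) {t : ℝ} (ht : t ∈ B.side i (s i)) :
    T.slope i ≤ |derivWithin (T.comp i s) (B.side i (s i)) t| :=
  ciInf_le (f := fun p : (s : B.Index) × B.side i (s i) =>
    |derivWithin (T.comp i p.1) (B.side i (p.1 i)) (p.2 : ℝ)|)
    ⟨0, by rintro _ ⟨p, rfl⟩; exact abs_nonneg _⟩ ⟨s, t, ht⟩

theorem IsAdmissible.slopeBound [TopologicalSpace Ω] [MeasurableSpace Ω] {P : Measure Ω}
    (hF : IsAdmissible P F) {ω : Ω} (hω : ∀ i, 0 < (F ω).slope i) :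
    (F ω).SlopeBound (Real.toNNReal (Real.exp (-logSlope F ω))) where
  pos := Real.toNNReal_pos.2 (Real.exp_pos _)
  contDiffOn := hF.contDiffOn ω
  monotone := hF.monotone ω
  le_deriv i s t ht := by
    rw [Real.coe_toNNReal _ (Real.exp_pos _).le, Real.exp_neg, inv_inv]
    -- The contraction constant is the reciprocal of the smallest slope; its Birkhoff products are
    -- `exp(-S_k)`.
    refine le_trans ?_ ((F ω).slope_le i s ht)
    rw [← Real.le_log_iff_exp_le (hω i)]
    exact ciInf_le (finite_range _).bddBelow i

theorem IsAdmissible.ae_isRegular [TopologicalSpace Ω] [MeasurableSpace Ω] {P : Measure Ω}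
    (hF : IsAdmissible P F) (hσ : MeasurePreserving σ P P) : ∀ᵐ ω ∂P, IsRegular σ F ω := by
  have h : ∀ j : ℕ, ∀ᵐ ω ∂P, ∀ i, 0 < (F (σ^[j] ω)).slope i := fun j =>
    (hσ.iterate j).quasiMeasurePreserving.ae hF.slope_pos
  filter_upwards [ae_all_iff.2 h] with ω hω j
  exact hF.slopeBound (hω j)

namespace IsRegular

variable {ω : Ω}

theorem isTransferOperator (hω : IsRegular σ F ω) (j : ℕ) :
    IsTransferOperator (F (σ^[j] ω)).toFun (generator F (σ^[j] ω)) :=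
  isTransferOperator_transferBV (hω j).exists_isTransferOperator

theorem isPush_cocycle (hω : IsRegular σ F ω) (k : ℕ) (h : BV d) :
    IsPush (iterMap (fun j => (F (σ^[j] ω)).toFun) k) h.toL1
      (cocycle σ (generator F) k ω h).toL1 :=
  Jab.isPush_cocycle k hω.isTransferOperator (fun j => (hω j).measurable) h

theorem norm_toL1_cocycle_le (hω : IsRegular σ F ω) (k : ℕ) (h : BV d) :
    ‖(cocycle σ (generator F) k ω h).toL1‖ ≤ ‖h.toL1‖ := by
  rw [BV.norm_toL1, BV.norm_toL1]
  exact (hω.isPush_cocycle k h).integral_abs_le (measurable_iterMap (fun j => (hω j).measurable) k)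
    h.integrable_toL1 (BV.integrable_toL1 _)

/-- Transfer operators preserve integrals, so the image of the constant 1 has `L¹` norm at least 1.
This is the lower bound for the maximal exponent. -/
theorem one_le_norm_cocycle (hω : IsRegular σ F ω) (k : ℕ) :
    1 ≤ ‖cocycle σ (generator F) k ω‖ := by
  set A := cocycle σ (generator F) k ω
  have h1 : ∫ x, (A (BV.one d)).toL1 x = 1 := by
    have := hω.isPush_cocycle k (BV.one d) univ MeasurableSet.univ
    rw [preimage_univ, setIntegral_univ, setIntegral_univ, integral_congr_ae BV.one_ae] at this
    simpa using this
  calc (1 : ℝ) ≤ ‖(A (BV.one d)).toL1‖ := by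
        rw [BV.norm_toL1, ← h1]
        exact integral_mono (BV.integrable_toL1 _) (BV.integrable_toL1 _).abs fun x => le_abs_self _
    _ ≤ ‖A (BV.one d)‖ := BV.norm_toL1_le _
    _ ≤ ‖A‖ * ‖BV.one d‖ := A.le_opNorm _
    _ = ‖A‖ := by rw [BV.norm_one, mul_one]

/-- The Lasota–Yorke inequality in the form used by all three assertions, with one factor 2 for any
number of steps. Here `C` depends on `ω` in no controlled way; `BV.exists_measurable_var_le` makes
it measurable. -/
theorem exists_var_cocycle_le (hω : IsRegular σ F ω) (k : ℕ) :
    ∃ C : ℝ, ∀ h : BV d, (cocycle σ (generator F) k ω h).var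
      ≤ 2 * Real.exp (-birkhoffSum σ (logSlope F) k ω) * h.var + C * ‖h.toL1‖ := by
  obtain ⟨C, hC⟩ := exists_totalVar_iterMap_le k hω
  refine ⟨C, fun h => ?_⟩
  have h1 := BV.var_le_of_totalVar_le
    (hC _ _ h.integrable_toL1 (BV.integrable_toL1 _) (hω.isPush_cocycle k h))
  refine h1.trans_eq ?_
  congr 2
  rw [birkhoffSum, ← Finset.sum_neg_distrib, Real.exp_sum]
  push_cast
  congr 1
  exact Finset.prod_congr rfl fun j _ => Real.coe_toNNReal _ (Real.exp_pos _).le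

end IsRegular

end RandomMap

end Jab

namespace Jab

/-! ### Averages over the cells of a uniform grid -/

section CellAverage

/-- The cell `[k / m, (k + 1) / m)` of the unit interval. -/
def gridCell (m k : ℕ) : Set unitInterval := {t | ⌊(m : ℝ) * t⌋₊ = k}

/-- The average of `u` over the cell of `t`. -/
noncomputable def cellAvg (m : ℕ) (u : unitInterval → ℝ) (t : unitInterval) : ℝ :=
  ⨍ s in gridCell m ⌊(m : ℝ) * t⌋₊, u s

theorem measurable_gridIndex (m : ℕ) : Measurable fun t : unitInterval => ⌊(m : ℝ) * t⌋₊ :=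
  Nat.measurable_floor.comp (measurable_subtype_coe.const_mul _)

theorem measurableSet_gridCell (m k : ℕ) : MeasurableSet (gridCell m k) :=
  measurable_gridIndex m (measurableSet_singleton k)

theorem gridIndex_le (m : ℕ) (t : unitInterval) : ⌊(m : ℝ) * t⌋₊ ≤ m :=
  Nat.floor_le_of_le (mul_le_of_le_one_right (Nat.cast_nonneg m) t.2.2)

theorem lintegral_eq_sum_gridCell (m : ℕ) (H : unitInterval → ℝ≥0∞) :
    ∫⁻ t, H t = ∑ k ∈ Finset.range (m + 1), ∫⁻ t in gridCell m k, H t := by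
  rw [← lintegral_biUnion_finset ?_ fun k _ => measurableSet_gridCell m k, ← setLIntegral_univ]
  · congr 2
    refine (eq_univ_of_forall fun t => ?_).symm
    exact mem_iUnion₂.2 ⟨_, Finset.mem_range.2 (Nat.lt_succ_of_le (gridIndex_le m t)), rfl⟩
  · intro k _ l _ hkl
    exact disjoint_left.2 fun t (ht : _ = k) (ht' : _ = l) => hkl (ht.symm.trans ht')

theorem volume_gridCell_le {m : ℕ} (hm : 0 < m) (k : ℕ) :
    volume (gridCell m k) ≤ ENNReal.ofReal (1 / m) := by
  rw [unitInterval.volume_apply]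
  have hm' : (0 : ℝ) < m := Nat.cast_pos.2 hm
  refine (measure_mono (t := Icc ((k : ℝ) / m) ((k + 1) / m)) ?_).trans_eq ?_
  · rintro _ ⟨t, ht, rfl⟩
    have h0 : (0 : ℝ) ≤ m * t := mul_nonneg hm'.le t.2.1
    have ht' : ⌊(m : ℝ) * t⌋₊ = k := ht
    obtain ⟨h1, h2⟩ := (Nat.floor_eq_iff h0).1 ht'
    constructor
    · rw [div_le_iff₀ hm']; linarith
    · rw [le_div_iff₀ hm']; linarith
  · rw [Real.volume_Icc]
    congr 1
    ring

theorem sum_eVariationOn_gridCell_le (m : ℕ) (u : unitInterval → ℝ) (n : ℕ) :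
    ∑ k ∈ Finset.range n, eVariationOn u (gridCell m k) ≤ eVariationOn u univ := by
  suffices h : ∑ k ∈ Finset.range n, eVariationOn u (gridCell m k)
      ≤ eVariationOn u {t : unitInterval | ⌊(m : ℝ) * t⌋₊ < n} from
    h.trans (eVariationOn.mono u (subset_univ _))
  induction n with
  | zero => simp
  | succ n ih =>
    rw [Finset.sum_range_succ]
    refine (add_le_add ih le_rfl).trans ((eVariationOn.add_le_union u ?_).trans
      (eVariationOn.mono u ?_))
    · intro x hx y hy
      by_contra hxy
      have h1 : ⌊(m : ℝ) * y⌋₊ ≤ ⌊(m : ℝ) * x⌋₊ := Nat.floor_mono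
        (mul_le_mul_of_nonneg_left (Subtype.coe_le_coe.2 (not_le.1 hxy).le) (Nat.cast_nonneg m))
      have h2 : ⌊(m : ℝ) * x⌋₊ < n := hx
      have h3 : ⌊(m : ℝ) * y⌋₊ = n := hy
      omega
    · rintro x (hx | hx)
      · exact Nat.lt_succ_of_lt hx
      · exact (Nat.lt_succ_of_le (le_of_eq hx))

theorem volume_mul_enorm_setAverage_le {J : Set unitInterval} (u : unitInterval → ℝ) :
    volume J * ‖⨍ s in J, u s‖ₑ ≤ ∫⁻ s in J, ‖u s‖ₑ := by
  rw [setAverage_eq, enorm_smul, ← mul_assoc]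
  refine (mul_le_mul_right (enorm_integral_le_lintegral_enorm _) _).trans ?_
  refine (mul_le_mul_left ?_ _).trans_eq (one_mul _)
  rcases eq_or_ne (volume J) 0 with h | h
  · simp [h]
  · have hr : volume.real J ≠ 0 := (ENNReal.toReal_pos h (measure_ne_top _ _)).ne'
    rw [enorm_inv hr, Real.enorm_of_nonneg measureReal_nonneg, ofReal_measureReal]
    exact ENNReal.mul_inv_le_one _

/-- Averaging over cells is a contraction in `L¹`. This allows representatives to be exchanged and
averages in several coordinates to be iterated. -/
theorem lintegral_cellAvg_sub_le (m : ℕ) {u v : unitInterval → ℝ} (hu : Integrable u)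
    (hv : Integrable v) :
    ∫⁻ t, ‖cellAvg m u t - cellAvg m v t‖ₑ ≤ ∫⁻ t, ‖u t - v t‖ₑ := by
  rw [lintegral_eq_sum_gridCell m, lintegral_eq_sum_gridCell m]
  refine Finset.sum_le_sum fun k _ => ?_
  have h1 : ∀ t ∈ gridCell m k, ‖cellAvg m u t - cellAvg m v t‖ₑ
      = ‖⨍ s in gridCell m k, (u s - v s)‖ₑ := by
    intro t ht
    have ht' : ⌊(m : ℝ) * t⌋₊ = k := ht
    rw [cellAvg, cellAvg, ht', setAverage_eq, setAverage_eq, setAverage_eq,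
      integral_sub hu.integrableOn hv.integrableOn, smul_sub]
  rw [setLIntegral_congr_fun (measurableSet_gridCell m k) h1, setLIntegral_const, mul_comm]
  exact volume_mul_enorm_setAverage_le _

/-- On one cell `u` differs from its average by at most its variation there. The cells have measure
at most `1 / m`, and the variations over the cells add up to at most the total variation. -/
theorem lintegral_sub_cellAvg_le {m : ℕ} (hm : 0 < m) {u : unitInterval → ℝ} (hu : Integrable u) :
    ∫⁻ t, ‖u t - cellAvg m u t‖ₑ ≤ ENNReal.ofReal (1 / m) * eVariationOn u univ := by
  rw [lintegral_eq_sum_gridCell m]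
  refine le_trans ?_ (mul_le_mul_right (sum_eVariationOn_gridCell_le m u (m + 1)) _)
  rw [Finset.mul_sum]
  refine Finset.sum_le_sum fun k _ => ?_
  refine le_trans ?_ (mul_le_mul_left (volume_gridCell_le hm k) _)
  -- The cell with index `m` is `{1}`, a null set on which the average is the default value 0.
  rcases eq_or_ne (volume (gridCell m k)) 0 with h | h
  · rw [setLIntegral_measure_zero _ _ h]
    exact zero_le
  have h1 : ∀ t ∈ gridCell m k, ‖u t - cellAvg m u t‖ₑ ≤ eVariationOn u (gridCell m k) := by
    intro t ht
    have ht' : ⌊(m : ℝ) * t⌋₊ = k := ht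
    have e : u t - cellAvg m u t = ⨍ s in gridCell m k, (u t - u s) := by
      have hr : volume.real (gridCell m k) ≠ 0 := (ENNReal.toReal_pos h (measure_ne_top _ _)).ne'
      rw [cellAvg, ht', setAverage_eq, setAverage_eq,
        integral_sub (integrable_const _) hu.integrableOn, setIntegral_const, smul_sub, smul_smul,
        inv_mul_cancel₀ hr, one_smul]
    have h2 : volume (gridCell m k) * ‖u t - cellAvg m u t‖ₑ
        ≤ volume (gridCell m k) * eVariationOn u (gridCell m k) := by
      rw [e]
      refine (volume_mul_enorm_setAverage_le _).trans ?_
      rw [mul_comm, ← setLIntegral_const]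
      refine setLIntegral_mono' (measurableSet_gridCell m k) fun s hs => ?_
      rw [← edist_eq_enorm_sub]
      exact eVariationOn.edist_le u ht hs
    exact (ENNReal.mul_le_mul_iff_right h (measure_ne_top _ _)).1 h2
  refine (setLIntegral_mono' (measurableSet_gridCell m k) h1).trans_eq ?_
  rw [setLIntegral_const, mul_comm]

variable {d : ℕ}

/-- Averaging in the `i`-th coordinate. -/
noncomputable def coordAvg (i : Fin (d + 1)) (m : ℕ) (f : Cube (d + 1) → ℝ) (x : Cube (d + 1)) :
    ℝ := cellAvg m (fun t => f (i.insertNth t (i.removeNth x))) (x i)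

theorem coordAvg_insertNth (i : Fin (d + 1)) (m : ℕ) (f : Cube (d + 1) → ℝ) (t : unitInterval)
    (y : Cube d) :
    coordAvg i m f (i.insertNth t y) = cellAvg m (fun t => f (i.insertNth t y)) t := by
  simp only [coordAvg, Fin.removeNth_insertNth, Fin.insertNth_apply_same]

theorem measurable_setAverage_insertNth (i : Fin (d + 1)) (s : Set unitInterval)
    {f : Cube (d + 1) → ℝ} (hf : Measurable f) :
    Measurable fun y : Cube d => ⨍ t in s, f (i.insertNth t y) := by
  have h2 : Measurable fun p : Cube d × unitInterval => f (i.insertNth p.2 p.1) :=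
    (hf.comp (measurable_insertNth i)).comp measurable_swap
  have h3 : StronglyMeasurable fun y : Cube d => ∫ t in s, f (i.insertNth t y) :=
    h2.stronglyMeasurable.integral_prod_right (ν := volume.restrict s)
  simp only [setAverage_eq, smul_eq_mul]
  exact h3.measurable.const_mul _

theorem measurable_setAverage_gridCell (i : Fin (d + 1)) (m : ℕ) {f : Cube (d + 1) → ℝ}
    (hf : Measurable f) :
    Measurable fun p : Cube d × ℕ => ⨍ t in gridCell m p.2, f (i.insertNth t p.1) :=
  measurable_from_prod_countable_left fun k : ℕ =>
    measurable_setAverage_insertNth i (gridCell m k) hf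

theorem measurable_removeNth_gridIndex (i : Fin (d + 1)) (m : ℕ) :
    Measurable fun x : Cube (d + 1) => ((i.removeNth x : Cube d), ⌊(m : ℝ) * x i⌋₊) := by
  have h : Measurable fun x : Cube (d + 1) => ⌊(m : ℝ) * x i⌋₊ :=
    (measurable_gridIndex m).comp (measurable_pi_apply i)
  exact (measurable_removeNth i).prodMk h

theorem measurable_coordAvg (i : Fin (d + 1)) (m : ℕ) {f : Cube (d + 1) → ℝ} (hf : Measurable f) :
    Measurable (coordAvg i m f) := by
  have h := (measurable_setAverage_gridCell i m hf).comp (measurable_removeNth_gridIndex i m)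
  exact h

theorem measurable_enorm_sub {f g : Cube d → ℝ} (hf : Measurable f) (hg : Measurable g) :
    Measurable fun x => ‖f x - g x‖ₑ := (hf.sub hg).enorm

theorem ae_integrable_insertNth (i : Fin (d + 1)) {f : Cube (d + 1) → ℝ} (hf : Integrable f) :
    ∀ᵐ y : Cube d, Integrable fun t => f (i.insertNth t y) := by
  have h1 := ((insertNth_measurePreserving i).integrable_comp hf.aestronglyMeasurable).2 hf
  exact Integrable.prod_left_ae h1

theorem lintegral_coordAvg_sub_le (i : Fin (d + 1)) (m : ℕ) {f g : Cube (d + 1) → ℝ}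
    (hf : Measurable f) (hg : Measurable g) (hfi : Integrable f) (hgi : Integrable g) :
    ∫⁻ x, ‖coordAvg i m f x - coordAvg i m g x‖ₑ ≤ ∫⁻ x, ‖f x - g x‖ₑ := by
  rw [lintegral_insertNth i
      (measurable_enorm_sub (measurable_coordAvg i m hf) (measurable_coordAvg i m hg)),
    lintegral_insertNth i (measurable_enorm_sub hf hg)]
  refine lintegral_mono_ae ?_
  filter_upwards [ae_integrable_insertNth i hfi, ae_integrable_insertNth i hgi] with y h1 h2
  simp only [coordAvg_insertNth]
  exact lintegral_cellAvg_sub_le m h1 h2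

theorem coordAvg_zero (i : Fin (d + 1)) (m : ℕ) : coordAvg i m (fun _ => 0) = fun _ => 0 := by
  funext x
  simp [coordAvg, cellAvg]

theorem integrable_coordAvg (i : Fin (d + 1)) (m : ℕ) {f : Cube (d + 1) → ℝ}
    (hf : Measurable f) (hfi : Integrable f) : Integrable (coordAvg i m f) := by
  refine ⟨(measurable_coordAvg i m hf).aestronglyMeasurable, ?_⟩
  have := lintegral_coordAvg_sub_le i m hf measurable_const hfi (integrable_const (0 : ℝ))
  simp only [coordAvg_zero, sub_zero] at this
  exact this.trans_lt hfi.2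

/-- Fubini reduces this to one variable for a regularised representative `g`. The contraction
property shows that replacing `f` by `g` changes neither the function nor its averages in `L¹`. -/
theorem lintegral_sub_coordAvg_le (i : Fin (d + 1)) {m : ℕ} (hm : 0 < m) {f : Cube (d + 1) → ℝ}
    (hf : Measurable f) (hfi : Integrable f) :
    ∫⁻ x, ‖f x - coordAvg i m f x‖ₑ ≤ ENNReal.ofReal (1 / m) * dirVar i f := by
  have hc : ENNReal.ofReal (1 / m) ≠ 0 := by simpa using hm.ne'
  conv_rhs => unfold dirVar
  simp only [ENNReal.mul_iInf_of_ne hc ENNReal.ofReal_ne_top]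
  refine le_iInf₂ fun g₀ a => le_iInf fun b => ?_
  by_cases htop : ∫⁻ y, lineVar i g₀ y = ⊤
  · rw [htop, ENNReal.mul_top hc]
    exact le_top
  obtain ⟨g, hg, hae, hgm, hle⟩ := exists_measurable_reg i hf.aestronglyMeasurable a
    ((ae_lt_top' b htop).mono fun y hy => hy.ne)
  have hgi : Integrable g := hfi.congr hae.symm
  have h0 : ∫⁻ x, ‖f x - g x‖ₑ = 0 := by
    rw [lintegral_congr_ae (g := fun _ => 0) (hae.mono fun x hx => by simp [hx]), lintegral_zero]
  have h0' : ∫⁻ x, ‖coordAvg i m g x - coordAvg i m f x‖ₑ = 0 :=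
    le_antisymm ((lintegral_coordAvg_sub_le i m hg hf hgi hfi).trans_eq
      (by simpa only [enorm_sub_rev] using h0)) zero_le
  have h1 : ∫⁻ x, ‖g x - coordAvg i m g x‖ₑ
      ≤ ENNReal.ofReal (1 / m) * ∫⁻ y, lineVar i g y := by
    rw [lintegral_insertNth i (measurable_enorm_sub hg (measurable_coordAvg i m hg)),
      ← lintegral_const_mul'' _ hgm]
    refine lintegral_mono_ae ?_
    filter_upwards [ae_integrable_insertNth i hgi] with y hy
    simp only [coordAvg_insertNth]
    exact lintegral_sub_cellAvg_le hm hy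
  calc ∫⁻ x, ‖f x - coordAvg i m f x‖ₑ
      ≤ ∫⁻ x, (‖f x - g x‖ₑ + (‖g x - coordAvg i m g x‖ₑ
          + ‖coordAvg i m g x - coordAvg i m f x‖ₑ)) := by
        refine lintegral_mono fun x => ?_
        simp only [← edist_eq_enorm_sub]
        exact (edist_triangle _ _ _).trans (add_le_add le_rfl (edist_triangle _ _ _))
    _ = ∫⁻ x, ‖g x - coordAvg i m g x‖ₑ := by
        rw [lintegral_add_left (measurable_enorm_sub hf hg),
          lintegral_add_left (measurable_enorm_sub hg (measurable_coordAvg i m hg)), h0, h0',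
          zero_add, add_zero]
    _ ≤ _ := h1.trans (mul_le_mul_right (lintegral_mono_ae hle) _)

/-- Averaging in the coordinates from a list. -/
noncomputable def listAvg (m : ℕ) (f : Cube (d + 1) → ℝ) : List (Fin (d + 1)) → Cube (d + 1) → ℝ
  | [] => f
  | i :: l => coordAvg i m (listAvg m f l)

theorem measurable_listAvg (m : ℕ) {f : Cube (d + 1) → ℝ} (hf : Measurable f)
    (l : List (Fin (d + 1))) : Measurable (listAvg m f l) := by
  induction l with
  | nil => exact hf
  | cons i l ih => exact measurable_coordAvg i m ih

theorem integrable_listAvg (m : ℕ) {f : Cube (d + 1) → ℝ} (hf : Measurable f)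
    (hfi : Integrable f) (l : List (Fin (d + 1))) : Integrable (listAvg m f l) := by
  induction l with
  | nil => exact hfi
  | cons i l ih => exact integrable_coordAvg i m (measurable_listAvg m hf l) ih

/-- The triangle inequality is applied after averaging `f` itself in the new coordinate, and the old
error passes through the contraction. In this order the variation of an averaged function never has
to be estimated. -/
theorem lintegral_sub_listAvg_le {m : ℕ} (hm : 0 < m) {f : Cube (d + 1) → ℝ}
    (hf : Measurable f) (hfi : Integrable f) (l : List (Fin (d + 1))) :
    ∫⁻ x, ‖f x - listAvg m f l x‖ₑ ≤ l.length * (ENNReal.ofReal (1 / m) * totalVar f) := by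
  induction l with
  | nil => simp [listAvg]
  | cons i l ih =>
    calc ∫⁻ x, ‖f x - listAvg m f (i :: l) x‖ₑ
        ≤ ∫⁻ x, (‖f x - coordAvg i m f x‖ₑ
            + ‖coordAvg i m f x - coordAvg i m (listAvg m f l) x‖ₑ) := by
          refine lintegral_mono fun x => ?_
          simp only [← edist_eq_enorm_sub]
          exact edist_triangle _ _ _
      _ ≤ ENNReal.ofReal (1 / m) * totalVar f
            + l.length * (ENNReal.ofReal (1 / m) * totalVar f) := by
          rw [lintegral_add_left (measurable_enorm_sub hf (measurable_coordAvg i m hf))]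
          refine add_le_add ((lintegral_sub_coordAvg_le i hm hf hfi).trans
            (mul_le_mul_right (le_iSup (fun i => dirVar i f) i) _)) ?_
          exact (lintegral_coordAvg_sub_le i m hf (measurable_listAvg m hf l) hfi
            (integrable_listAvg m hf hfi l)).trans ih
      _ = _ := by
          rw [List.length_cons]
          push_cast
          ring

/-- An average sees the averaged coordinate only through its cell. After averaging in all
coordinates the function is constant on the cells of the grid, hence lies in a finite-dimensional
space. -/
theorem listAvg_congr (m : ℕ) (f : Cube (d + 1) → ℝ) (l : List (Fin (d + 1)))
    {x x' : Cube (d + 1)} (h : ∀ i, i ∈ l → ⌊(m : ℝ) * x i⌋₊ = ⌊(m : ℝ) * x' i⌋₊)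
    (h' : ∀ i, i ∉ l → x i = x' i) : listAvg m f l x = listAvg m f l x' := by
  induction l generalizing x x' with
  | nil => exact congrArg f (funext fun i => h' i List.not_mem_nil)
  | cons i l ih =>
    have e : ∀ t, listAvg m f l (i.insertNth t (i.removeNth x))
        = listAvg m f l (i.insertNth t (i.removeNth x')) := by
      intro t
      refine ih (fun j hj => ?_) fun j hj => ?_
      all_goals
        rcases eq_or_ne j i with rfl | hji
        · simp only [Fin.insertNth_apply_same]
        obtain ⟨k, rfl⟩ := Fin.exists_succAbove_eq hji
        simp only [Fin.insertNth_apply_succAbove, Fin.removeNth]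
      · exact h _ (List.mem_cons_of_mem _ hj)
      · exact h' _ fun hm => (List.mem_cons.1 hm).elim hji hj
    simp only [listAvg, coordAvg, cellAvg, e, h i List.mem_cons_self]

/-- The index of the cell of `x` in the uniform grid. -/
noncomputable def cellIndex (d m : ℕ) (x : Cube (d + 1)) (i : Fin (d + 1)) : Fin (m + 1) :=
  Fin.ofNat (m + 1) ⌊(m : ℝ) * x i⌋₊

theorem cellIndex_eq {m : ℕ} {x x' : Cube (d + 1)} (h : cellIndex d m x = cellIndex d m x')
    (i : Fin (d + 1)) : ⌊(m : ℝ) * x i⌋₊ = ⌊(m : ℝ) * x' i⌋₊ := by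
  have h1 := congrArg Fin.val (congrFun h i)
  simp only [cellIndex, Fin.ofNat] at h1
  rwa [Nat.mod_eq_of_lt (Nat.lt_succ_of_le (gridIndex_le m _)),
    Nat.mod_eq_of_lt (Nat.lt_succ_of_le (gridIndex_le m _))] at h1

theorem measurable_cellIndex (d m : ℕ) : Measurable (cellIndex d m) :=
  measurable_pi_lambda _ fun i => by
    have h1 : Measurable fun k : ℕ => Fin.ofNat (m + 1) k := measurable_from_nat
    have h2 : Measurable fun x : Cube (d + 1) => ⌊(m : ℝ) * x i⌋₊ :=
      (measurable_gridIndex m).comp (measurable_pi_apply i)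
    exact h1.comp h2

theorem integrable_comp_cellIndex (m : ℕ) (c : (Fin (d + 1) → Fin (m + 1)) → ℝ) :
    Integrable fun x => c (cellIndex d m x) :=
  Integrable.of_bound
    ((measurable_of_finite c).comp (measurable_cellIndex d m)).aestronglyMeasurable
    (∑ k, ‖c k‖) (Eventually.of_forall fun _ => Finset.single_le_sum (f := fun k => ‖c k‖)
      (fun _ _ => norm_nonneg _) (Finset.mem_univ _))

/-- The functions which are constant on the cells of the uniform grid, as elements of `L¹`. -/
noncomputable def stepFun (d m : ℕ) :
    ((Fin (d + 1) → Fin (m + 1)) → ℝ) →ₗ[ℝ] Lp ℝ 1 (volume : Measure (Cube (d + 1))) where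
  toFun c := (integrable_comp_cellIndex m c).toL1 _
  map_add' c c' := Integrable.toL1_add _ _ (integrable_comp_cellIndex m c)
    (integrable_comp_cellIndex m c')
  map_smul' r c := Integrable.toL1_smul _ (integrable_comp_cellIndex m c) r

theorem BV.exists_norm_sub_stepFun_le {m : ℕ} (hm : 0 < m) (h : BV d) :
    ∃ c, ‖h.toL1 - stepFun d m c‖ ≤ (d + 1) / m * h.var := by
  have hsm := Lp.stronglyMeasurable h.toL1
  set K := listAvg m h.toL1 (List.finRange (d + 1)) with hK
  have hKi : Integrable K := integrable_listAvg m hsm.measurable h.integrable_toL1 _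
  have hfac : Function.FactorsThrough K (cellIndex d m) := fun x x' hx =>
    listAvg_congr m _ _ (fun i _ => cellIndex_eq hx i)
      fun i hi => absurd (List.mem_finRange i) hi
  obtain ⟨c, hc⟩ := (Function.factorsThrough_iff K).1 hfac
  refine ⟨c, ?_⟩
  have h1 := lintegral_sub_listAvg_le hm hsm.measurable h.integrable_toL1 (List.finRange (d + 1))
  have h2 : stepFun d m c = hKi.toL1 K :=
    (Integrable.toL1_eq_toL1_iff _ _ (integrable_comp_cellIndex m c) hKi).2 (by rw [hc]; rfl)
  have h3 : ENNReal.ofReal ‖h.toL1 - stepFun d m c‖ = ∫⁻ x, ‖h.toL1 x - K x‖ₑ := by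
    rw [h2, ofReal_norm, Lp.enorm_def, eLpNorm_one_eq_lintegral_enorm]
    refine lintegral_congr_ae ?_
    filter_upwards [Lp.coeFn_sub h.toL1 (hKi.toL1 K), hKi.coeFn_toL1] with x hx hx'
    rw [hx, Pi.sub_apply, hx']
  have hnn : 0 ≤ (d + 1) / m * h.var := mul_nonneg (by positivity) h.var_nonneg
  rw [← ENNReal.ofReal_le_ofReal_iff hnn, h3]
  refine h1.trans_eq ?_
  rw [← BV.ofReal_var, List.length_finRange, ← ENNReal.ofReal_mul (by positivity),
    ← ENNReal.ofReal_natCast, ← ENNReal.ofReal_mul (by positivity)]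
  congr 1
  push_cast
  ring

end CellAverage

/-- Up to an error of `(d + 1) / m` in `L¹`, the unit ball lies in a bounded part of the
finite-dimensional space of step functions. -/
theorem BV.totallyBounded_toL1 (d : ℕ) :
    TotallyBounded (toL1 (d := d) '' Metric.closedBall 0 1) := by
  rw [Metric.totallyBounded_iff]
  intro ε hε
  obtain ⟨m, hm⟩ := exists_nat_gt ((d + 1) / (ε / 2) + 1)
  have hd : 0 ≤ (d + 1) / (ε / 2) := by positivity
  have hm0 : (0 : ℝ) < m := by linarith
  have hdm : ((d : ℝ) + 1) / m < ε / 2 := by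
    rw [div_lt_iff₀ hm0]
    have := (div_lt_iff₀ (half_pos hε)).1 (show (d + 1) / (ε / 2) < (m : ℝ) by linarith)
    linarith
  have hc : TotallyBounded ((fun z : LinearMap.range (stepFun d m) => z.1) ''
      Metric.closedBall 0 (1 + ε / 2)) :=
    ((isCompact_closedBall _ _).image continuous_subtype_val).totallyBounded
  obtain ⟨t, ht, hcov⟩ := Metric.totallyBounded_iff.1 hc (ε / 2) (half_pos hε)
  refine ⟨t, ht, ?_⟩
  rintro _ ⟨h, hh, rfl⟩
  rw [mem_closedBall_zero_iff] at hh
  obtain ⟨c, hc⟩ := h.exists_norm_sub_stepFun_le (Nat.cast_pos.1 hm0)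
  have h1 : ‖h.toL1 - stepFun d m c‖ < ε / 2 := by
    refine (hc.trans ?_).trans_lt hdm
    exact mul_le_of_le_one_right (by positivity) (h.var_le_norm.trans hh)
  have h2 : ‖stepFun d m c‖ ≤ 1 + ε / 2 := by
    have := norm_sub_norm_le (stepFun d m c) h.toL1
    rw [norm_sub_rev] at this
    linarith [h.norm_toL1_le]
  have h3 : stepFun d m c ∈ (fun z : LinearMap.range (stepFun d m) => z.1) ''
      Metric.closedBall 0 (1 + ε / 2) :=
    ⟨⟨_, LinearMap.mem_range_self _ c⟩, by rw [mem_closedBall_zero_iff]; exact h2, rfl⟩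
  obtain ⟨z, hz, hz'⟩ := mem_iUnion₂.1 (hcov h3)
  refine mem_iUnion₂.2 ⟨z, hz, ?_⟩
  rw [Metric.mem_ball] at hz' ⊢
  rw [← dist_eq_norm] at h1
  linarith [dist_triangle h.toL1 (stepFun d m c) z]

/-- Cover the unit ball by finitely many sets of small `L¹` diameter with centres in the ball. Two
elements of the ball differ by at most 2 in variation, so their images differ by at most `2a` plus
an arbitrarily small multiple of the `L¹` distance. -/
theorem indexOfCompactness_le_of_var_le {d : ℕ} {A : BV d →L[ℝ] BV d} {a C : ℝ} (ha : 0 < a)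
    (hA : ∀ h, (A h).var ≤ a * h.var + C * ‖h.toL1‖) (hL : ∀ h, ‖(A h).toL1‖ ≤ ‖h.toL1‖) :
    indexOfCompactness A ≤ 2 * a := by
  refine le_of_forall_pos_le_add fun ε hε => csInf_le ⟨0, fun r hr => hr.1.le⟩ ⟨by positivity, ?_⟩
  have hδ : 0 < ε / (|C| + 1) := by positivity
  obtain ⟨t, hts, ht, hcov⟩ := Metric.finite_approx_of_totallyBounded
    (BV.totallyBounded_toL1 d) _ hδ
  obtain ⟨u, hu, hut⟩ := subset_image_iff.1 hts
  have hufin : u.Finite := (hut ▸ ht).of_finite_image BV.toL1_injective.injOn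
  refine ⟨A '' u, hufin.image _, ?_⟩
  rintro _ ⟨h, hh, rfl⟩
  obtain ⟨z, hz, hz'⟩ := mem_iUnion₂.1 (hcov ⟨h, hh, rfl⟩)
  rw [← hut] at hz
  obtain ⟨k, hk, rfl⟩ := hz
  refine mem_iUnion₂.2 ⟨A k, ⟨k, hk, rfl⟩, ?_⟩
  rw [Metric.mem_ball, dist_eq_norm, ← map_sub] at hz'
  rw [Metric.mem_closedBall, dist_eq_norm, ← map_sub, BV.norm_def]
  have h1 := hA (h - k)
  have h2 := hL (h - k)
  have h3 : (h - k).var ≤ 2 := by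
    have e1 := mem_closedBall_zero_iff.1 hh
    have e2 := mem_closedBall_zero_iff.1 (hu hk)
    linarith [(h - k).var_le_norm, norm_sub_le h k]
  have h4 : C * ‖(h - k).toL1‖ + ‖(h - k).toL1‖ ≤ ε := by
    have e1 := (lt_div_iff₀ (by positivity)).1 hz'
    have e2 := mul_le_mul_of_nonneg_right (le_abs_self C) (norm_nonneg (h - k).toL1)
    linarith
  have h5 := mul_le_mul_of_nonneg_left h3 ha.le
  linarith

end Jab

namespace Jab

/-! ### Measurability of cocycles -/

/-- The space of operators need not be separable, and strong measurability needs a separable range.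
It is a countable union of continuous images of subsets of the separable space `Ω`. -/
theorem PContinuous.stronglyMeasurable {Ω Y : Type*} [TopologicalSpace Ω] [PolishSpace Ω]
    [MeasurableSpace Ω] [BorelSpace Ω] [TopologicalSpace Y]
    [TopologicalSpace.PseudoMetrizableSpace Y] {L : Ω → Y}
    (h : PContinuous L) : StronglyMeasurable L := by
  obtain ⟨E, hE, hU, hc⟩ := h
  borelize Y
  refine stronglyMeasurable_iff_measurable_separable.2 ⟨measurable_of_isOpen fun V hV => ?_, ?_⟩
  · have : L ⁻¹' V = ⋃ j, L ⁻¹' V ∩ E j := by rw [← inter_iUnion, hU, inter_univ]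
    rw [this]
    refine MeasurableSet.iUnion fun j => ?_
    obtain ⟨W, hW, e⟩ := continuousOn_iff'.1 (hc j) V hV
    rw [e]
    exact hW.measurableSet.inter (hE j)
  · have : range L = ⋃ j, L '' E j := by rw [← image_iUnion, hU, image_univ]
    rw [this]
    exact TopologicalSpace.IsSeparable.iUnion fun j =>
      (hc j).isSeparable_image (TopologicalSpace.IsSeparable.of_separableSpace _)

theorem stronglyMeasurable_cocycle {Ω X : Type*} [NormedAddCommGroup X] [NormedSpace ℝ X]
    [MeasurableSpace Ω] {σ : Ω → Ω} (hσ : Measurable σ) {L : Ω → X →L[ℝ] X}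
    (hL : StronglyMeasurable L) (k : ℕ) : StronglyMeasurable (cocycle σ L k) := by
  induction k with
  | zero => exact stronglyMeasurable_const
  | succ k ih =>
    exact (isBoundedBilinearMap_comp (𝕜 := ℝ) (E := X) (F := X)
      (G := X)).continuous.comp_stronglyMeasurable
      ((hL.comp_measurable (hσ.iterate k)).prodMk ih)

/-! ### The index of compactness -/

section IndexOfCompactness

variable {X : Type*} [NormedAddCommGroup X] [NormedSpace ℝ X]

/-- The image of the unit ball under `A` is covered by finitely many balls of radius `r`. -/
def HasFiniteCover (A : X →L[ℝ] X) (r : ℝ) : Prop :=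
  ∃ t : Set X, t.Finite ∧ A '' Metric.closedBall 0 1 ⊆ ⋃ x ∈ t, Metric.closedBall x r

theorem HasFiniteCover.exists_norm_sub_le {A : X →L[ℝ] X} {r : ℝ} (h : HasFiniteCover A r) :
    ∃ t : Set X, t.Finite ∧ ∀ x, ‖x‖ ≤ 1 → ∃ y ∈ t, ‖A x - y‖ ≤ r := by
  obtain ⟨t, ht, hcov⟩ := h
  refine ⟨t, ht, fun x hx => ?_⟩
  obtain ⟨y, hy, hy'⟩ := mem_iUnion₂.1 (hcov ⟨x, mem_closedBall_zero_iff.2 hx, rfl⟩)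
  exact ⟨y, hy, by rwa [← dist_eq_norm]⟩

theorem hasFiniteCover_of_norm_sub_le {A : X →L[ℝ] X} {r : ℝ} {t : Set X} (ht : t.Finite)
    (h : ∀ x, ‖x‖ ≤ 1 → ∃ y ∈ t, ‖A x - y‖ ≤ r) : HasFiniteCover A r := by
  refine ⟨t, ht, ?_⟩
  rintro _ ⟨x, hx, rfl⟩
  obtain ⟨y, hy, hy'⟩ := h x (mem_closedBall_zero_iff.1 hx)
  exact mem_iUnion₂.2 ⟨y, hy, by rwa [Metric.mem_closedBall, dist_eq_norm]⟩

theorem hasFiniteCover_norm (A : X →L[ℝ] X) : HasFiniteCover A ‖A‖ :=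
  hasFiniteCover_of_norm_sub_le (finite_singleton 0) fun x hx =>
    ⟨0, rfl, by rw [sub_zero]; exact A.unit_le_opNorm x hx⟩

theorem indexOfCompactness_nonneg (A : X →L[ℝ] X) : 0 ≤ indexOfCompactness A :=
  Real.sInf_nonneg fun _ hr => hr.1.le

theorem indexOfCompactness_le {A : X →L[ℝ] X} {r : ℝ} (hr : 0 < r) (h : HasFiniteCover A r) :
    indexOfCompactness A ≤ r :=
  csInf_le ⟨0, fun _ hr => hr.1.le⟩ ⟨hr, h⟩

theorem indexOfCompactness_le_norm (A : X →L[ℝ] X) : indexOfCompactness A ≤ ‖A‖ :=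
  le_of_forall_pos_le_add fun ε hε => by
    refine indexOfCompactness_le (add_pos_of_nonneg_of_pos (norm_nonneg A) hε) ?_
    obtain ⟨t, ht, h⟩ := (hasFiniteCover_norm A).exists_norm_sub_le
    refine hasFiniteCover_of_norm_sub_le ht fun x hx => ?_
    obtain ⟨y, hy, hy'⟩ := h x hx
    exact ⟨y, hy, hy'.trans (le_add_of_nonneg_right hε.le)⟩

theorem exists_hasFiniteCover (A : X →L[ℝ] X) {ε : ℝ} (hε : 0 < ε) :
    ∃ r, 0 < r ∧ HasFiniteCover A r ∧ r < indexOfCompactness A + ε := by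
  have hne : {r : ℝ | 0 < r ∧ HasFiniteCover A r}.Nonempty := by
    refine ⟨‖A‖ + 1, by positivity, ?_⟩
    obtain ⟨t, ht, h⟩ := (hasFiniteCover_norm A).exists_norm_sub_le
    refine hasFiniteCover_of_norm_sub_le ht fun x hx => ?_
    obtain ⟨y, hy, hy'⟩ := h x hx
    exact ⟨y, hy, hy'.trans (le_add_of_nonneg_right zero_le_one)⟩
  obtain ⟨r, hr, hlt⟩ := Real.lt_sInf_add_pos hne hε
  exact ⟨r, hr.1, hr.2, hlt⟩

/-- The centres of a cover for `B` serve for `A` with radii enlarged by `‖A - B‖`. The index is thus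
continuous, hence measurable along the cocycle. -/
theorem indexOfCompactness_le_add (A B : X →L[ℝ] X) :
    indexOfCompactness A ≤ indexOfCompactness B + ‖A - B‖ :=
  le_of_forall_pos_le_add fun ε hε => by
    obtain ⟨r, hr, hcov, hlt⟩ := exists_hasFiniteCover B hε
    obtain ⟨t, ht, h⟩ := hcov.exists_norm_sub_le
    have : indexOfCompactness A ≤ r + ‖A - B‖ := by
      refine indexOfCompactness_le (by positivity) (hasFiniteCover_of_norm_sub_le ht fun x hx => ?_)
      obtain ⟨y, hy, hy'⟩ := h x hx
      refine ⟨y, hy, ?_⟩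
      have e : A x - y = (B x - y) + (A - B) x := by
        rw [sub_apply]; abel
      rw [e]
      exact (norm_add_le _ _).trans (add_le_add hy' ((A - B).unit_le_opNorm x hx))
    linarith

theorem continuous_indexOfCompactness :
    Continuous (indexOfCompactness : (X →L[ℝ] X) → ℝ) := by
  refine (LipschitzWith.of_le_add fun A B => ?_).continuous
  rw [dist_eq_norm]
  exact indexOfCompactness_le_add A B

/-- If `A x` is within `r` of `y`, then `A x = y + r u` with `u` in the unit ball, and `B u` is
within `s` of some `z`. The points `B y + r z` are centres of a finite cover with radius `s r`. -/
theorem indexOfCompactness_comp_le (A B : X →L[ℝ] X) :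
    indexOfCompactness (B.comp A) ≤ indexOfCompactness B * indexOfCompactness A := by
  have key : ∀ ε : ℝ, 0 < ε → indexOfCompactness (B.comp A)
      ≤ (indexOfCompactness B + ε) * (indexOfCompactness A + ε) := fun ε hε => by
    obtain ⟨r, hr, hcov, hlt⟩ := exists_hasFiniteCover A hε
    obtain ⟨s, hs, hcov', hlt'⟩ := exists_hasFiniteCover B hε
    obtain ⟨t, ht, h⟩ := hcov.exists_norm_sub_le
    obtain ⟨t', ht', h'⟩ := hcov'.exists_norm_sub_le
    have h1 : indexOfCompactness (B.comp A) ≤ s * r := by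
      refine indexOfCompactness_le (mul_pos hs hr)
        (hasFiniteCover_of_norm_sub_le (ht.image2 (fun y z => B y + r • z) ht') fun x hx => ?_)
      obtain ⟨y, hy, hy'⟩ := h x hx
      have hu : ‖r⁻¹ • (A x - y)‖ ≤ 1 := by
        rw [norm_smul, norm_inv, Real.norm_of_nonneg hr.le, inv_mul_le_iff₀ hr, mul_one]
        exact hy'
      obtain ⟨z, hz, hz'⟩ := h' _ hu
      refine ⟨_, mem_image2_of_mem hy hz, ?_⟩
      have e : B.comp A x - (B y + r • z) = r • (B (r⁻¹ • (A x - y)) - z) := by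
        rw [map_smul, smul_sub, smul_smul, mul_inv_cancel₀ hr.ne', one_smul, map_sub,
          ContinuousLinearMap.comp_apply]
        abel
      rw [e, norm_smul, Real.norm_of_nonneg hr.le, mul_comm]
      exact mul_le_mul_of_nonneg_right hz' hr.le
    refine h1.trans (mul_le_mul hlt'.le hlt.le hr.le ?_)
    linarith [indexOfCompactness_nonneg B]
  have hc : Tendsto (fun ε : ℝ => (indexOfCompactness B + ε) * (indexOfCompactness A + ε))
      (𝓝[>] 0) (𝓝 ((indexOfCompactness B + 0) * (indexOfCompactness A + 0))) :=
    ((by fun_prop : Continuous fun ε : ℝ =>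
      (indexOfCompactness B + ε) * (indexOfCompactness A + ε)).tendsto 0).mono_left
      nhdsWithin_le_nhds
  rw [add_zero, add_zero] at hc
  exact ge_of_tendsto hc (eventually_mem_nhdsWithin.mono fun ε hε => key ε hε)

end IndexOfCompactness

/-! ### Operator norms with respect to weighted norms on `BV` -/

namespace BV

variable {d : ℕ}

/-- The norm `V h + K ‖h‖₁`. -/
noncomputable def wnorm (K : ℝ) (h : BV d) : ℝ := h.var + K * ‖h.toL1‖

theorem norm_le_wnorm {K : ℝ} (hK : 1 ≤ K) (h : BV d) : ‖h‖ ≤ wnorm K h := by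
  rw [norm_def, wnorm]
  linarith [le_mul_of_one_le_left (norm_nonneg h.toL1) hK]

theorem wnorm_le {K : ℝ} (hK : 1 ≤ K) (h : BV d) : wnorm K h ≤ K * ‖h‖ := by
  rw [norm_def, wnorm, mul_add]
  linarith [le_mul_of_one_le_left h.var_nonneg hK]

theorem wnorm_add_le {K : ℝ} (hK : 1 ≤ K) (h k : BV d) :
    wnorm K (h + k) ≤ wnorm K h + wnorm K k := by
  simp only [wnorm, map_add]
  have := mul_le_mul_of_nonneg_left (norm_add_le h.toL1 k.toL1) (zero_le_one.trans hK)
  linarith [var_add_le h k]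

/-- The operator norm with respect to `wnorm K`. -/
noncomputable def wopNorm (K : ℝ) (A : BV d →L[ℝ] BV d) : ℝ :=
  sInf {c : ℝ | 0 ≤ c ∧ ∀ h, wnorm K (A h) ≤ c * wnorm K h}

theorem wopNorm_nonneg (K : ℝ) (A : BV d →L[ℝ] BV d) : 0 ≤ wopNorm K A :=
  Real.sInf_nonneg fun _ hr => hr.1

theorem wopNorm_le {K c : ℝ} {A : BV d →L[ℝ] BV d} (hc : 0 ≤ c)
    (h : ∀ h, wnorm K (A h) ≤ c * wnorm K h) : wopNorm K A ≤ c :=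
  csInf_le ⟨0, fun _ hr => hr.1⟩ ⟨hc, h⟩

theorem wnorm_apply_le {K : ℝ} (hK : 1 ≤ K) (A : BV d →L[ℝ] BV d) (h : BV d) :
    wnorm K (A h) ≤ wopNorm K A * wnorm K h := by
  have hne : {c : ℝ | 0 ≤ c ∧ ∀ h, wnorm K (A h) ≤ c * wnorm K h}.Nonempty := by
    refine ⟨K * ‖A‖, by positivity, fun h => ?_⟩
    calc wnorm K (A h) ≤ K * (‖A‖ * ‖h‖) := (wnorm_le hK _).trans
          (mul_le_mul_of_nonneg_left (A.le_opNorm h) (by positivity))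
      _ ≤ K * ‖A‖ * wnorm K h := by
          rw [← mul_assoc]
          exact mul_le_mul_of_nonneg_left (norm_le_wnorm hK h) (by positivity)
  -- The set of admissible constants is closed, so the infimum is itself admissible.
  have hcl : IsClosed {c : ℝ | 0 ≤ c ∧ ∀ h, wnorm K (A h) ≤ c * wnorm K h} := by
    simp only [ofPred_and, ofPred_forall]
    exact isClosed_Ici.inter (isClosed_iInter fun h =>
      isClosed_le continuous_const (continuous_id.mul continuous_const))
  exact (hcl.csInf_mem hne ⟨0, fun _ hr => hr.1⟩).2 h

theorem wopNorm_comp_le {K : ℝ} (hK : 1 ≤ K) (A B : BV d →L[ℝ] BV d) :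
    wopNorm K (B.comp A) ≤ wopNorm K B * wopNorm K A :=
  wopNorm_le (mul_nonneg (wopNorm_nonneg K B) (wopNorm_nonneg K A)) fun h => by
    rw [ContinuousLinearMap.comp_apply, mul_assoc]
    exact (wnorm_apply_le hK B _).trans
      (mul_le_mul_of_nonneg_left (wnorm_apply_le hK A h) (wopNorm_nonneg K B))

theorem wopNorm_id_le (K : ℝ) : wopNorm K (ContinuousLinearMap.id ℝ (BV d)) ≤ 1 :=
  wopNorm_le zero_le_one fun h => by rw [one_mul]; rfl

theorem wopNorm_le_add {K : ℝ} (hK : 1 ≤ K) (A B : BV d →L[ℝ] BV d) :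
    wopNorm K A ≤ wopNorm K B + K * ‖A - B‖ :=
  wopNorm_le (add_nonneg (wopNorm_nonneg K B) (by positivity)) fun h => by
    have e : A h = B h + (A - B) h := by rw [sub_apply]; abel
    rw [e, add_mul]
    refine (wnorm_add_le hK _ _).trans (add_le_add (wnorm_apply_le hK B h) ?_)
    refine (wnorm_le hK _).trans ?_
    rw [mul_assoc]
    refine mul_le_mul_of_nonneg_left (((A - B).le_opNorm h).trans ?_) (by positivity)
    exact mul_le_mul_of_nonneg_left (norm_le_wnorm hK h) (norm_nonneg _)

theorem continuous_wopNorm {K : ℝ} (hK : 1 ≤ K) :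
    Continuous (wopNorm K : (BV d →L[ℝ] BV d) → ℝ) := by
  refine (LipschitzWith.of_le_add_mul (Real.toNNReal K) fun A B => ?_).continuous
  rw [dist_eq_norm, Real.coe_toNNReal K (by positivity)]
  exact wopNorm_le_add hK A B

theorem norm_le_wopNorm {K : ℝ} (hK : 1 ≤ K) (A : BV d →L[ℝ] BV d) : ‖A‖ ≤ K * wopNorm K A :=
  A.opNorm_le_bound (mul_nonneg (by positivity) (wopNorm_nonneg K A)) fun h => by
    refine (norm_le_wnorm hK _).trans ((wnorm_apply_le hK A h).trans ?_)
    rw [mul_comm K, mul_assoc]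
    exact mul_le_mul_of_nonneg_left (wnorm_le hK h) (wopNorm_nonneg K A)

/-- Since `A` contracts `L¹`, the bound does not depend on `K`. It provides the integrable majorant
for the passage to large `K`. -/
theorem wopNorm_le_one_add_norm {K : ℝ} (hK : 1 ≤ K) {A : BV d →L[ℝ] BV d}
    (hA : ∀ h, ‖(A h).toL1‖ ≤ ‖h.toL1‖) : wopNorm K A ≤ 1 + ‖A‖ :=
  wopNorm_le (by positivity) fun h => by
    have h1 : (A h).var ≤ ‖A‖ * wnorm K h := (A h).var_le_norm.trans ((A.le_opNorm h).trans
      (mul_le_mul_of_nonneg_left (norm_le_wnorm hK h) (norm_nonneg _)))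
    have h2 := mul_le_mul_of_nonneg_left (hA h) (zero_le_one.trans hK)
    have h3 : wnorm K (A h) = (A h).var + K * ‖(A h).toL1‖ := rfl
    have h4 : wnorm K h = h.var + K * ‖h.toL1‖ := rfl
    rw [add_mul, one_mul]
    linarith [h.var_nonneg]

/-- The weight `K` absorbs the remainder of a Lasota–Yorke inequality: `c ‖h‖₁` is the fraction `c /
K` of `K ‖h‖₁`. For large `K` the norm is essentially `max a 1`. -/
theorem wopNorm_le_max {K a c : ℝ} (hK : 1 ≤ K) {A : BV d →L[ℝ] BV d} (hc : 0 ≤ c)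
    (hA : ∀ h, ‖(A h).toL1‖ ≤ ‖h.toL1‖) (hV : ∀ h, (A h).var ≤ a * h.var + c * ‖h.toL1‖) :
    wopNorm K A ≤ max a (1 + c / K) := by
  have hK0 : 0 < K := by linarith
  refine wopNorm_le (le_max_of_le_right (by positivity)) fun h => ?_
  have h1 := mul_le_mul_of_nonneg_left (hA h) hK0.le
  have h2 := mul_le_mul_of_nonneg_right (le_max_left a (1 + c / K)) h.var_nonneg
  have h3 := mul_le_mul_of_nonneg_right (le_max_right a (1 + c / K))
    (mul_nonneg hK0.le (norm_nonneg h.toL1))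
  have h4 : (1 + c / K) * (K * ‖h.toL1‖) = K * ‖h.toL1‖ + c * ‖h.toL1‖ := by field_simp
  have h5 := hV h
  rw [wnorm, wnorm, mul_add]
  linarith

theorem continuous_var : Continuous fun h : BV d => h.var := by
  refine (LipschitzWith.of_le_add fun h k => ?_).continuous
  have h1 := (h - k).var_le_norm
  rw [← dist_eq_norm h k] at h1
  have h2 := var_add_le k (h - k)
  rw [add_sub_cancel] at h2
  linarith

/-- The remainder in a Lasota–Yorke inequality can be chosen measurably. -/
theorem exists_measurable_var_le {Ω : Type*} [MeasurableSpace Ω] {A : Ω → BV d →L[ℝ] BV d}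
    (hA : StronglyMeasurable A) {a : Ω → ℝ} (ha : Measurable a) :
    ∃ c : Ω → ℝ, Measurable c ∧ (∀ ω, 0 < c ω) ∧ ∀ ω,
      (∃ C : ℝ, ∀ h, (A ω h).var ≤ a ω * h.var + C * ‖h.toL1‖) →
        ∀ h, (A ω h).var ≤ a ω * h.var + c ω * ‖h.toL1‖ := by
  classical
  set S : ℕ → Set ((BV d →L[ℝ] BV d) × ℝ) :=
    fun n => {p | ∀ h, (p.1 h).var ≤ p.2 * h.var + n * ‖h.toL1‖} with hS
  have hScl : ∀ n, IsClosed (S n) := fun n => by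
    simp only [hS, ofPred_forall]
    refine isClosed_iInter fun h => isClosed_le (continuous_var.comp ?_) ?_
    · exact continuous_fst.clm_apply continuous_const
    · exact (continuous_snd.mul continuous_const).add continuous_const
  have hm : ∀ n, MeasurableSet {ω | (A ω, a ω) ∈ S n} := fun n => by
    borelize ((BV d →L[ℝ] BV d) × ℝ)
    exact (hA.prodMk ha.stronglyMeasurable).measurable (hScl n).measurableSet
  -- The second alternative makes every `n` admissible where no constant exists, so that the least
  -- `n` is defined for all `ω` and is measurable.
  set p : Ω → ℕ → Prop := fun ω n => (A ω, a ω) ∈ S n ∨ ∀ k, (A ω, a ω) ∉ S k with hp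
  have hex : ∀ ω, ∃ n, p ω n := fun ω => by
    by_cases h : ∃ k, (A ω, a ω) ∈ S k
    · exact h.imp fun k hk => Or.inl hk
    · exact ⟨0, Or.inr (not_exists.1 h)⟩
  have hpm : ∀ n, MeasurableSet {ω | p ω n} := fun n => by
    simp only [hp, ofPred_or, ofPred_forall]
    exact (hm n).union (MeasurableSet.iInter fun k => (hm k).compl)
  refine ⟨fun ω => (Nat.find (hex ω) : ℝ) + 1, ?_, fun ω => by positivity, ?_⟩
  · exact (measurable_from_nat.comp (measurable_find hex hpm)).add_const _
  · rintro ω ⟨C, hC⟩ h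
    obtain ⟨n, hn⟩ := exists_nat_ge C
    have hmem : (A ω, a ω) ∈ S n := fun h => (hC h).trans
      (add_le_add le_rfl (mul_le_mul_of_nonneg_right hn (norm_nonneg _)))
    have h1 := (Nat.find_spec (hex ω)).resolve_right fun h' => h' n hmem
    exact (h1 h).trans (add_le_add le_rfl
      (mul_le_mul_of_nonneg_right (by linarith) (norm_nonneg _)))

end BV

end Jab

namespace Jab

/-! ### Exponents of cocycles -/

section Exponent

variable {Ω X : Type*} [NormedAddCommGroup X] [NormedSpace ℝ X]

/-- The growth of a submultiplicative size function along a cocycle, cut off from below. -/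
noncomputable def logGrowth (σ : Ω → Ω) (L : Ω → X →L[ℝ] X) (s : (X →L[ℝ] X) → ℝ) (b : ℝ) (n : ℕ)
    (ω : Ω) : ℝ := Real.posLog (s (cocycle σ L n ω) * b ^ n)

/-- Taking positive parts keeps the process nonnegative and subadditive and cuts the exponent off at
`-log b` when `b > 0`. The second clause, a bound of the limit by one majorised term, is what makes
it possible to compute signs. -/
theorem exists_tendsto_logGrowth [MeasurableSpace Ω] {P : Measure Ω} [IsProbabilityMeasure P]
    {σ : Ω → Ω} (hσ : Ergodic σ P) {L : Ω → X →L[ℝ] X} (hL : StronglyMeasurable L)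
    (hlog : Integrable (fun ω => Real.posLog ‖L ω‖) P) {s : (X →L[ℝ] X) → ℝ} (hs : Continuous s)
    (hs0 : ∀ A, 0 ≤ s A) (hs1 : s (ContinuousLinearMap.id ℝ X) ≤ 1)
    (hmul : ∀ A B : X →L[ℝ] X, s (B.comp A) ≤ s B * s A) (hle : ∀ᵐ ω ∂P, s (L ω) ≤ 1 + ‖L ω‖)
    {b : ℝ} (hb : 0 ≤ b) :
    ∃ c : ℝ, (∀ᵐ ω ∂P, Tendsto (fun n : ℕ => logGrowth σ L s b n ω / n) atTop (𝓝 c)) ∧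
      ∀ N : ℕ, 0 < N → ∀ φ : Ω → ℝ, Integrable φ P → (∀ᵐ ω ∂P, logGrowth σ L s b N ω ≤ φ ω) →
        c * N ≤ ∫ ω, φ ω ∂P := by
  have hm : ∀ n, Measurable (logGrowth σ L s b n) := fun n =>
    Real.continuous_posLog.measurable.comp ((hs.comp_stronglyMeasurable
      (stronglyMeasurable_cocycle hσ.measurable hL n)).measurable.mul_const _)
  have h0 : ∀ ω, logGrowth σ L s b 0 ω = 0 := fun ω => by
    rw [logGrowth, Real.posLog_eq_zero_iff, pow_zero, mul_one, abs_of_nonneg (hs0 _)]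
    exact hs1
  have hpos : ∀ n ω, 0 ≤ logGrowth σ L s b n ω := fun _ _ => Real.posLog_nonneg
  have hsub : ∀ m n ω, logGrowth σ L s b (m + n) ω
      ≤ logGrowth σ L s b m ω + logGrowth σ L s b n (σ^[m] ω) := fun m n ω => by
    refine le_trans (Real.posLog_le_posLog (mul_nonneg (hs0 _) (pow_nonneg hb _)) ?_)
      Real.posLog_mul
    rw [cocycle_add, pow_add]
    calc _ ≤ s (cocycle σ L n (σ^[m] ω)) * s (cocycle σ L m ω) * (b ^ m * b ^ n) :=
          mul_le_mul_of_nonneg_right (hmul _ _) (by positivity)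
      _ = _ := by ring
  have hi : Integrable (logGrowth σ L s b 1) P := by
    refine Integrable.mono' ((hlog.add (integrable_const (Real.log 2 + Real.posLog b))))
      (hm 1).aestronglyMeasurable ?_
    filter_upwards [hle] with ω hω
    rw [Real.norm_of_nonneg (hpos 1 ω), logGrowth, cocycle_one, pow_one]
    have h1 := Real.posLog_le_posLog (hs0 (L ω)) hω
    have h2 := Real.posLog_add (x := 1) (y := ‖L ω‖)
    have h3 := Real.posLog_mul (x := s (L ω)) (y := b)
    have h4 : Real.posLog (1 : ℝ) = 0 := (Real.posLog_eq_zero_iff 1).2 (by simp)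
    simp only [Pi.add_apply]
    linarith
  obtain ⟨c, hc⟩ := exists_tendsto_subadditive hσ hm h0 hpos hsub hi
  exact ⟨c, hc, fun N hN φ hφ h => subadditive_limit_le hσ hm h0 hpos hsub hc hN hφ h⟩

theorem inv_mul_log_ofReal {x : ℝ} (hx : 0 < x) (k : ℕ) :
    (((k : ℝ)⁻¹ : ℝ) : EReal) * ENNReal.log (ENNReal.ofReal x)
      = ((Real.log x / k : ℝ) : EReal) := by
  rw [ENNReal.log_pos_real' (by rwa [ENNReal.toReal_ofReal hx.le]), ENNReal.toReal_ofReal hx.le,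
    ← EReal.coe_mul, mul_comm, div_eq_mul_inv]

/-- Multiplying by `exp(M k)` before taking the positive part of the logarithm amounts to truncating
the exponent at `-M`, also when `x = 0`. -/
theorem max_inv_mul_log_ofReal {x : ℝ} (hx : 0 ≤ x) {k : ℕ} (hk : 0 < k) (M : ℝ) :
    max ((((k : ℝ)⁻¹ : ℝ) : EReal) * ENNReal.log (ENNReal.ofReal x)) ((-M : ℝ) : EReal)
      = ((Real.posLog (x * Real.exp M ^ k) / k - M : ℝ) : EReal) := by
  have hk' : (0 : ℝ) < k := Nat.cast_pos.2 hk
  rcases hx.eq_or_lt with rfl | hx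
  · rw [ENNReal.ofReal_zero, ENNReal.log_zero, EReal.coe_mul_bot_of_pos (inv_pos.2 hk'),
      max_eq_right bot_le, zero_mul]
    simp [Real.posLog]
  · rw [inv_mul_log_ofReal hx, ← EReal.coe_strictMono.monotone.map_max,
      EReal.coe_eq_coe_iff, Real.posLog,
      Real.log_mul hx.ne' (pow_ne_zero _ (Real.exp_pos M).ne'), Real.log_pow, Real.log_exp]
    have e : (Real.log x + k * M) / k = Real.log x / k + M := by field_simp
    rw [max_comm]
    rcases le_total (Real.log x + k * M) 0 with h | h
    · have h' : Real.log x / k + M ≤ 0 := e ▸ div_nonpos_of_nonpos_of_nonneg h hk'.le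
      rw [max_eq_left h, max_eq_left (by linarith)]
      simp
    · have h' : 0 ≤ Real.log x / k + M := e ▸ div_nonneg h hk'.le
      rw [max_eq_right h, max_eq_right (by linarith), e]
      ring

/-- The value `-∞` is allowed. For a lower bound `r`, a truncation at `-M < r` is invisible; an
upper bound for one truncation bounds the sequence. -/
theorem tendsto_iInf_of_tendsto_max {x : ℕ → EReal} {κ : ℕ → EReal}
    (h : ∀ M : ℕ, Tendsto (fun n => max (x n) ((-(M : ℝ) : ℝ) : EReal)) atTop (𝓝 (κ M))) :
    Tendsto x atTop (𝓝 (⨅ M, κ M)) := by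
  refine tendsto_order.2 ⟨fun a ha => ?_, fun a ha => ?_⟩
  · obtain ⟨r, har, hr⟩ := EReal.lt_iff_exists_real_btwn.1 ha
    obtain ⟨M, hM⟩ := exists_nat_gt (-r)
    filter_upwards [(tendsto_order.1 (h M)).1 r (hr.trans_le (iInf_le _ M))] with n hn
    rcases lt_max_iff.1 hn with h1 | h1
    · exact har.trans h1
    · rw [EReal.coe_lt_coe_iff] at h1
      linarith
  · obtain ⟨M, hM⟩ := iInf_lt_iff.1 ha
    filter_upwards [(tendsto_order.1 (h M)).2 a hM] with n hn
    exact (le_max_left _ _).trans_lt hn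

/-- The truncations `max f (-M N)` converge to `f` in mean, so that a deep enough truncation still
has negative integral. -/
theorem exists_integral_max_add_lt [MeasurableSpace Ω] {P : Measure Ω} [IsProbabilityMeasure P]
    {f : Ω → ℝ} (hf : Integrable f P) (hneg : ∫ ω, f ω ∂P < 0) {N : ℕ} (hN : 0 < N) :
    ∃ M : ℕ, ∫ ω, max (f ω + M * N) 0 ∂P < M * N := by
  have hN' : (1 : ℝ) ≤ N := by exact_mod_cast hN
  have hlim : Tendsto (fun M : ℕ => ∫ ω, max (f ω) (-(M * N : ℝ)) ∂P) atTop (𝓝 (∫ ω, f ω ∂P)) := by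
    refine tendsto_integral_of_dominated_convergence (fun ω => |f ω|)
      (fun M => (hf.sup (integrable_const _)).aestronglyMeasurable) hf.abs
      (fun M => Eventually.of_forall fun ω => ?_) (Eventually.of_forall fun ω => ?_)
    · have : (0 : ℝ) ≤ M * N := by positivity
      rw [Real.norm_eq_abs, abs_le]
      exact ⟨(neg_abs_le _).trans (le_max_left _ _),
        max_le (le_abs_self _) ((neg_nonpos.2 this).trans (abs_nonneg _))⟩
    · obtain ⟨M₀, hM₀⟩ := exists_nat_ge (-f ω)
      refine tendsto_const_nhds.congr' ?_
      filter_upwards [eventually_ge_atTop M₀] with M hM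
      have h1 : (M₀ : ℝ) ≤ M := by exact_mod_cast hM
      have h2 : (M : ℝ) ≤ M * N := le_mul_of_one_le_right (Nat.cast_nonneg M) hN'
      rw [max_eq_left]
      linarith
  obtain ⟨M, hM⟩ := ((tendsto_order.1 hlim).2 0 hneg).exists
  refine ⟨M, ?_⟩
  have e : ∀ ω, max (f ω + M * N) 0 = max (f ω) (-(M * N : ℝ)) + M * N := fun ω => by
    rw [← max_add_add_right]; simp
  have hi : Integrable (fun ω => max (f ω) (-(M * N : ℝ))) P := hf.sup (integrable_const _)
  simp only [e]
  rw [integral_add hi (integrable_const _)]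
  simpa using hM

theorem integrable_posLog_norm_cocycle [MeasurableSpace Ω] {P : Measure Ω} {σ : Ω → Ω}
    (hσ : MeasurePreserving σ P P) {L : Ω → X →L[ℝ] X} (hL : StronglyMeasurable L)
    (hlog : Integrable (fun ω => Real.posLog ‖L ω‖) P) (N : ℕ) :
    Integrable (fun ω => Real.posLog ‖cocycle σ L N ω‖) P := by
  refine Integrable.mono' (integral_birkhoffSum hσ hlog N).1
    (Real.continuous_posLog.measurable.comp (stronglyMeasurable_cocycle hσ.measurable hL
      N).norm.measurable).aestronglyMeasurable (Eventually.of_forall fun ω => ?_)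
  rw [Real.norm_of_nonneg Real.posLog_nonneg]
  induction N with
  | zero =>
    rw [birkhoffSum_zero, (Real.posLog_eq_zero_iff _).2]
    rw [abs_of_nonneg (norm_nonneg _)]
    exact ContinuousLinearMap.norm_id_le
  | succ N ih =>
    have h1 : ‖cocycle σ L (N + 1) ω‖ ≤ ‖L (σ^[N] ω)‖ * ‖cocycle σ L N ω‖ :=
      ContinuousLinearMap.opNorm_comp_le (L (σ^[N] ω)) (cocycle σ L N ω)
    rw [birkhoffSum_succ, add_comm (birkhoffSum σ _ N ω)]
    exact (Real.posLog_le_posLog (norm_nonneg _) h1).trans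
      (Real.posLog_mul.trans (add_le_add le_rfl ih))

end Exponent

/-! ### The exponents of a random Jabłoński map. -/

section RandomMap

variable {Ω : Type*} [TopologicalSpace Ω] [MeasurableSpace Ω] {P : Measure Ω}
  {σ : Ω → Ω} {d : ℕ} {B : Grid (d + 1)} {F : Ω → B.JablonskiMap}

/-- A measurable version of the logarithm of the smallest slope. -/
theorem IsAdmissible.exists_measurable_logSlope (hF : IsAdmissible P F)
    (hσ : MeasurePreserving σ P P) :
    ∃ G : Ω → ℝ, Measurable G ∧ Integrable G P ∧ 0 < ∫ ω, G ω ∂P ∧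
      ∀ᵐ ω ∂P, IsRegular σ F ω ∧ ∀ N, birkhoffSum σ G N ω = birkhoffSum σ (logSlope F) N ω := by
  obtain ⟨γ, hγ, hlt⟩ := hF.expanding
  have hpos : 0 < ∫ ω, logSlope F ω ∂P := hγ.trans hlt
  -- A function that is not integrable would have integral 0 by convention, against positivity.
  have hi : Integrable (logSlope F) P := by
    by_contra h
    exact hpos.ne' (integral_undef h)
  set G := hi.aestronglyMeasurable.mk (logSlope F)
  have hae : logSlope F =ᵐ[P] G := hi.aestronglyMeasurable.ae_eq_mk
  refine ⟨G, hi.aestronglyMeasurable.stronglyMeasurable_mk.measurable, hi.congr hae,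
    (integral_congr_ae hae) ▸ hpos, ?_⟩
  have h : ∀ j : ℕ, ∀ᵐ ω ∂P, logSlope F (σ^[j] ω) = G (σ^[j] ω) := fun j =>
    (hσ.iterate j).quasiMeasurePreserving.ae hae
  filter_upwards [hF.ae_isRegular hσ, ae_all_iff.2 h] with ω h1 h2
  exact ⟨h1, fun N => Finset.sum_congr rfl fun j _ => (h2 j).symm⟩

/-- Each truncation of the exponent at `-M` has a limit by subadditivity, and the infimum over `M`
is the exponent. One value of `M` is enough to see that it is negative. -/
theorem exists_hasCompactnessExponent [PolishSpace Ω] [BorelSpace Ω]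
    [IsProbabilityMeasure P] (hσ : Ergodic σ P)
    (hF : IsAdmissible P F) (hlog : Integrable (fun ω => Real.posLog ‖generator F ω‖) P) :
    ∃ κ : EReal, HasCompactnessExponent P σ (generator F) κ ∧ κ < 0 := by
  obtain ⟨G, hGm, hGi, hG, hae⟩ := hF.exists_measurable_logSlope hσ.toMeasurePreserving
  have hL := hF.pContinuous.stronglyMeasurable
  choose c hc hcN using fun M : ℕ => exists_tendsto_logGrowth hσ hL hlog
    continuous_indexOfCompactness indexOfCompactness_nonneg
    ((indexOfCompactness_le_norm _).trans ContinuousLinearMap.norm_id_le)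
    indexOfCompactness_comp_le (Eventually.of_forall fun ω =>
      (indexOfCompactness_le_norm _).trans (le_add_of_nonneg_left zero_le_one))
    (Real.exp_pos M).le
  refine ⟨⨅ M : ℕ, ((c M - M : ℝ) : EReal), ?_, ?_⟩
  · filter_upwards [ae_all_iff.2 hc] with ω hω
    refine tendsto_iInf_of_tendsto_max fun M => ?_
    refine (continuous_coe_real_ereal.tendsto _ |>.comp ((hω M).sub_const (M : ℝ))).congr' ?_
    filter_upwards [eventually_gt_atTop 0] with n hn
    exact (max_inv_mul_log_ofReal (indexOfCompactness_nonneg _) hn M).symm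
  -- The number 4 is the product of the factor 2 of the Lasota–Yorke inequality and the factor 2 of
  -- the index of compactness.
  · obtain ⟨N, hN⟩ := exists_nat_gt (Real.log 4 / ∫ ω, G ω ∂P)
    have hN0 : 0 < N := Nat.cast_pos.1
      ((div_pos (Real.log_pos (by norm_num)) hG).trans hN)
    obtain ⟨hSi, hS⟩ := integral_birkhoffSum hσ.toMeasurePreserving hGi N
    obtain ⟨M, hM⟩ := exists_integral_max_add_lt (f := fun ω => Real.log 4 - birkhoffSum σ G N ω)
      ((integrable_const _).sub hSi) (by
        rw [integral_sub (integrable_const _) hSi, hS]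
        rw [div_lt_iff₀ hG] at hN
        simpa using hN) hN0
    have h1 := hcN M N hN0 _ ((((integrable_const _).sub hSi).add
      (integrable_const (M * N : ℝ))).sup (integrable_zero Ω ℝ P)) (by
        filter_upwards [hae] with ω hω
        obtain ⟨C, hC⟩ := hω.1.exists_var_cocycle_le N
        rw [← hω.2 N] at hC
        have h2 := indexOfCompactness_le_of_var_le (by positivity) hC
          (hω.1.norm_toL1_cocycle_le N)
        have h3 : indexOfCompactness (cocycle σ (generator F) N ω) * Real.exp M ^ N
            ≤ Real.exp (Real.log 4 - birkhoffSum σ G N ω + M * N) := by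
          refine (mul_le_mul_of_nonneg_right h2 (by positivity)).trans_eq ?_
          rw [sub_eq_add_neg, Real.exp_add, Real.exp_add, Real.exp_log (by norm_num),
            ← Real.exp_nat_mul, mul_comm (N : ℝ)]
          ring
        refine (Real.posLog_le_posLog (mul_nonneg (indexOfCompactness_nonneg _)
          (by positivity)) h3).trans_eq ?_
        rw [Real.posLog, Real.log_exp, max_comm]
        rfl)
    refine (iInf_le _ M).trans_lt ?_
    have h2 : c M * N < M * N := h1.trans_lt hM
    rw [← EReal.coe_zero, EReal.coe_lt_coe_iff]
    have := lt_of_mul_lt_mul_right h2 (Nat.cast_nonneg N)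
    linarith

/-- First `N` is chosen so that `∫ max (log 2 - S_N) 0 < ε N`, then `K` so large that the remainder
of the inequality hardly contributes to the logarithm of the weighted norm. -/
theorem exists_wopNorm_exponent_lt [PolishSpace Ω] [BorelSpace Ω]
    [IsProbabilityMeasure P] (hσ : Ergodic σ P)
    (hF : IsAdmissible P F) (hlog : Integrable (fun ω => Real.posLog ‖generator F ω‖) P)
    {ε : ℝ} (hε : 0 < ε) :
    ∃ K : ℝ, 1 ≤ K ∧ ∃ c < ε, ∀ᵐ ω ∂P, Tendsto (fun n : ℕ =>
      Real.posLog (BV.wopNorm K (cocycle σ (generator F) n ω)) / n) atTop (𝓝 c) := by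
  obtain ⟨G, hGm, hGi, hG, hae⟩ := hF.exists_measurable_logSlope hσ.toMeasurePreserving
  have hL := hF.pContinuous.stronglyMeasurable
  obtain ⟨N, hN0, hN⟩ := exists_integral_max_sub_birkhoffSum_lt hσ hGm hGi hG (Real.log 2) hε 0
  set A := cocycle σ (generator F) N with hA
  set S := birkhoffSum σ G N with hS
  have hAm : StronglyMeasurable A := stronglyMeasurable_cocycle hσ.measurable hL N
  obtain ⟨hSi, -⟩ := integral_birkhoffSum hσ.toMeasurePreserving hGi N
  have hSm : Measurable S :=
    Finset.measurable_fun_sum _ fun j _ => hGm.comp (hσ.measurable.iterate j)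
  obtain ⟨C, hCm, hC0, hC⟩ := BV.exists_measurable_var_le hAm
    (a := fun ω => 2 * Real.exp (-S ω)) ((Real.measurable_exp.comp hSm.neg).const_mul 2)
  set D : Ω → ℝ := fun ω => Real.log (1 + ‖A ω‖) with hD
  set R : Ω → ℝ := fun ω => max (Real.log 2 - S ω) 0 with hR
  have hRi : Integrable R P := ((integrable_const _).sub hSi).sup (integrable_zero Ω ℝ P)
  have hD0 : ∀ ω, 0 ≤ D ω := fun ω => Real.log_nonneg (by linarith [norm_nonneg (A ω)])
  have hDi : Integrable D P := by
    refine Integrable.mono' ((integrable_posLog_norm_cocycle hσ.toMeasurePreserving hL hlog N).add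
      (integrable_const (Real.log 2)))
      (Real.measurable_log.comp (hAm.norm.measurable.const_add 1)).aestronglyMeasurable
      (Eventually.of_forall fun ω => ?_)
    rw [Real.norm_of_nonneg (hD0 ω)]
    have h1 := Real.posLog_add (x := 1) (y := ‖A ω‖)
    have h2 : Real.posLog (1 : ℝ) = 0 := (Real.posLog_eq_zero_iff 1).2 (by simp)
    have h3 : D ω ≤ Real.posLog (1 + ‖A ω‖) := le_max_right _ _
    simp only [Pi.add_apply]
    linarith
  -- The logarithm of the remainder `C` is not known to be integrable. The minimum with `D`, an
  -- integrable bound that does not depend on the weight `k + 1`, permits dominated convergence.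
  set φ : ℕ → Ω → ℝ := fun k ω => min (D ω) (max (R ω) (Real.log (1 + C ω / (k + 1)))) with hφ
  have hφm : ∀ k, AEStronglyMeasurable (φ k) P := fun k =>
    hDi.aestronglyMeasurable.inf (hRi.aestronglyMeasurable.sup (Real.measurable_log.comp
      ((hCm.div_const _).const_add 1)).aestronglyMeasurable)
  have hφb : ∀ k ω, ‖φ k ω‖ ≤ D ω := fun k ω => by
    rw [Real.norm_of_nonneg (le_min (hD0 ω) (le_max_of_le_left (le_max_right _ _)))]
    exact min_le_left _ _
  have hlim : Tendsto (fun k => ∫ ω, φ k ω ∂P) atTop (𝓝 (∫ ω, min (D ω) (R ω) ∂P)) := by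
    refine tendsto_integral_of_dominated_convergence D hφm hDi
      (fun k => Eventually.of_forall (hφb k)) (Eventually.of_forall fun ω => ?_)
    have h1 : Tendsto (fun k : ℕ => Real.log (1 + C ω / (k + 1))) atTop (𝓝 (Real.log (1 + 0))) := by
      refine Tendsto.log (tendsto_const_nhds.add ?_) (by norm_num)
      have := (tendsto_one_div_add_atTop_nhds_zero_nat (𝕜 := ℝ)).const_mul (C ω)
      simpa [div_eq_mul_inv] using this
    rw [add_zero, Real.log_one] at h1
    have h2 := (tendsto_const_nhds (x := D ω)).min ((tendsto_const_nhds (x := R ω)).max h1)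
    rwa [max_eq_left (le_max_right _ _ : 0 ≤ R ω)] at h2
  have hlt : ∫ ω, min (D ω) (R ω) ∂P < ε * N :=
    (integral_mono (hDi.inf hRi) hRi fun ω => min_le_right _ _).trans_lt hN
  obtain ⟨k, hk⟩ := ((tendsto_order.1 hlim).2 _ hlt).exists
  have hK : (1 : ℝ) ≤ k + 1 := by linarith [(Nat.cast_nonneg k : (0 : ℝ) ≤ k)]
  obtain ⟨c, hc, hcN⟩ := exists_tendsto_logGrowth hσ hL hlog (BV.continuous_wopNorm hK)
    (BV.wopNorm_nonneg _) (BV.wopNorm_id_le _) (BV.wopNorm_comp_le hK)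
    (hae.mono fun ω hω => BV.wopNorm_le_one_add_norm hK (hω.1.norm_toL1_cocycle_le 1)) zero_le_one
  refine ⟨k + 1, hK, c, ?_, ?_⟩
  · have h1 := hcN N hN0 (φ k) (Integrable.mono' hDi (hφm k)
      (Eventually.of_forall (hφb k))) (by
        filter_upwards [hae] with ω hω
        have hex := hω.1.exists_var_cocycle_le N
        rw [← hω.2 N] at hex
        have hnn := BV.wopNorm_nonneg (k + 1) (A ω)
        have hLc := hω.1.norm_toL1_cocycle_le N
        rw [logGrowth, one_pow, mul_one]
        refine le_min ?_ ?_
        · refine (Real.posLog_le_posLog hnn (BV.wopNorm_le_one_add_norm hK hLc)).trans_eq ?_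
          exact Real.posLog_eq_log (by
            rw [abs_of_nonneg (by positivity)]
            linarith [norm_nonneg (A ω)])
        · have h2 := BV.wopNorm_le_max hK (hC0 ω).le hLc (hC ω hex)
          have h3 : 0 ≤ Real.log (1 + C ω / (k + 1)) :=
            Real.log_nonneg (le_add_of_nonneg_right (div_nonneg (hC0 ω).le (by positivity)))
          refine (Real.posLog_le_posLog hnn h2).trans ?_
          rcases max_choice (2 * Real.exp (-S ω)) (1 + C ω / (k + 1)) with e | e
          · rw [e, Real.posLog, Real.log_mul two_ne_zero (Real.exp_pos _).ne', Real.log_exp,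
              max_comm, ← sub_eq_add_neg]
            exact le_max_left _ _
          · rw [e, Real.posLog, max_eq_right h3]
            exact le_max_right _ _)
    exact lt_of_mul_lt_mul_right (h1.trans_lt hk) (Nat.cast_nonneg N)
  · simpa only [logGrowth, one_pow, mul_one] using hc

/-- The norm is at least 1 along the cocycle. It is at most `K` times the weighted norm, whose
exponent is below any given `ε`, and the factor `K` has no exponential effect. -/
theorem hasMaxLyapunovExponent_zero [PolishSpace Ω] [BorelSpace Ω]
    [IsProbabilityMeasure P] (hσ : Ergodic σ P)
    (hF : IsAdmissible P F) (hlog : Integrable (fun ω => Real.posLog ‖generator F ω‖) P) :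
    HasMaxLyapunovExponent P σ (generator F) 0 := by
  choose K hK c hc hlim using fun j : ℕ =>
    exists_wopNorm_exponent_lt hσ hF hlog (Nat.one_div_pos_of_nat (α := ℝ) (n := j))
  filter_upwards [hF.ae_isRegular hσ.toMeasurePreserving, ae_all_iff.2 hlim] with ω hω hω'
  have h1 : ∀ n, 1 ≤ ‖cocycle σ (generator F) n ω‖ := hω.one_le_norm_cocycle
  have hreal : Tendsto (fun n : ℕ => Real.log ‖cocycle σ (generator F) n ω‖ / n) atTop (𝓝 0) := by
    refine tendsto_order.2 ⟨fun a ha => Eventually.of_forall fun n =>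
      ha.trans_le (div_nonneg (Real.log_nonneg (h1 n)) (Nat.cast_nonneg n)), fun a ha => ?_⟩
    obtain ⟨j, hj⟩ := exists_nat_one_div_lt ha
    have h2 : Tendsto (fun n : ℕ => Real.posLog (K j) / n
        + Real.posLog (BV.wopNorm (K j) (cocycle σ (generator F) n ω)) / n) atTop
        (𝓝 (0 + c j)) :=
      (tendsto_const_nhds.div_atTop tendsto_natCast_atTop_atTop).add (hω' j)
    rw [zero_add] at h2
    filter_upwards [(tendsto_order.1 h2).2 a ((hc j).trans hj)] with n hn
    refine lt_of_le_of_lt ?_ hn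
    rw [← add_div]
    refine div_le_div_of_nonneg_right ?_ (Nat.cast_nonneg n)
    exact (le_max_right _ _).trans ((Real.posLog_le_posLog (norm_nonneg _)
      (BV.norm_le_wopNorm (hK j) _)).trans Real.posLog_mul)
  refine ((continuous_coe_real_ereal.tendsto 0).comp hreal).congr fun n => ?_
  exact (inv_mul_log_ofReal (zero_lt_one.trans_le (h1 n)) n).symm

/-- With `α₁ = 2 exp(-S_N)` the mean of `log α₁` is `log 2 - N ∫ G`, negative for large `N`. -/
theorem exists_lasotaYorke [PolishSpace Ω] [BorelSpace Ω]
    [IsProbabilityMeasure P] (hσ : Ergodic σ P)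
    (hF : IsAdmissible P F) :
    ∃ N : ℕ, 0 < N ∧ ∃ α₁ α₂ : Ω → ℝ, Measurable α₁ ∧ Measurable α₂ ∧
      (∀ ω, 0 < α₁ ω) ∧ (∀ ω, 0 < α₂ ω) ∧
      Integrable (fun ω => Real.log (α₁ ω)) P ∧ ∫ ω, Real.log (α₁ ω) ∂P < 0 ∧
      ∀ᵐ ω ∂P, ∀ h : BV d, (cocycle σ (generator F) N ω h).var ≤
        α₁ ω * h.var + α₂ ω * ‖h.toL1‖ := by
  obtain ⟨G, hGm, hGi, hG, hae⟩ := hF.exists_measurable_logSlope hσ.toMeasurePreserving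
  obtain ⟨N, hN⟩ := exists_nat_gt (Real.log 2 / ∫ ω, G ω ∂P)
  have hN0 : 0 < N := Nat.cast_pos.1 ((div_pos (Real.log_pos (by norm_num)) hG).trans hN)
  obtain ⟨hSi, hS⟩ := integral_birkhoffSum hσ.toMeasurePreserving hGi N
  have hSm : Measurable (birkhoffSum σ G N) :=
    Finset.measurable_fun_sum _ fun j _ => hGm.comp (hσ.measurable.iterate j)
  have hα : Measurable fun ω => 2 * Real.exp (-birkhoffSum σ G N ω) :=
    (Real.measurable_exp.comp hSm.neg).const_mul 2
  obtain ⟨C, hCm, hC0, hC⟩ := BV.exists_measurable_var_le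
    (stronglyMeasurable_cocycle hσ.measurable hF.pContinuous.stronglyMeasurable N) hα
  have e : (fun ω => Real.log (2 * Real.exp (-birkhoffSum σ G N ω)))
      = fun ω => Real.log 2 - birkhoffSum σ G N ω := funext fun ω => by
    rw [Real.log_mul two_ne_zero (Real.exp_pos _).ne', Real.log_exp, sub_eq_add_neg]
  refine ⟨N, hN0, _, C, hα, hCm, fun ω => by positivity, hC0, ?_, ?_, ?_⟩
  · rw [e]
    exact (integrable_const _).sub hSi
  · rw [e, integral_sub (integrable_const _) hSi, hS]
    rw [div_lt_iff₀ hG] at hN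
    simpa using hN
  · filter_upwards [hae] with ω hω
    have hex := hω.1.exists_var_cocycle_le N
    rw [← hω.2 N] at hex
    exact hC ω hex

end RandomMap

end Jab

/-! ### Conclusion. -/

theorem theorem3p1 {Ω : Type*} [TopologicalSpace Ω] [PolishSpace Ω] [MeasurableSpace Ω]
    [BorelSpace Ω] (P : Measure Ω) [IsProbabilityMeasure P] (σ : Ω ≃ᵐ Ω) (hσ : Ergodic σ P)
    {d : ℕ} (B : Jab.Grid (d + 1)) (F : Ω → B.JablonskiMap) (hF : Jab.IsAdmissible P F)
    (hlog : Integrable (fun ω => Real.posLog ‖Jab.generator F ω‖) P) :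
    (∀ᵐ ω ∂P, Jab.IsTransferOperator (F ω).toFun (Jab.generator F ω)) ∧
    (∃ N : ℕ, 0 < N ∧ ∃ α₁ α₂ : Ω → ℝ, Measurable α₁ ∧ Measurable α₂ ∧
      (∀ ω, 0 < α₁ ω) ∧ (∀ ω, 0 < α₂ ω) ∧
      Integrable (fun ω => Real.log (α₁ ω)) P ∧ ∫ ω, Real.log (α₁ ω) ∂P < 0 ∧
      ∀ᵐ ω ∂P, ∀ h : Jab.BV d, (Jab.cocycle σ (Jab.generator F) N ω h).var ≤
        α₁ ω * h.var + α₂ ω * ‖h.toL1‖) ∧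
    Jab.IsQuasiCompact P σ (Jab.generator F) ∧
    Jab.HasMaxLyapunovExponent P σ (Jab.generator F) 0 := by
  obtain ⟨κ, hκ, hκ0⟩ := Jab.exists_hasCompactnessExponent hσ hF hlog
  have hlam := Jab.hasMaxLyapunovExponent_zero hσ hF hlog
  exact ⟨(hF.ae_isRegular hσ.toMeasurePreserving).mono fun ω hω => hω.isTransferOperator 0,
    Jab.exists_lasotaYorke hσ hF, ⟨κ, 0, hκ, hlam, hκ0⟩, hlam⟩
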